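/- **Notation.** Let $k\in\{0,1,2,\dots\}$, $0<\alpha\le 1$, $\nu\in\mathbb R$, and assume $\nu\ge 0$ if $\alpha=1$. For an open set $\Omega\subset\mathbb R^n$, let $C^{k,L^\alpha Log^\nu L}(\Omega)$ be the space of complex-valued $f\in C^k(\Omega)$ with $$\|f\|_{C^{k,L^\alpha Log^\nu L}(\Omega)}:=\sum_{|\gamma|\le k}\ \sup_{w\in\Omega}|D^\gamma f(w)|+\sum_{|\gamma|=k}\ \sup_{\substack{w,\,w+h\in\Omega\\ 0<|h|\le 1/2}}\frac{|D^\gamma f(w+h)-D^\gamma f(w)|}{|h|^\alpha\,|\ln|h||^\nu}<\infty .$$ **Theorem.** Let $D\subset\mathbb C$ be a bounded domain whose boundary is of class $C^{m,\alpha}$, i.e. consists of finitely many pairwise disjoint regular Jordan curves of class $C^{m,\alpha}$, with $D$ on exactly one side of each of them, where $m=\max(k,1)$ if $\nu\ge -1$ and $m=k+1$ if $\nu<-1$. Let $\Lambda$ be an open set in $\mathbb R$ or $\mathbb C$. If $k\ge 2$, assume also that there are constants $M,\delta>0$ such that any two points $\lambda,\lambda'\in\Lambda$ with $|\lambda-\lambda'|<\delta$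 can be joined in $\Lambda$ by a path of length at most $M|\lambda-\lambda'|$. Put $\Omega=D\times\Lambda$. Then there is a constant $C$, depending only on $\Omega,k,\alpha$ and $\nu$, such that the following holds for every $f\in C^{k,L^\alpha Log^\nu L}(\Omega)$. For each $\lambda\in\Lambda$ and $\zeta\in\partial D$ the boundary value $f(\zeta,\lambda)=\lim_{D\ni z\to\zeta}f(z,\lambda)$ exists. The Cauchy singular integral along the slice $D$, $$Sf(z,\lambda)=\frac1{2\pi i}\int_{\partial D}\frac{f(\zeta,\lambda)}{\zeta-z}\,d\zeta,\qquad (z,\lambda)\in\Omega,$$ with $\partial D$ positively oriented ($D$ on the left), is well defined. Moreover $Sf\in C^{k,L^\alpha Log^{\nu+1}L}(\Omega)$ and $$\|Sf\|_{C^{k,L^\alpha Log^{\nu+1}L}(\Omega)}\le C\,\|f\|_{C^{k,L^\alpha Log^\nu L}(\Omega)} .$$ -/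

import Mathlib

open Set Filter
open scoped ENNReal NNReal Topology

noncomputable section

/-! ### Log-Hölder spaces on subsets of `ℂ × 𝕜`, where `𝕜` is `ℝ` or `ℂ` -/

section LogHolder

variable {𝕜 : Type*} [RCLike 𝕜]

/-- The Euclidean distance on `ℂ × 𝕜`, viewed as `ℝ³` (if `𝕜 = ℝ`) or `ℝ⁴` (if `𝕜 = ℂ`).
(The distance that `ℂ × 𝕜` carries by default is the maximum distance.) -/
def euclidDist (w w' : ℂ × 𝕜) : ℝ :=
  √(‖w'.1 - w.1‖ ^ 2 + ‖w'.2 - w.2‖ ^ 2)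

/-- The real coordinate directions of `ℂ × 𝕜`. If `𝕜 = ℝ` then `RCLike.I = 0`, so the fourth
vector is `0`: derivatives in this direction vanish, and only the three real coordinates of
`ℂ × ℝ` count. -/
def coordDir (𝕜 : Type*) [RCLike 𝕜] : Fin 4 → ℂ × 𝕜 :=
  ![(1, 0), (Complex.I, 0), (0, 1), (0, RCLike.I)]

/-- First order real partial derivative in the coordinate direction number `i`. -/
def coordDeriv (i : Fin 4) (g : ℂ × 𝕜 → ℂ) : ℂ × 𝕜 → ℂ :=
  fun w => fderiv ℝ g w (coordDir 𝕜 i)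

/-- The real partial derivative `D^γ f` for the multi-index `γ`. -/
def partialDeriv (γ : Fin 4 → ℕ) (f : ℂ × 𝕜 → ℂ) : ℂ × 𝕜 → ℂ :=
  (coordDeriv 0)^[γ 0] ((coordDeriv 1)^[γ 1] ((coordDeriv 2)^[γ 2] ((coordDeriv 3)^[γ 3] f)))

/-- `sup_{w ∈ Ω} |g w|`. -/
def supNormOn (Ω : Set (ℂ × 𝕜)) (g : ℂ × 𝕜 → ℂ) : ℝ≥0∞ :=
  ⨆ w ∈ Ω, ‖g w‖ₑ

/-- The seminorm `H^ν[g]`: the supremum of `|g (w + h) - g w| / (|h|^α |ln |h||^ν)` over all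
`w, w + h ∈ Ω` with `0 < |h| ≤ 1/2`. -/
def logHolderSeminorm (α ν : ℝ) (Ω : Set (ℂ × 𝕜)) (g : ℂ × 𝕜 → ℂ) : ℝ≥0∞ :=
  ⨆ (w ∈ Ω) (w' ∈ Ω) (_ : 0 < euclidDist w w' ∧ euclidDist w w' ≤ 1 / 2),
    ‖g w' - g w‖ₑ /
      ENNReal.ofReal (euclidDist w w' ^ α * |Real.log (euclidDist w w')| ^ ν)

/-- The norm of `C^{k, L^α Log^ν L}(Ω)`: the suprema of all partial derivatives of order `≤ k`
plus the seminorms of all partial derivatives of order `k`.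
(`Finset.Nat.antidiagonalTuple 4 j` is the set of multi-indices `γ` with `|γ| = j`.) -/
def logHolderNorm (k : ℕ) (α ν : ℝ) (Ω : Set (ℂ × 𝕜)) (f : ℂ × 𝕜 → ℂ) : ℝ≥0∞ :=
  (∑ j ∈ Finset.range (k + 1), ∑ γ ∈ Finset.Nat.antidiagonalTuple 4 j,
      supNormOn Ω (partialDeriv γ f)) +
    ∑ γ ∈ Finset.Nat.antidiagonalTuple 4 k, logHolderSeminorm α ν Ω (partialDeriv γ f)

/-- `f ∈ C^{k, L^α Log^ν L}(Ω)`, for `Ω` open. Only the values of `f` on `Ω` matter. -/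
def MemLogHolder (k : ℕ) (α ν : ℝ) (Ω : Set (ℂ × 𝕜)) (f : ℂ × 𝕜 → ℂ) : Prop :=
  ContDiffOn ℝ k f Ω ∧ logHolderNorm k α ν Ω f < ∞

/-- Points of `Λ` that are close to each other can be joined inside `Λ` by a path (parametrized
by `[0, 1]`) whose length is at most a constant multiple of their distance. -/
def LocallyQuasiconvex (Λ : Set 𝕜) : Prop :=
  ∃ (M : ℝ≥0) (δ : ℝ), 0 < δ ∧ ∀ x ∈ Λ, ∀ y ∈ Λ, dist x y < δ →
    ∃ p : ℝ → 𝕜, p 0 = x ∧ p 1 = y ∧ (∀ t ∈ Icc (0 : ℝ) 1, p t ∈ Λ) ∧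
      LipschitzOnWith (M * nndist x y) p (Icc 0 1)

end LogHolder

/-! ### Plane domains with Hölder boundary and the Cauchy singular integral -/

/-- A positively oriented parametrization of the boundary of the plane domain `D` by finitely
many pairwise disjoint regular Jordan curves of class `C^{m, α}` (with `1 ≤ m`). The domain `D`
has `C^{m, α}` boundary if there is one. -/
structure BoundaryParametrization (D : Set ℂ) (m : ℕ) (α : ℝ) where
  /-- the number of boundary curves -/
  n : ℕ
  /-- the period of the parametrization of each curve -/
  period : Fin n → ℝ
  /-- the curves -/
  curve : Fin n → ℝ → ℂ
  period_pos : ∀ j, 0 < period j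
  periodic : ∀ j, Function.Periodic (curve j) (period j)
  injOn : ∀ j, InjOn (curve j) (Ico 0 (period j))
  disjoint : Pairwise fun i j => Disjoint (range (curve i)) (range (curve j))
  contDiff : ∀ j, ContDiff ℝ m (curve j)
  holder : ∀ j, ∃ M : ℝ, ∀ s t,
    ‖iteratedDeriv m (curve j) s - iteratedDeriv m (curve j) t‖ ≤ M * |s - t| ^ α
  deriv_ne_zero : ∀ j t, deriv (curve j) t ≠ 0
  frontier_eq : frontier D = ⋃ j, range (curve j)
  /-- `D` lies immediately to the left of each curve, and the exterior of `D` to its right -/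
  left_right : ∀ j t, ∀ᶠ ε : ℝ in 𝓝[>] 0,
    curve j t + ε * (Complex.I * deriv (curve j) t) ∈ D ∧
    curve j t - ε * (Complex.I * deriv (curve j) t) ∉ closure D

namespace BoundaryParametrization

variable {D : Set ℂ} {m : ℕ} {α : ℝ}

/-- `g` is integrable along `∂D`. -/
def ContourIntegrable (Γ : BoundaryParametrization D m α) (g : ℂ → ℂ) : Prop :=
  ∀ j, IntervalIntegrable (fun t => g (Γ.curve j t) * deriv (Γ.curve j) t)
    MeasureTheory.volume 0 (Γ.period j)

/-- The contour integral `∫_{∂D} g(ζ) dζ`. -/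
def contourIntegral (Γ : BoundaryParametrization D m α) (g : ℂ → ℂ) : ℂ :=
  ∑ j, ∫ t in (0 : ℝ)..Γ.period j, g (Γ.curve j t) * deriv (Γ.curve j) t

end BoundaryParametrization

/-- The boundary value at `ζ ∈ ∂D` of the slice `f(·, l)` of a function `f` on `D × Λ`: the
limit of `f(z, l)` as `z → ζ` inside `D`. -/
def boundaryValue {𝕜 : Type*} (D : Set ℂ) (f : ℂ × 𝕜 → ℂ) (ζ : ℂ) (l : 𝕜) : ℂ :=
  extendFrom D (fun z => f (z, l)) ζ

/-- The integrand `f(ζ, l) / (ζ - z)` of the Cauchy singular integral, `ζ ∈ ∂D`. -/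
def cauchyIntegrand {𝕜 : Type*} (D : Set ℂ) (f : ℂ × 𝕜 → ℂ) (z : ℂ) (l : 𝕜) (ζ : ℂ) : ℂ :=
  boundaryValue D f ζ l / (ζ - z)

/-- The Cauchy singular integral along the slice `D` with parameter:
`S f (z, l) = (2πi)⁻¹ ∫_{∂D} f(ζ, l) / (ζ - z) dζ`. -/
def cauchyS {𝕜 : Type*} {D : Set ℂ} {m : ℕ} {α : ℝ} (Γ : BoundaryParametrization D m α)
    (f : ℂ × 𝕜 → ℂ) : ℂ × 𝕜 → ℂ :=
  fun w => (2 * Real.pi * Complex.I)⁻¹ * Γ.contourIntegral (cauchyIntegrand D f w.1 w.2)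

/-- The order of differentiability required of the boundary of `D`: the boundary is of class
`C^{max(k, 1), α}` if `ν ≥ -1` and of class `C^{k + 1, α}` if `ν < -1`. -/
def boundaryOrder (k : ℕ) (ν : ℝ) : ℕ :=
  open Classical in if ν < -1 then k + 1 else max k 1

end

/-! The Cauchy integral `S f` is holomorphic in `z`, and a derivative of order `k` of `S f` is again
a Cauchy integral: a `z`-derivative moves, by integration by parts along the closed boundary curves,
to the tangential derivative `d/dζ` of the boundary values, and an `l`-derivative is taken under the
integral sign. So `D^γ S f` is, up to a constant factor, the Cauchy integral of a linear combination
of boundary values of derivatives of `f` of order at most `|γ|`, with coefficients built from the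
derivatives of the boundary curves (`BoundaryOp`, `BoundaryOp.partialDeriv_eq_cauchyOp`). The
class `C^{m, α}` of the boundary is what makes these coefficients Hölder continuous, or Lipschitz
continuous if `ν < -1`.

The boundary values exist and inherit the moduli of continuity of the derivatives of `f`
(`BoundaryParametrization.exists_isBoundaryJet`). A uniform interior cone condition serves to compare
points of `D` along paths that avoid the boundary. In the parameter, derivatives of order `< k` are
Lipschitz continuous by the quasiconvexity of `Λ`. The exception is `f` itself for `0 < k`, for
which nothing is assumed if `k = 1`; but the terms of order zero in `D^γ S f` vanish for `γ ≠ 0`,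
since the coefficient of `f` in `S f` is constant (`BoundaryOp.Admissible`).

The estimates rest on the subtraction of the value of the density at the nearest boundary point,
which bounds the integral of `a(ζ) / (ζ - z)^p` by the integral of `η(u) / (u + δ)^p`, where `η` is
the modulus of continuity of `a` and `δ` the distance of `z` to the boundary
(`BoundaryParametrization.norm_kern_le`). For `p = 2` and `η(u) = u^α |ln u|^ν` it gives the bound
`δ^(α - 1) |ln δ|^(ν + 1)` of the `z`-derivative (`exists_kern_two_bound`), which a Hardy–Littlewood
lemma turns into the modulus in `z` (`exists_holder_of_norm_deriv_le`). For `p = 1` it is applied to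
the increment in `l` of the density, with `h = |l - l'|`: this is bounded by `h^α |ln h|^ν` and, for
close boundary points, varies by much less, so that the integral of `du / u` is effectively taken
over `h ≤ u` only, whence one factor `|ln h|` (`exists_kern_one_bound_of_small`).

All constants are obtained for one parametrization of the boundary. They serve for every other one
since the contour integral does not depend on the parametrization
(`BoundaryParametrization.contourIntegral_eq`). -/

/-! ### Logarithmic moduli of continuity -/

/-- The modulus `t ^ α * |ln t| ^ μ`, meant for `0 < t ≤ 1 / 2`. -/
noncomputable def logMod (α μ t : ℝ) : ℝ := t ^ α * |Real.log t| ^ μ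

/-- The modulus `logMod α μ`, made constant for `t ≥ 1 / 2`, so that it is defined at all distances
and positive for `t > 0`. -/
noncomputable def cutMod (α μ t : ℝ) : ℝ := logMod α μ (min t (1 / 2))

lemma log_two_le_abs_log {t : ℝ} (h0 : 0 < t) (h1 : t ≤ 1 / 2) : Real.log 2 ≤ |Real.log t| := by
  have : Real.log t ≤ Real.log (1 / 2) := Real.log_le_log h0 h1
  rw [one_div, Real.log_inv] at this
  have h2 := Real.log_pos one_lt_two
  rw [abs_of_neg (by linarith)]
  linarith

lemma abs_log_pos {t : ℝ} (h0 : 0 < t) (h1 : t ≤ 1 / 2) : 0 < |Real.log t| :=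
  (Real.log_pos one_lt_two).trans_le (log_two_le_abs_log h0 h1)

lemma abs_log_eq_add {s t : ℝ} (h0 : 0 < s) (h1 : s ≤ t) (h2 : t ≤ 1 / 2) :
    |Real.log s| = |Real.log t| + Real.log (t / s) := by
  have ht : 0 < t := h0.trans_le h1
  rw [Real.log_div ht.ne' h0.ne', abs_of_nonpos (Real.log_nonpos h0.le (by linarith)),
    abs_of_nonpos (Real.log_nonpos ht.le (by linarith))]
  ring

/-- A power of the logarithm varies more slowly than any power. -/
lemma abs_log_rpow_le (μ : ℝ) {ε : ℝ} (hε : 0 < ε) :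
    ∃ C > 0, ∀ s t : ℝ, 0 < s → s ≤ t → t ≤ 1 / 2 →
      |Real.log s| ^ μ ≤ C * (t / s) ^ ε * |Real.log t| ^ μ := by
  rcases le_or_gt μ 0 with hμ | hμ
  · refine ⟨1, one_pos, fun s t h0 h1 h2 => ?_⟩
    have ht : 0 < t := h0.trans_le h1
    have h3 : 1 ≤ (t / s) ^ ε := Real.one_le_rpow ((one_le_div h0).2 h1) hε.le
    have h4 : |Real.log s| ^ μ ≤ |Real.log t| ^ μ := by
      apply Real.rpow_le_rpow_of_nonpos (abs_log_pos ht h2) _ hμ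
      rw [abs_log_eq_add h0 h1 h2]
      linarith [Real.log_nonneg ((one_le_div h0).2 h1)]
    have h5 : 0 ≤ |Real.log t| ^ μ := by positivity
    nlinarith
  · have hl := Real.log_pos one_lt_two
    have hq : 0 < ε / μ := by positivity
    refine ⟨(1 + 1 / (ε / μ * Real.log 2)) ^ μ, by positivity, fun s t h0 h1 h2 => ?_⟩
    have ht : 0 < t := h0.trans_le h1
    set x := t / s with hx
    have hx1 : 1 ≤ x := (one_le_div h0).2 h1
    have hx0 : 0 ≤ x := by linarith
    have h3 : 1 ≤ x ^ (ε / μ) := Real.one_le_rpow hx1 hq.le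
    have h4 : Real.log x ≤ x ^ (ε / μ) / (ε / μ) := Real.log_le_rpow_div hx0 hq
    have h5 := log_two_le_abs_log ht h2
    have h6 : |Real.log s| ≤ (1 + 1 / (ε / μ * Real.log 2)) * x ^ (ε / μ) * |Real.log t| := by
      rw [abs_log_eq_add h0 h1 h2]
      have e1 : |Real.log t| ≤ x ^ (ε / μ) * |Real.log t| := by nlinarith
      have e2 : x ^ (ε / μ) / (ε / μ) ≤
          1 / (ε / μ * Real.log 2) * x ^ (ε / μ) * |Real.log t| := by
        have : 1 / (ε / μ * Real.log 2) * x ^ (ε / μ) * |Real.log t| =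
            x ^ (ε / μ) / (ε / μ) * (|Real.log t| / Real.log 2) := by
          field_simp
        rw [this]
        apply le_mul_of_one_le_right (by positivity)
        exact (one_le_div hl).2 h5
      calc _ ≤ x ^ (ε / μ) * |Real.log t| +
            1 / (ε / μ * Real.log 2) * x ^ (ε / μ) * |Real.log t| := by linarith
        _ = _ := by ring
    calc |Real.log s| ^ μ
        ≤ ((1 + 1 / (ε / μ * Real.log 2)) * x ^ (ε / μ) * |Real.log t|) ^ μ :=
          Real.rpow_le_rpow (abs_nonneg _) h6 hμ.le
      _ = _ := by
          rw [Real.mul_rpow (by positivity) (by positivity),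
            Real.mul_rpow (by positivity) (by positivity), ← Real.rpow_mul hx0,
            div_mul_cancel₀ _ hμ.ne']

lemma logMod_le_of_le (α μ : ℝ) {ε : ℝ} (hε : 0 < ε) :
    ∃ C > 0, ∀ s t : ℝ, 0 < s → s ≤ t → t ≤ 1 / 2 →
      logMod α μ s ≤ C * (s / t) ^ (α - ε) * logMod α μ t := by
  obtain ⟨C, hC, h⟩ := abs_log_rpow_le μ hε
  refine ⟨C, hC, fun s t h0 h1 h2 => ?_⟩
  have ht : 0 < t := h0.trans_le h1
  unfold logMod
  calc s ^ α * |Real.log s| ^ μ ≤ s ^ α * (C * (t / s) ^ ε * |Real.log t| ^ μ) :=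
        mul_le_mul_of_nonneg_left (h s t h0 h1 h2) (by positivity)
    _ = _ := by
      rw [Real.rpow_sub (by positivity), Real.div_rpow h0.le ht.le, Real.div_rpow h0.le ht.le,
        Real.div_rpow ht.le h0.le]
      field_simp

lemma logMod_le_of_ge (α μ e : ℝ) (he : α < e ∨ α = e ∧ 0 ≤ μ) :
    ∃ C > 0, ∀ s t : ℝ, 0 < s → s ≤ t → t ≤ 1 / 2 →
      logMod α μ t ≤ C * (t / s) ^ e * logMod α μ s := by
  rcases he with he | ⟨he, hμ⟩
  · obtain ⟨C, hC, h⟩ := abs_log_rpow_le (-μ) (sub_pos.2 he)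
    refine ⟨C, hC, fun s t h0 h1 h2 => ?_⟩
    have ht : 0 < t := h0.trans_le h1
    have hls := abs_log_pos h0 (h1.trans h2)
    have hlt := abs_log_pos ht h2
    have h3 := h s t h0 h1 h2
    rw [Real.rpow_neg hls.le, Real.rpow_neg hlt.le] at h3
    have h4 : |Real.log t| ^ μ ≤ C * (t / s) ^ (e - α) * |Real.log s| ^ μ := by
      have p1 : 0 < |Real.log s| ^ μ := by positivity
      have p2 : 0 < |Real.log t| ^ μ := by positivity
      rw [inv_le_iff_one_le_mul₀ p1] at h3
      calc |Real.log t| ^ μ = 1 * |Real.log t| ^ μ := by ring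
        _ ≤ (|Real.log s| ^ μ * (C * (t / s) ^ (e - α) * (|Real.log t| ^ μ)⁻¹)) *
            |Real.log t| ^ μ := by gcongr; simpa [mul_comm] using h3
        _ = _ := by field_simp
    unfold logMod
    calc t ^ α * |Real.log t| ^ μ ≤ t ^ α * (C * (t / s) ^ (e - α) * |Real.log s| ^ μ) :=
          mul_le_mul_of_nonneg_left h4 (by positivity)
      _ = _ := by
        rw [Real.rpow_sub (by positivity), Real.div_rpow ht.le h0.le (x := t) (z := α)]
        field_simp
  · subst he
    refine ⟨1, one_pos, fun s t h0 h1 h2 => ?_⟩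
    have ht : 0 < t := h0.trans_le h1
    have h3 : |Real.log t| ^ μ ≤ |Real.log s| ^ μ := by
      apply Real.rpow_le_rpow (abs_nonneg _) _ hμ
      rw [abs_log_eq_add h0 h1 h2]
      linarith [Real.log_nonneg ((one_le_div h0).2 h1)]
    unfold logMod
    rw [Real.div_rpow ht.le h0.le, one_mul]
    have : t ^ α / s ^ α * (s ^ α * |Real.log s| ^ μ) = t ^ α * |Real.log s| ^ μ := by
      field_simp
    rw [this]
    gcongr

lemma logMod_pos {α μ t : ℝ} (h0 : 0 < t) (h1 : t ≤ 1 / 2) : 0 < logMod α μ t := by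
  have := abs_log_pos h0 h1
  unfold logMod; positivity

lemma cutMod_pos {α μ t : ℝ} (h0 : 0 < t) : 0 < cutMod α μ t :=
  logMod_pos (lt_min h0 (by norm_num)) (min_le_right _ _)

lemma cutMod_zero {α μ : ℝ} (hα : 0 < α) : cutMod α μ 0 = 0 := by
  simp [cutMod, logMod, Real.zero_rpow hα.ne']

lemma cutMod_nonneg {α μ t : ℝ} (hα : 0 < α) (h0 : 0 ≤ t) : 0 ≤ cutMod α μ t := by
  rcases h0.eq_or_lt with rfl | h
  · rw [cutMod_zero hα]
  · exact (cutMod_pos h).le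

lemma cutMod_eq {α μ t : ℝ} (h1 : t ≤ 1 / 2) : cutMod α μ t = logMod α μ t := by
  rw [cutMod, min_eq_left h1]

/-- The modulus is almost increasing, with a power to spare. -/
lemma cutMod_decay {α : ℝ} (hα : 0 < α) (μ : ℝ) :
    ∃ C > 0, ∀ s t : ℝ, 0 ≤ s → s ≤ t → 0 < t → t ≤ 1 / 2 →
      cutMod α μ s ≤ C * (s / t) ^ (α / 2) * cutMod α μ t := by
  obtain ⟨C, hC, h⟩ := logMod_le_of_le α μ (half_pos hα)
  refine ⟨C, hC, fun s t h0 h1 h2 h3 => ?_⟩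
  rcases h0.eq_or_lt with rfl | h0
  · rw [cutMod_zero hα]
    have := (cutMod_pos h2 : 0 < cutMod α μ t)
    positivity
  · have := h s t h0 h1 h3
    rwa [cutMod_eq (h1.trans h3), cutMod_eq h3, show α / 2 = α - α / 2 by ring]

lemma cutMod_mono {α : ℝ} (hα : 0 < α) (μ : ℝ) :
    ∃ C > 0, ∀ s t : ℝ, 0 ≤ s → s ≤ t → cutMod α μ s ≤ C * cutMod α μ t := by
  obtain ⟨C, hC, h⟩ := cutMod_decay hα μ
  refine ⟨C, hC, fun s t h0 h1 => ?_⟩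
  rcases (h0.trans h1).eq_or_lt with h2 | h2
  · have : s = 0 := le_antisymm (h2 ▸ h1) h0
    rw [this, ← h2, cutMod_zero hα, mul_zero]
  have hs : cutMod α μ s = cutMod α μ (min s (1 / 2)) := by simp [cutMod]
  have ht : cutMod α μ t = cutMod α μ (min t (1 / 2)) := by simp [cutMod]
  have hp : 0 < min t (1 / 2) := lt_min h2 (by norm_num)
  have hle : min s (1 / 2) ≤ min t (1 / 2) := min_le_min_right _ h1
  have h0' : 0 ≤ min s (1 / 2) := le_min h0 (by norm_num)
  have := h _ _ h0' hle hp (min_le_right _ _)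
  rw [hs, ht]
  refine this.trans ?_
  have h4 : (min s (1 / 2) / min t (1 / 2)) ^ (α / 2) ≤ 1 :=
    Real.rpow_le_one (by positivity) ((div_le_one hp).2 hle) (by positivity)
  have h5 : 0 < cutMod α μ (min t (1 / 2)) := cutMod_pos hp
  have h6 : C * (min s (1 / 2) / min t (1 / 2)) ^ (α / 2) ≤ C * 1 := by gcongr
  nlinarith

/-- The modulus grows at most like a power: like any power above `α`, and like the power `α` itself
if the logarithm has a nonnegative exponent. -/
lemma cutMod_growth {α : ℝ} (hα : 0 < α) (μ e : ℝ) (he : α < e ∨ α = e ∧ 0 ≤ μ) :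
    ∃ C > 0, ∀ s t : ℝ, 0 < s → 0 ≤ t → cutMod α μ t ≤ C * (1 + t / s) ^ e * cutMod α μ s := by
  obtain ⟨C₁, hC₁, h₁⟩ := cutMod_mono hα μ
  obtain ⟨C₂, hC₂, h₂⟩ := logMod_le_of_ge α μ e he
  have he0 : 0 < e := by rcases he with h | h <;> linarith
  refine ⟨C₁ + C₂, by positivity, fun s t h0 h1 => ?_⟩
  have hs : 0 < cutMod α μ s := cutMod_pos h0
  have hx : 1 ≤ (1 + t / s) ^ e := Real.one_le_rpow (by simp; positivity) he0.le
  rcases le_total t s with hts | hts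
  · calc cutMod α μ t ≤ C₁ * cutMod α μ s := h₁ t s h1 hts
      _ = C₁ * 1 * cutMod α μ s := by ring
      _ ≤ _ := by gcongr; linarith
  · have hs' : 0 < min s (1 / 2) := lt_min h0 (by norm_num)
    have hle : min s (1 / 2) ≤ min t (1 / 2) := min_le_min_right _ hts
    have h3 := h₂ _ _ hs' hle (min_le_right _ _)
    have h4 : min t (1 / 2) / min s (1 / 2) ≤ 1 + t / s := by
      rcases le_total s (1 / 2) with h | h
      · rw [min_eq_left h]
        have : min t (1 / 2) / s ≤ t / s := by gcongr; exact min_le_left _ _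
        linarith
      · rw [min_eq_right h, min_eq_right (h.trans hts)]
        have : 0 ≤ t / s := by positivity
        norm_num; linarith
    have h5 : (min t (1 / 2) / min s (1 / 2)) ^ e ≤ (1 + t / s) ^ e :=
      Real.rpow_le_rpow (by positivity) h4 he0.le
    calc cutMod α μ t ≤ C₂ * (min t (1 / 2) / min s (1 / 2)) ^ e * cutMod α μ s := h3
      _ ≤ _ := by gcongr; linarith

lemma cutMod_growth_linear {α : ℝ} (hα : 0 < α) (hα₁ : α ≤ 1) {μ : ℝ} (hμ : α = 1 → 0 ≤ μ) :
    ∃ C > 0, ∀ s t : ℝ, 0 < s → 0 ≤ t → cutMod α μ t ≤ C * (1 + t / s) * cutMod α μ s := by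
  obtain ⟨C, hC, h⟩ := cutMod_growth hα μ 1
    (hα₁.lt_or_eq.imp id fun h => ⟨h, hμ h⟩)
  exact ⟨C, hC, fun s t hs ht => by simpa using h s t hs ht⟩

lemma cutMod_dilate {α : ℝ} (hα : 0 < α) (μ : ℝ) {M : ℝ} (hM : 0 ≤ M) :
    ∃ C > 0, ∀ t : ℝ, 0 ≤ t → cutMod α μ (M * t) ≤ C * cutMod α μ t := by
  obtain ⟨C, hC, h⟩ := cutMod_growth hα μ (α + 1) (Or.inl (by linarith))
  refine ⟨C * (1 + M) ^ (α + 1), by positivity, fun t ht => ?_⟩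
  rcases ht.eq_or_lt with rfl | ht
  · simp [cutMod_zero hα]
  · have := h t (M * t) ht (by positivity)
    rwa [mul_div_assoc, div_self ht.ne', mul_one] at this

lemma linear_le_cutMod {α : ℝ} (hα : 0 < α) (hα₁ : α ≤ 1) {μ : ℝ} (hμ : α = 1 → 0 ≤ μ) {R : ℝ}
    (hR : 0 ≤ R) : ∃ C > 0, ∀ t : ℝ, 0 ≤ t → t ≤ R → t ≤ C * cutMod α μ t := by
  obtain ⟨C, hC, h⟩ := cutMod_growth_linear hα hα₁ hμ
  have h2 : 0 < cutMod α μ (1 / 2) := cutMod_pos (by norm_num)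
  refine ⟨C * (R + 1) / cutMod α μ (1 / 2), by positivity, fun t ht htR => ?_⟩
  rcases ht.eq_or_lt with rfl | ht
  · simp [cutMod_zero hα]
  have h3 := h t (1 / 2) ht (by norm_num)
  have h4 : 0 < cutMod α μ t := cutMod_pos ht
  have h5 : t * cutMod α μ (1 / 2) ≤ C * (t + 1 / 2) * cutMod α μ t := by
    calc t * cutMod α μ (1 / 2) ≤ t * (C * (1 + 1 / 2 / t) * cutMod α μ t) := by gcongr
      _ = _ := by field_simp
  rw [div_mul_eq_mul_div, le_div_iff₀ h2]
  refine h5.trans ?_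
  gcongr
  linarith

lemma cutMod_le_rpow {α : ℝ} (hα : 0 < α) (μ : ℝ) :
    ∃ C > 0, ∀ t : ℝ, 0 ≤ t → cutMod α μ t ≤ C * t ^ (α / 2) := by
  obtain ⟨C, hC, h⟩ := cutMod_decay hα μ
  have h2 : 0 < cutMod α μ (1 / 2) := cutMod_pos (by norm_num)
  refine ⟨C * 2 ^ (α / 2) * cutMod α μ (1 / 2), by positivity, fun t ht => ?_⟩
  have hs : cutMod α μ t = cutMod α μ (min t (1 / 2)) := by simp [cutMod]
  have h0' : 0 ≤ min t (1 / 2) := le_min ht (by norm_num)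
  rw [hs]
  calc _ ≤ C * (min t (1 / 2) / (1 / 2)) ^ (α / 2) * cutMod α μ (1 / 2) :=
        h _ _ h0' (min_le_right _ _) (by norm_num) le_rfl
    _ ≤ C * (2 * t) ^ (α / 2) * cutMod α μ (1 / 2) := by
        gcongr
        have := min_le_left t (1 / 2)
        linarith
    _ = _ := by rw [Real.mul_rpow (by norm_num) ht]; ring

lemma rpow_le_cutMod {α : ℝ} (hα : 0 < α) {μ : ℝ} (hμ : 0 ≤ μ) {R : ℝ} (hR : 0 ≤ R) :
    ∃ C > 0, ∀ t : ℝ, 0 ≤ t → t ≤ R → t ^ α ≤ C * cutMod α μ t := by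
  have hl := Real.log_pos one_lt_two
  refine ⟨(1 + 2 * R) ^ α * (Real.log 2 ^ μ)⁻¹, by positivity, fun t ht htR => ?_⟩
  rcases ht.eq_or_lt with rfl | ht
  · simp [cutMod_zero hα, Real.zero_rpow hα.ne']
  have hm : 0 < min t (1 / 2) := lt_min ht (by norm_num)
  have h1 : t ≤ (1 + 2 * R) * min t (1 / 2) := by
    rcases le_total t (1 / 2) with h | h
    · rw [min_eq_left h]; nlinarith
    · rw [min_eq_right h]; nlinarith
  have h2 : Real.log 2 ^ μ ≤ |Real.log (min t (1 / 2))| ^ μ :=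
    Real.rpow_le_rpow hl.le (log_two_le_abs_log hm (min_le_right _ _)) hμ
  have h3 : 0 < Real.log 2 ^ μ := by positivity
  calc t ^ α ≤ ((1 + 2 * R) * min t (1 / 2)) ^ α := Real.rpow_le_rpow ht.le h1 hα.le
    _ = (1 + 2 * R) ^ α * (Real.log 2 ^ μ)⁻¹ * (min t (1 / 2) ^ α * Real.log 2 ^ μ) := by
      rw [Real.mul_rpow (by positivity) hm.le]; field_simp
    _ ≤ _ := by unfold cutMod logMod; gcongr

lemma cutMod_le_cutMod {α : ℝ} (hα : 0 < α) {μ μ' : ℝ} (h : μ ≤ μ') :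
    ∃ C > 0, ∀ t : ℝ, 0 ≤ t → cutMod α μ t ≤ C * cutMod α μ' t := by
  have hl := Real.log_pos one_lt_two
  refine ⟨Real.log 2 ^ (μ - μ'), by positivity, fun t ht => ?_⟩
  rcases ht.eq_or_lt with rfl | ht
  · simp [cutMod_zero hα]
  have hm : 0 < min t (1 / 2) := lt_min ht (by norm_num)
  have hp := abs_log_pos hm (min_le_right _ _)
  have h2 : |Real.log (min t (1 / 2))| ^ (μ - μ') ≤ Real.log 2 ^ (μ - μ') :=
    Real.rpow_le_rpow_of_nonpos hl (log_two_le_abs_log hm (min_le_right _ _)) (by linarith)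
  unfold cutMod logMod
  calc _ = |Real.log (min t (1 / 2))| ^ (μ - μ') *
        (min t (1 / 2) ^ α * |Real.log (min t (1 / 2))| ^ μ') := by
        rw [Real.rpow_sub hp]; field_simp
    _ ≤ _ := by gcongr

lemma cutMod_mul_abs_log {α μ t : ℝ} (h0 : 0 < t) (h1 : t ≤ 1 / 2) :
    cutMod α μ t * |Real.log t| = cutMod α (μ + 1) t := by
  rw [cutMod_eq h1, cutMod_eq h1, logMod, logMod, Real.rpow_add_one (abs_log_pos h0 h1).ne']
  ring

/-! ### Geometry of the boundary curves -/

lemma exists_pos_forall_le {ι : Type*} [Finite ι] (f : ι → ℝ) (hf : ∀ i, 0 < f i) :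
    ∃ c > 0, ∀ i, c ≤ f i := by
  rcases isEmpty_or_nonempty ι with h | h
  · exact ⟨1, one_pos, fun i => h.elim i⟩
  · obtain ⟨i, hi⟩ := Finite.exists_min f
    exact ⟨f i, hf i, hi⟩

lemma exists_pos_forall_ge {ι : Type*} [Finite ι] (f : ι → ℝ) : ∃ c > 0, ∀ i, f i ≤ c := by
  rcases isEmpty_or_nonempty ι with h | h
  · exact ⟨1, one_pos, fun i => h.elim i⟩
  · obtain ⟨i, hi⟩ := Finite.exists_max f
    exact ⟨max (f i) 1, by positivity, fun j => (hi j).trans (le_max_left _ _)⟩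

lemma Function.Periodic.exists_norm_le {g : ℝ → ℂ} {L : ℝ} (hg : Function.Periodic g L)
    (hL : 0 < L) (hc : Continuous g) : ∃ M, ∀ t, ‖g t‖ ≤ M := by
  obtain ⟨M, hM⟩ := (isCompact_Icc (a := (0 : ℝ)) (b := L)).exists_bound_of_continuousOn
    hc.continuousOn
  refine ⟨M, fun t => ?_⟩
  obtain ⟨y, hy, hty⟩ := hg.exists_mem_Ico₀ hL t
  rw [hty]
  exact hM y (Ico_subset_Icc_self hy)

lemma Function.Periodic.deriv_periodic {g : ℝ → ℂ} {L : ℝ} (hg : Function.Periodic g L) :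
    Function.Periodic (deriv g) L := by
  intro t
  rw [← deriv_comp_add_const]
  exact congrArg (fun h => deriv h t) hg.funext

lemma IsPreconnected.subset_of_disjoint_frontier {s D : Set ℂ} (hs : IsPreconnected s)
    (hD : IsOpen D) (hd : Disjoint s (frontier D)) (hne : (s ∩ D).Nonempty) : s ⊆ D := by
  refine hs.subset_left_of_subset_union hD isClosed_closure.isOpen_compl
    (disjoint_compl_right.mono_left subset_closure |>.symm.symm) ?_ hne
  intro x hx
  by_cases h : x ∈ closure D
  · left
    by_contra hxD
    exact hd.le_bot ⟨hx, h, by rwa [hD.interior_eq]⟩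
  · exact Or.inr h

namespace BoundaryParametrization

variable {D : Set ℂ} {m : ℕ} {α : ℝ} (Γ : BoundaryParametrization D m α)

lemma contDiff_one (hm : 1 ≤ m) (j : Fin Γ.n) : ContDiff ℝ 1 (Γ.curve j) :=
  (Γ.contDiff j).of_le (by exact_mod_cast hm)

lemma continuous_curve (j : Fin Γ.n) : Continuous (Γ.curve j) := (Γ.contDiff j).continuous

lemma hasDerivAt_curve (hm : 1 ≤ m) (j : Fin Γ.n) (t : ℝ) :
    HasDerivAt (Γ.curve j) (deriv (Γ.curve j) t) t :=
  ((Γ.contDiff_one hm j).differentiable (by norm_num) t).hasDerivAt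

lemma continuous_deriv (hm : 1 ≤ m) (j : Fin Γ.n) : Continuous (deriv (Γ.curve j)) :=
  (Γ.contDiff_one hm j).continuous_deriv (by norm_num)

lemma deriv_periodic (j : Fin Γ.n) : Function.Periodic (deriv (Γ.curve j)) (Γ.period j) :=
  (Γ.periodic j).deriv_periodic

lemma curve_mem_frontier (j : Fin Γ.n) (t : ℝ) : Γ.curve j t ∈ frontier D := by
  rw [Γ.frontier_eq]
  exact mem_iUnion.2 ⟨j, t, rfl⟩

lemma exists_of_mem_frontier {z : ℂ} (hz : z ∈ frontier D) : ∃ j t, Γ.curve j t = z := by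
  rw [Γ.frontier_eq] at hz
  obtain ⟨j, t, h⟩ := mem_iUnion.1 hz
  exact ⟨j, t, h⟩

lemma exists_int_of_curve_eq (j : Fin Γ.n) {s t : ℝ} (h : Γ.curve j s = Γ.curve j t) :
    ∃ k : ℤ, t - s = k * Γ.period j := by
  have hL := Γ.period_pos j
  have key : ∀ x : ℝ, x - ⌊x / Γ.period j⌋ * Γ.period j ∈ Ico 0 (Γ.period j) := fun x => by
    have h1 := Int.floor_le (x / Γ.period j)
    have h2 := Int.lt_floor_add_one (x / Γ.period j)
    rw [le_div_iff₀ hL] at h1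
    rw [div_lt_iff₀ hL] at h2
    constructor <;> linarith
  have h3 := Γ.injOn j (key s) (key t) (by
    rw [(Γ.periodic j).sub_int_mul_eq, (Γ.periodic j).sub_int_mul_eq, h])
  exact ⟨⌊t / Γ.period j⌋ - ⌊s / Γ.period j⌋, by push_cast; linarith⟩

lemma exists_norm_deriv_le (hm : 1 ≤ m) : ∃ M > 0, ∀ j t, ‖deriv (Γ.curve j) t‖ ≤ M := by
  choose M hM using fun j =>
    (Γ.deriv_periodic j).exists_norm_le (Γ.period_pos j) (Γ.continuous_deriv hm j)
  obtain ⟨M', h0, h⟩ := exists_pos_forall_ge M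
  exact ⟨M', h0, fun j t => (hM j t).trans (h j)⟩

lemma exists_lipschitz (hm : 1 ≤ m) : ∃ M > 0, (∀ j t, ‖deriv (Γ.curve j) t‖ ≤ M) ∧
    ∀ j s t, ‖Γ.curve j t - Γ.curve j s‖ ≤ M * |t - s| := by
  obtain ⟨M, h0, h⟩ := Γ.exists_norm_deriv_le hm
  refine ⟨M, h0, h, fun j s t => ?_⟩
  exact convex_univ.norm_image_sub_le_of_norm_hasDerivWithin_le
    (fun x _ => (Γ.hasDerivAt_curve hm j x).hasDerivWithinAt) (fun x _ => h j x)
    (mem_univ s) (mem_univ t)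

/-- The curves satisfy a chord-arc condition. The difference quotient of a curve extends to the
continuous function `(s, u) ↦ ∫₀¹ γ'(s + x u) dx`, which does not vanish for `|u| ≤ L / 2`. -/
lemma chord_arc (hm : 1 ≤ m) : ∃ c > 0, ∀ j s t, |t - s| ≤ Γ.period j / 2 →
    c * |t - s| ≤ ‖Γ.curve j t - Γ.curve j s‖ := by
  suffices h : ∀ j, ∃ c > 0, ∀ s t, |t - s| ≤ Γ.period j / 2 →
      c * |t - s| ≤ ‖Γ.curve j t - Γ.curve j s‖ by
    choose c hc h using h
    obtain ⟨c', h0, h1⟩ := exists_pos_forall_le c hc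
    exact ⟨c', h0, fun j s t hst =>
      (mul_le_mul_of_nonneg_right (h1 j) (abs_nonneg _)).trans (h j s t hst)⟩
  intro j
  have hL := Γ.period_pos j
  set L := Γ.period j with hLdef
  set γ := Γ.curve j with hγ
  have hcd : Continuous (deriv γ) := Γ.continuous_deriv hm j
  let Q : ℝ × ℝ → ℂ := fun p => ∫ x in (0 : ℝ)..1, deriv γ (p.1 + x * p.2)
  have hQc : Continuous Q := by
    apply intervalIntegral.continuous_parametric_intervalIntegral_of_continuous'
    exact hcd.comp (by fun_prop)
  have hQ : ∀ s u : ℝ, (u : ℂ) * Q (s, u) = γ (s + u) - γ s := by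
    intro s u
    have h1 : ∀ x ∈ uIcc (0 : ℝ) 1, HasDerivAt (fun x => γ (s + x * u))
        ((u : ℂ) * deriv γ (s + x * u)) x := by
      intro x _
      have h2 : HasDerivAt (fun x : ℝ => s + x * u) u x := by
        simpa using ((hasDerivAt_id x).mul_const u).const_add s
      have h3 := (Γ.hasDerivAt_curve hm j (s + x * u)).scomp x h2
      simpa [Function.comp_def, hγ] using h3
    have h2 := intervalIntegral.integral_eq_sub_of_hasDerivAt h1
      ((continuous_const.mul (hcd.comp (by fun_prop))).intervalIntegrable _ _)
    rw [intervalIntegral.integral_const_mul] at h2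
    simpa [Q] using h2
  have hne : ∀ s u : ℝ, |u| ≤ L / 2 → Q (s, u) ≠ 0 := by
    intro s u hu h0
    rcases eq_or_ne u 0 with rfl | hu0
    · have : Q (s, 0) = deriv γ s := by simp [Q]
      exact Γ.deriv_ne_zero j s (this ▸ h0)
    · have h1 := hQ s u
      rw [h0, mul_zero] at h1
      obtain ⟨k, hk⟩ := Γ.exists_int_of_curve_eq j (sub_eq_zero.1 h1.symm).symm
      rw [add_sub_cancel_left] at hk
      rw [hk, abs_mul, abs_of_pos hL] at hu
      have h3 : |(k : ℝ)| < 1 := by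
        by_contra hh
        push Not at hh
        nlinarith
      have h4 : k = 0 := by
        have : |k| < 1 := by exact_mod_cast h3
        exact Int.abs_lt_one_iff.1 this
      exact hu0 (by rw [hk, h4]; simp)
  obtain ⟨p, hp, hmin⟩ := ((isCompact_Icc (a := (0 : ℝ)) (b := L)).prod
    (isCompact_Icc (a := -(L / 2)) (b := L / 2))).exists_isMinOn
    ⟨(0, 0), by simp only [mem_prod, mem_Icc]; refine ⟨⟨le_rfl, hL.le⟩, ?_, ?_⟩ <;> linarith⟩
    (f := fun p => ‖Q p‖) hQc.norm.continuousOn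
  refine ⟨‖Q p‖, norm_pos_iff.2 (hne p.1 p.2 (abs_le.2 hp.2)), fun s t hst => ?_⟩
  obtain ⟨k, hk⟩ : ∃ k : ℤ, s - k * L ∈ Icc 0 L := by
    refine ⟨⌊s / L⌋, ?_⟩
    have h1 := Int.floor_le (s / L)
    have h2 := Int.lt_floor_add_one (s / L)
    rw [le_div_iff₀ hL] at h1
    rw [div_lt_iff₀ hL] at h2
    constructor <;> linarith
  have h1 := hQ (s - k * L) (t - s)
  have h2 : s - k * L + (t - s) = t - k * L := by ring
  have hper : Function.Periodic γ L := Γ.periodic j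
  rw [h2, hper.sub_int_mul_eq, hper.sub_int_mul_eq] at h1
  rw [← h1, norm_mul, Complex.norm_real, Real.norm_eq_abs, mul_comm]
  gcongr
  exact hmin (show (s - k * L, t - s) ∈ Icc 0 L ×ˢ Icc (-(L / 2)) (L / 2) from
    ⟨hk, abs_le.1 hst⟩)

lemma isCompact_range (j : Fin Γ.n) : IsCompact (range (Γ.curve j)) := by
  have : range (Γ.curve j) = Γ.curve j '' Icc 0 (Γ.period j) := by
    apply subset_antisymm
    · rintro _ ⟨t, rfl⟩
      obtain ⟨y, hy, h⟩ := (Γ.periodic j).exists_mem_Ico₀ (Γ.period_pos j) t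
      exact ⟨y, Ico_subset_Icc_self hy, h.symm⟩
    · exact image_subset_range _ _
  rw [this]
  exact isCompact_Icc.image (Γ.continuous_curve j)

lemma separated : ∃ d > 0, ∀ i j s t, i ≠ j → d ≤ ‖Γ.curve i s - Γ.curve j t‖ := by
  have h : ∀ p : Fin Γ.n × Fin Γ.n, ∃ d > 0, ∀ s t, p.1 ≠ p.2 →
      d ≤ ‖Γ.curve p.1 s - Γ.curve p.2 t‖ := by
    rintro ⟨i, j⟩
    by_cases hij : i = j
    · exact ⟨1, one_pos, fun s t h => absurd hij h⟩
    obtain ⟨p, ⟨⟨s, hs⟩, ⟨t, ht⟩⟩, hmin⟩ :=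
      ((Γ.isCompact_range i).prod (Γ.isCompact_range j)).exists_isMinOn
      ⟨(Γ.curve i 0, Γ.curve j 0), by simp⟩ (f := fun p => ‖p.1 - p.2‖)
      (by fun_prop)
    refine ⟨‖p.1 - p.2‖, norm_pos_iff.2 (sub_ne_zero.2 fun h => ?_), fun s t _ => ?_⟩
    · exact (Γ.disjoint hij).le_bot ⟨⟨s, hs⟩, ⟨t, ht.trans h.symm⟩⟩
    · exact hmin (show (Γ.curve i s, Γ.curve j t) ∈ _ from by simp)
  choose d hd h using h
  obtain ⟨d', h0, h1⟩ := exists_pos_forall_le d hd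
  exact ⟨d', h0, fun i j s t hij => (h1 (i, j)).trans (h (i, j) s t hij)⟩

/-- Near a boundary point the boundary consists of a small arc of one curve. -/
lemma exists_near (hm : 1 ≤ m) (j : Fin Γ.n) (t₀ : ℝ) {r : ℝ} (hr : 0 < r) :
    ∃ ρ > 0, ∀ z ∈ frontier D,
    ‖z - Γ.curve j t₀‖ < ρ → ∃ t, |t - t₀| < r ∧ Γ.curve j t = z := by
  obtain ⟨c, hc, hca⟩ := Γ.chord_arc hm
  obtain ⟨d, hd, hsep⟩ := Γ.separated
  have hL := Γ.period_pos j
  refine ⟨min d (c * r), by positivity, fun z hz hzr => ?_⟩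
  obtain ⟨i, s, rfl⟩ := Γ.exists_of_mem_frontier hz
  have hij : i = j := by
    by_contra hij
    exact absurd (hsep i j s t₀ hij) (not_le.2 (hzr.trans_le (min_le_left _ _)))
  subst hij
  set k : ℤ := round ((s - t₀) / Γ.period i)
  have hk := abs_sub_round ((s - t₀) / Γ.period i)
  have h1 : |s - k * Γ.period i - t₀| ≤ Γ.period i / 2 := by
    have : s - k * Γ.period i - t₀ = ((s - t₀) / Γ.period i - k) * Γ.period i := by
      field_simp; ring
    rw [this, abs_mul, abs_of_pos hL]
    nlinarith
  have h2 := hca i _ _ h1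
  rw [(Γ.periodic i).sub_int_mul_eq] at h2
  refine ⟨s - k * Γ.period i, ?_, (Γ.periodic i).sub_int_mul_eq k⟩
  have h3 := hzr.trans_le (min_le_right _ _)
  exact lt_of_mul_lt_mul_left (h2.trans_lt h3) hc.le

/-- Translating a boundary arc in its normal direction straightens `D` locally. This gives the
interior cone condition at one boundary point. -/
lemma cone_at (Γ : BoundaryParametrization D m α) (hm : 1 ≤ m) (hD : IsOpen D) {ζ : ℂ}
    (hζ : ζ ∈ frontier D) : ∃ r > 0, ∃ v : ℂ, ‖v‖ = 1 ∧ ∀ w ∈ D, ‖w - ζ‖ < r → ∀ s, 0 < s → s ≤ r →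
      Metric.ball (w + s * v) (s / 4) ⊆ D := by
  obtain ⟨j, t₀, rfl⟩ := Γ.exists_of_mem_frontier hζ
  set γ := Γ.curve j with hγ
  set b := deriv γ t₀ with hb
  have hb0 : b ≠ 0 := Γ.deriv_ne_zero j t₀
  have hbn : 0 < ‖b‖ := norm_pos_iff.2 hb0
  -- `Ψ` maps the real axis to the boundary and the upper side of it to the side of `D`
  let Ψ : ℂ → ℂ := fun x => γ x.re + x.im * (Complex.I * b)
  have hΨ0 : Ψ t₀ = γ t₀ := by simp [Ψ]
  let b' : ℂ ≃L[ℝ] ℂ :=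
    (ContinuousLinearEquiv.unitsEquivAut ℂ (Units.mk0 b hb0)).restrictScalars ℝ
  have hb' : ∀ x, b' x = x * b := fun x => by simp [b']
  have hstrict : HasStrictFDerivAt Ψ (b' : ℂ →L[ℝ] ℂ) (t₀ : ℂ) := by
    have h1 : HasStrictDerivAt γ b t₀ :=
      (Γ.contDiff_one hm j).contDiffAt.hasStrictDerivAt (by norm_num)
    have h2 := h1.hasStrictFDerivAt.comp (t₀ : ℂ) (f := fun x : ℂ => x.re)
      (Complex.reCLM.hasStrictFDerivAt)
    have h3 : HasStrictFDerivAt (fun x : ℂ => (x.im : ℂ) * (Complex.I * b))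
        ((ContinuousLinearMap.mul ℝ ℂ).flip (Complex.I * b) ∘L Complex.ofRealCLM ∘L
          Complex.imCLM) (t₀ : ℂ) :=
      ((ContinuousLinearMap.mul ℝ ℂ).flip (Complex.I * b) ∘L Complex.ofRealCLM ∘L
          Complex.imCLM).hasStrictFDerivAt
    refine (h2.add h3).congr_fderiv ?_
    ext x
    simp [hb']
    linear_combination b * Complex.re_add_im x
  have happ : ∀ᶠ p : ℂ × ℂ in 𝓝 ((t₀ : ℂ), (t₀ : ℂ)),
      ‖Ψ p.1 - Ψ p.2 - (p.1 - p.2) * b‖ ≤ ‖b‖ / 4 * ‖p.1 - p.2‖ := by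
    have := hstrict.isLittleO.def (c := ‖b‖ / 4) (by positivity)
    simpa [hb'] using this
  obtain ⟨r₁, hr₁, happ⟩ : ∃ r₁ > 0, ∀ x y : ℂ, ‖x - t₀‖ < r₁ → ‖y - t₀‖ < r₁ →
      ‖Ψ x - Ψ y - (x - y) * b‖ ≤ ‖b‖ / 4 * ‖x - y‖ := by
    obtain ⟨r, hr, h⟩ := Metric.eventually_nhds_iff.1 happ
    exact ⟨r, hr, fun x y hx hy => h (y := (x, y)) (by
      rw [Prod.dist_eq, dist_eq_norm, dist_eq_norm]; exact max_lt hx hy)⟩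
  have hinj : ∀ x y : ℂ, ‖x - t₀‖ < r₁ → ‖y - t₀‖ < r₁ → Ψ x = Ψ y → x = y := by
    intro x y hx hy hxy
    have h1 := happ x y hx hy
    rw [hxy, sub_self, zero_sub, norm_neg, norm_mul] at h1
    have h2 : ‖x - y‖ = 0 := by nlinarith [norm_nonneg (x - y)]
    exact sub_eq_zero.1 (norm_eq_zero.1 h2)
  -- near `t₀` only real points are mapped to the boundary
  obtain ⟨ρ, hρ, hnear⟩ := Γ.exists_near hm j t₀ hr₁
  have hΨc : Continuous Ψ := by
    have := Γ.continuous_curve j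
    simp only [Ψ]
    fun_prop
  obtain ⟨r₂, hr₂, hr₂'⟩ : ∃ r₂ > 0, ∀ x : ℂ, ‖x - t₀‖ < r₂ → ‖Ψ x - γ t₀‖ < ρ := by
    obtain ⟨r, hr, h⟩ := Metric.continuousAt_iff.1 (hΨc.continuousAt (x := (t₀ : ℂ))) ρ hρ
    refine ⟨r, hr, fun x hx => ?_⟩
    have := h (x := x) (by rwa [dist_eq_norm])
    rwa [dist_eq_norm, hΨ0] at this
  set r₃ := min r₁ r₂ with hr₃
  have hr₃0 : 0 < r₃ := lt_min hr₁ hr₂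
  have him : ∀ x : ℂ, ‖x - t₀‖ < r₃ → Ψ x ∈ frontier D → x.im = 0 := by
    intro x hx hxf
    obtain ⟨t, ht, hte⟩ := hnear _ hxf (hr₂' x (hx.trans_le (min_le_right _ _)))
    have h1 : Ψ (t : ℂ) = Ψ x := by rw [← hte]; simp [Ψ, hγ]
    have h2 := hinj t x (by rw [← Complex.ofReal_sub, Complex.norm_real]; exact ht)
      (hx.trans_le (min_le_left _ _)) h1
    rw [← h2]; simp
  -- the two sides of the straightened boundary
  have hconv : ∀ σ : ℝ, Convex ℝ ({x : ℂ | 0 < σ * x.im} ∩ Metric.ball (t₀ : ℂ) r₃) := by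
    intro σ
    refine Convex.inter ?_ (convex_ball _ _)
    have : IsLinearMap ℝ (fun x : ℂ => σ * x.im) :=
      ⟨fun x y => by simp [mul_add], fun c x => by simp; ring⟩
    exact convex_halfSpace_gt this 0
  have hdisj : ∀ σ : ℝ, Disjoint (Ψ '' ({x : ℂ | 0 < σ * x.im} ∩ Metric.ball (t₀ : ℂ) r₃))
      (frontier D) := by
    intro σ
    rw [Set.disjoint_left]
    rintro _ ⟨x, ⟨hx1, hx2⟩, rfl⟩ hxf
    have := him x (by rwa [← dist_eq_norm]) hxf
    simp [this] at hx1
  have hpre : ∀ σ : ℝ, IsPreconnected (Ψ '' ({x : ℂ | 0 < σ * x.im} ∩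
      Metric.ball (t₀ : ℂ) r₃)) :=
    fun σ => (hconv σ).isPreconnected.image _ hΨc.continuousOn
  have hlr := Γ.left_right j t₀
  obtain ⟨ε, ⟨hε1, hε2⟩, hε0, hεr⟩ := (hlr.and (Ioo_mem_nhdsGT hr₃0)).exists
  have hεball : ∀ σ : ℝ, |σ| = 1 → ((t₀ : ℂ) + (σ * ε : ℝ) * Complex.I) ∈ Metric.ball (t₀ : ℂ) r₃ := by
    intro σ hσ
    rw [Metric.mem_ball, dist_eq_norm, add_sub_cancel_left, norm_mul, Complex.norm_I, mul_one,
      Complex.norm_real, Real.norm_eq_abs, abs_mul, hσ, one_mul, abs_of_pos hε0]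
    exact hεr
  -- each half disc is mapped to one side, which `left_right` identifies at a single point
  have hplus : ∀ x : ℂ, ‖x - t₀‖ < r₃ → 0 < x.im → Ψ x ∈ D := by
    intro x hx hxi
    refine (hpre 1).subset_of_disjoint_frontier hD (hdisj 1) ?_
      ⟨x, ⟨by simpa using hxi, by rwa [Metric.mem_ball, dist_eq_norm]⟩, rfl⟩
    refine ⟨_, ⟨_, ⟨?_, hεball 1 (by simp)⟩, rfl⟩, ?_⟩
    · simpa using hε0
    · simpa [Ψ, hγ, hb] using hε1
  have hminus : ∀ x : ℂ, ‖x - t₀‖ < r₃ → x.im < 0 → Ψ x ∉ D := by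
    intro x hx hxi hxD
    have h1 := (hpre (-1)).subset_of_disjoint_frontier hD (hdisj (-1))
      ⟨_, ⟨x, ⟨by simpa using hxi, by rwa [Metric.mem_ball, dist_eq_norm]⟩, rfl⟩, hxD⟩
    refine hε2 (subset_closure (h1 ⟨_, ⟨?_, hεball (-1) (by simp)⟩, ?_⟩))
    · simpa using hε0
    · simp [Ψ, hγ, hb, sub_eq_add_neg]
  have hnhds : Ψ '' Metric.ball (t₀ : ℂ) r₃ ∈ 𝓝 (γ t₀) := by
    rw [← hΨ0, ← hstrict.map_nhds_eq_of_equiv]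
    exact image_mem_map (Metric.ball_mem_nhds _ hr₃0)
  obtain ⟨r₄, hr₄, hball⟩ := Metric.mem_nhds_iff.1 hnhds
  refine ⟨r₄ / 3, by positivity, Complex.I * b / ‖b‖, ?_, fun w hw hwr s hs0 hsr y hy => ?_⟩
  · simp [hbn.ne']
  have hy' : ‖y - (w + s * (Complex.I * b / ‖b‖))‖ < s / 4 := by rwa [← dist_eq_norm]
  have hv1 : ‖(s : ℂ) * (Complex.I * b / ‖b‖)‖ = s := by
    simp [hbn.ne', abs_of_pos hs0]
  obtain ⟨x, hx, hxw⟩ := hball (show w ∈ Metric.ball (γ t₀) r₄ by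
    rw [Metric.mem_ball, dist_eq_norm]; linarith)
  obtain ⟨x', hx', hxy⟩ := hball (show y ∈ Metric.ball (γ t₀) r₄ by
    rw [Metric.mem_ball, dist_eq_norm]
    calc ‖y - γ t₀‖ = ‖(y - (w + s * (Complex.I * b / ‖b‖))) + (w - γ t₀) +
          s * (Complex.I * b / ‖b‖)‖ := by congr 1; ring
      _ ≤ _ := norm_add₃_le
      _ < r₄ := by rw [hv1]; linarith)
  rw [Metric.mem_ball, dist_eq_norm] at hx hx'
  have hxim : 0 < x.im := by
    rcases lt_trichotomy x.im 0 with h | h | h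
    · exact absurd (hxw ▸ hw) (hminus x hx h)
    · exfalso
      have h1 : Ψ x = γ x.re := by simp [Ψ, h]
      have h2 : w ∈ frontier D := by rw [← hxw, h1]; exact Γ.curve_mem_frontier j _
      rw [hD.frontier_eq] at h2
      exact h2.2 hw
    · exact h
  rw [← hxy]
  -- since `Ψ` is nearly multiplication by `b`, the shift by `s i b / |b|` raises the imaginary part
  apply hplus x' hx'
  have h1 := happ x' x (hx'.trans_le (min_le_left _ _)) (hx.trans_le (min_le_left _ _))
  rw [hxy, hxw] at h1
  set e : ℂ := (x' - x) * b - s * (Complex.I * b / ‖b‖) with he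
  have he1 : ‖e‖ ≤ s / 4 + ‖b‖ / 4 * ‖x' - x‖ := by
    have : e = (y - (w + s * (Complex.I * b / ‖b‖))) - (y - w - (x' - x) * b) := by
      rw [he]; ring
    rw [this]
    exact (norm_sub_le _ _).trans (by linarith)
  have h2 : ‖x' - x‖ * ‖b‖ ≤ s + ‖e‖ := by
    rw [← norm_mul]
    have : (x' - x) * b = s * (Complex.I * b / ‖b‖) + e := by rw [he]; ring
    rw [this]
    exact (norm_add_le _ _).trans (by rw [hv1])
  have h3 : (x' - x).im = s / ‖b‖ + (e / b).im := by
    have : x' - x = (s / ‖b‖ : ℝ) * Complex.I + e / b := by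
      rw [he]; push_cast; field_simp; ring
    conv_lhs => rw [this]
    simp
  have h4 : |(e / b).im| ≤ ‖e‖ / ‖b‖ := by
    rw [← norm_div]; exact Complex.abs_im_le_norm _
  have h5 : ‖e‖ < s := by nlinarith
  have h6 : ‖e‖ / ‖b‖ < s / ‖b‖ := div_lt_div_of_pos_right h5 hbn
  have h7 := (abs_le.1 h4).1
  rw [Complex.sub_im] at h3
  linarith

lemma isCompact_frontier (Γ : BoundaryParametrization D m α) : IsCompact (frontier D) := by
  rw [Γ.frontier_eq]
  exact isCompact_iUnion Γ.isCompact_range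

end BoundaryParametrization

lemma ball_subset_of_le_infDist {D : Set ℂ} (hD : IsOpen D) {w : ℂ} (hw : w ∈ D) {r : ℝ}
    (hr : r ≤ Metric.infDist w (frontier D)) : Metric.ball w r ⊆ D := by
  rcases le_or_gt r 0 with h0 | h0
  · simp [Metric.ball_eq_empty.2 h0]
  refine (convex_ball w r).isPreconnected.subset_of_disjoint_frontier hD ?_
    ⟨w, Metric.mem_ball_self h0, hw⟩
  rw [Set.disjoint_left]
  intro x hx hxf
  have := Metric.infDist_le_dist_of_mem (x := w) hxf
  rw [Metric.mem_ball, dist_comm] at hx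
  linarith

lemma frontier_nonempty_of_bounded {D : Set ℂ} (hne : D.Nonempty) (hb : Bornology.IsBounded D) :
    (frontier D).Nonempty := by
  rw [nonempty_frontier_iff]
  refine ⟨hne, fun h => ?_⟩
  rw [h] at hb
  exact NormedSpace.unbounded_univ ℝ ℂ hb

/-- A uniform interior cone condition: near every point there is a direction that leads into `D`,
away from the boundary. -/
def UniformCone (D : Set ℂ) (r : ℝ) : Prop :=
  ∀ z : ℂ, ∃ v : ℂ, ‖v‖ = 1 ∧ ∀ w ∈ D, ‖w - z‖ < r → ∀ s, 0 < s → s ≤ r →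
    Metric.ball (w + s * v) (s / 4) ⊆ D

lemma BoundaryParametrization.exists_uniformCone {D : Set ℂ} {m : ℕ} {α : ℝ}
    (Γ : BoundaryParametrization D m α) (hm : 1 ≤ m) (hD : IsOpen D)
    (hf : (frontier D).Nonempty) : ∃ r > 0, UniformCone D r := by
  obtain ⟨r, hr, h⟩ : ∃ r > 0, ∀ ζ ∈ frontier D, ∃ v : ℂ, ‖v‖ = 1 ∧ ∀ w ∈ D, ‖w - ζ‖ < r →
      ∀ s, 0 < s → s ≤ r → Metric.ball (w + s * v) (s / 4) ⊆ D := by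
    refine Γ.isCompact_frontier.induction_on (p := fun S => ∃ r > 0, ∀ ζ ∈ S, ∃ v : ℂ, ‖v‖ = 1 ∧
      ∀ w ∈ D, ‖w - ζ‖ < r → ∀ s, 0 < s → s ≤ r → Metric.ball (w + s * v) (s / 4) ⊆ D)
      ⟨1, one_pos, by simp⟩ ?_ ?_ ?_
    · rintro S T hST ⟨r, hr, h⟩
      exact ⟨r, hr, fun ζ hζ => h ζ (hST hζ)⟩
    · rintro S T ⟨r, hr, h⟩ ⟨r', hr', h'⟩
      refine ⟨min r r', lt_min hr hr', fun ζ hζ => ?_⟩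
      rcases hζ with hζ | hζ
      · obtain ⟨v, hv, hw⟩ := h ζ hζ
        exact ⟨v, hv, fun w hwD hwr s h0 hs => hw w hwD (hwr.trans_le (min_le_left _ _)) s h0
          (hs.trans (min_le_left _ _))⟩
      · obtain ⟨v, hv, hw⟩ := h' ζ hζ
        exact ⟨v, hv, fun w hwD hwr s h0 hs => hw w hwD (hwr.trans_le (min_le_right _ _)) s h0
          (hs.trans (min_le_right _ _))⟩
    · intro ζ₀ hζ₀
      obtain ⟨r, hr, v, hv, h⟩ := Γ.cone_at hm hD hζ₀
      refine ⟨Metric.ball ζ₀ (r / 2), mem_nhdsWithin_of_mem_nhds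
        (Metric.ball_mem_nhds _ (by positivity)), r / 2, by positivity, fun ζ hζ => ⟨v, hv, ?_⟩⟩
      intro w hw hwr s h0 hs
      refine h w hw ?_ s h0 (by linarith)
      rw [Metric.mem_ball, dist_eq_norm] at hζ
      calc ‖w - ζ₀‖ ≤ ‖w - ζ‖ + ‖ζ - ζ₀‖ := norm_sub_le_norm_sub_add_norm_sub _ _ _
        _ < r := by linarith
  refine ⟨r / 8, by positivity, fun z => ?_⟩
  rcases lt_or_ge (Metric.infDist z (frontier D)) (r / 2) with hz | hz
  · obtain ⟨ζ, hζ, hzζ⟩ := (Metric.infDist_lt_iff hf).1 hz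
    obtain ⟨v, hv, hw⟩ := h ζ hζ
    refine ⟨v, hv, fun w hwD hwr s h0 hs => hw w hwD ?_ s h0 (by linarith)⟩
    rw [dist_eq_norm] at hzζ
    calc ‖w - ζ‖ ≤ ‖w - z‖ + ‖z - ζ‖ := norm_sub_le_norm_sub_add_norm_sub _ _ _
      _ < r := by linarith
  · refine ⟨1, by simp, fun w hwD hwr s h0 hs => ?_⟩
    have h1 : r / 4 ≤ Metric.infDist w (frontier D) := by
      have := Metric.infDist_le_infDist_add_dist (s := frontier D) (x := z) (y := w)
      rw [dist_eq_norm, norm_sub_rev] at this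
      linarith
    refine subset_trans (Metric.ball_subset_ball' ?_) (ball_subset_of_le_infDist hD hwD h1)
    rw [dist_eq_norm, add_sub_cancel_left, mul_one, Complex.norm_real, Real.norm_eq_abs,
      abs_of_pos h0]
    linarith

/-! ### Independence of the contour integral of the parametrization -/

namespace BoundaryParametrization

variable {D : Set ℂ} {m m' : ℕ} {α α' : ℝ}

/-- The parameters of the `i`-th curve of `Γ` that belong to points of the `j`-th curve of `Γ'`.
End points of the parameter intervals are left out on both sides, which makes the set open. -/
def overlap (Γ : BoundaryParametrization D m α) (Γ' : BoundaryParametrization D m' α')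
    (i : Fin Γ.n) (j : Fin Γ'.n) : Set ℝ :=
  {t | t ∈ Ioo 0 (Γ.period i) ∧ ∃ u ∈ Ioo 0 (Γ'.period j), Γ'.curve j u = Γ.curve i t}

lemma exists_mem_Ico (Γ : BoundaryParametrization D m α) {z : ℂ} (hz : z ∈ frontier D) :
    ∃ j, ∃ t ∈ Ico 0 (Γ.period j), Γ.curve j t = z := by
  obtain ⟨j, t, rfl⟩ := Γ.exists_of_mem_frontier hz
  obtain ⟨y, hy, h⟩ := (Γ.periodic j).exists_mem_Ico₀ (Γ.period_pos j) t
  exact ⟨j, y, hy, h.symm⟩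

lemma curve_injective_pair (Γ : BoundaryParametrization D m α) {i j : Fin Γ.n} {s t : ℝ}
    (h : Γ.curve i s = Γ.curve j t) : i = j := by
  by_contra hij
  exact (Γ.disjoint hij).le_bot ⟨⟨s, rfl⟩, ⟨t, h.symm⟩⟩

lemma isOpen_overlap (Γ : BoundaryParametrization D m α) (Γ' : BoundaryParametrization D m' α')
    (i : Fin Γ.n) (j : Fin Γ'.n) : IsOpen (overlap Γ Γ' i j) := by
  have h : overlap Γ Γ' i j = Ioo 0 (Γ.period i) ∩
      Γ.curve i ⁻¹' ((⋃ k ∈ {k | k ≠ j}, range (Γ'.curve k)) ∪ {Γ'.curve j 0})ᶜ := by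
    ext t
    constructor
    · rintro ⟨h1, u, hu, hut⟩
      refine ⟨h1, ?_⟩
      rintro (h2 | h2)
      · obtain ⟨k, hk, s, hs⟩ := mem_iUnion₂.1 h2
        exact hk (Γ'.curve_injective_pair (hs.trans hut.symm))
      · rw [mem_singleton_iff, ← hut] at h2
        exact hu.1.ne' (Γ'.injOn j (Ioo_subset_Ico_self hu) (by simp [Γ'.period_pos j]) h2)
    · rintro ⟨h1, h2⟩
      refine ⟨h1, ?_⟩
      obtain ⟨k, u, hu, hut⟩ := Γ'.exists_mem_Ico (Γ.curve_mem_frontier i t)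
      rw [mem_preimage, mem_compl_iff, mem_union, not_or] at h2
      have hk : k = j := by
        by_contra hk
        exact h2.1 (mem_iUnion₂.2 ⟨k, hk, u, hut⟩)
      subst hk
      refine ⟨u, ⟨lt_of_le_of_ne hu.1 fun h0 => h2.2 ?_, hu.2⟩, hut⟩
      rw [mem_singleton_iff, ← hut, ← h0]
  rw [h]
  refine isOpen_Ioo.inter (IsOpen.preimage (Γ.continuous_curve i) ?_)
  rw [isOpen_compl_iff]
  exact ((Set.toFinite _).isClosed_biUnion fun k _ => (Γ'.isCompact_range k).isClosed).union
    isClosed_singleton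

/-- Close to `u`, the curve `Γ' j` separates points at the rate of their parameters. -/
lemma abs_sub_le_of_near (Γ : BoundaryParametrization D m α) (hm : 1 ≤ m) :
    ∃ c > 0, ∀ j, ∀ u ∈ Ioo 0 (Γ.period j), ∃ ρ > 0, ∀ s ∈ Ioo 0 (Γ.period j),
      ‖Γ.curve j s - Γ.curve j u‖ < ρ → c * |s - u| ≤ ‖Γ.curve j s - Γ.curve j u‖ := by
  obtain ⟨c, hc, hca⟩ := Γ.chord_arc hm
  refine ⟨c, hc, fun j u hu => ?_⟩
  have hu2 := sub_pos.2 hu.2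
  have hu1 := hu.1
  refine ⟨c * min u (Γ.period j - u), by positivity, fun s hs hsu => ?_⟩
  have hs1 := hs.1
  have hs2 := hs.2
  rcases le_or_gt |s - u| (Γ.period j / 2) with h | h
  · exact hca j u s h
  exfalso
  rcases lt_abs.1 h with h | h
  · have h1 := hca j u (s - Γ.period j) (abs_le.2 ⟨by linarith, by linarith⟩)
    rw [(Γ.periodic j).sub_eq] at h1
    have h2 : min u (Γ.period j - u) ≤ |s - Γ.period j - u| := by
      refine (min_le_left _ _).trans ?_
      rw [abs_of_nonpos (by linarith)]; linarith
    nlinarith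
  · have h1 := hca j u (s + Γ.period j) (abs_le.2 ⟨by linarith, by linarith⟩)
    rw [(Γ.periodic j)] at h1
    have h2 : min u (Γ.period j - u) ≤ |s + Γ.period j - u| := by
      refine (min_le_right _ _).trans ?_
      rw [abs_of_nonneg (by linarith)]; linarith
    nlinarith

open Classical in
/-- The change of parameter from `Γ i` to `Γ' j`. -/
noncomputable def reparam (Γ : BoundaryParametrization D m α)
    (Γ' : BoundaryParametrization D m' α') (i : Fin Γ.n) (j : Fin Γ'.n) (t : ℝ) : ℝ :=
  if h : ∃ u ∈ Ioo 0 (Γ'.period j), Γ'.curve j u = Γ.curve i t then h.choose else 0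

lemma reparam_spec (Γ : BoundaryParametrization D m α) (Γ' : BoundaryParametrization D m' α')
    {i : Fin Γ.n} {j : Fin Γ'.n} {t : ℝ} (ht : t ∈ overlap Γ Γ' i j) :
    reparam Γ Γ' i j t ∈ Ioo 0 (Γ'.period j) ∧
      Γ'.curve j (reparam Γ Γ' i j t) = Γ.curve i t := by
  rw [reparam, dif_pos ht.2]
  exact ht.2.choose_spec

/-- The change of parameter is differentiable, with positive derivative because both
parametrizations have `D` on their left. -/
lemma hasDerivAt_reparam (Γ : BoundaryParametrization D m α) (hm : 1 ≤ m)
    (Γ' : BoundaryParametrization D m' α') (hm' : 1 ≤ m') {i : Fin Γ.n} {j : Fin Γ'.n} {t : ℝ}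
    (ht : t ∈ overlap Γ Γ' i j) :
    ∃ q : ℝ, 0 < q ∧ HasDerivAt (reparam Γ Γ' i j) q t ∧
      deriv (Γ.curve i) t = q * deriv (Γ'.curve j) (reparam Γ Γ' i j t) := by
  set φ := reparam Γ Γ' i j with hφ
  set u := φ t with hu
  have hspec := reparam_spec Γ Γ' ht
  obtain ⟨c, hc, hca⟩ := Γ'.abs_sub_le_of_near hm'
  obtain ⟨ρ, hρ, hca⟩ := hca j u hspec.1
  have hE : ∀ᶠ s in 𝓝 t, s ∈ overlap Γ Γ' i j := (isOpen_overlap Γ Γ' i j).mem_nhds ht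
  have hcont : Tendsto (fun s => ‖Γ.curve i s - Γ.curve i t‖) (𝓝 t) (𝓝 0) := by
    have := ((Γ.continuous_curve i).sub continuous_const).norm.tendsto' t
      (f := fun s => ‖Γ.curve i s - Γ.curve i t‖) 0 (by simp)
    exact this
  have hφc : Tendsto φ (𝓝 t) (𝓝 u) := by
    rw [tendsto_iff_norm_sub_tendsto_zero]
    have h1 : Tendsto (fun s => ‖Γ.curve i s - Γ.curve i t‖ / c) (𝓝 t) (𝓝 0) := by
      simpa using hcont.div_const c
    refine squeeze_zero' (Eventually.of_forall fun _ => norm_nonneg _) ?_ h1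
    filter_upwards [hE, hcont.eventually (gt_mem_nhds hρ)] with s hs hsρ
    have h2 := reparam_spec Γ Γ' hs
    have h3 := hca _ h2.1 (by rw [h2.2, hspec.2]; exact hsρ)
    rw [h2.2, hspec.2] at h3
    rw [le_div_iff₀ hc, Real.norm_eq_abs, mul_comm]
    exact h3
  set a := deriv (Γ.curve i) t with ha
  set b := deriv (Γ'.curve j) u with hb
  have hb0 : b ≠ 0 := Γ'.deriv_ne_zero j u
  have ha0 : a ≠ 0 := Γ.deriv_ne_zero i t
  have hne : ∀ᶠ s in 𝓝[≠] t, φ s ≠ u := by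
    filter_upwards [hE.filter_mono nhdsWithin_le_nhds, self_mem_nhdsWithin] with s hs hst h
    have h2 := reparam_spec Γ Γ' hs
    apply hst
    refine Γ.injOn i (Ioo_subset_Ico_self hs.1) (Ioo_subset_Ico_self ht.1) ?_
    rw [← h2.2, ← hspec.2]
    exact congrArg _ h
  have h1 : Tendsto (slope (Γ.curve i) t) (𝓝[≠] t) (𝓝 a) :=
    (Γ.hasDerivAt_curve hm i t).tendsto_slope
  have h2 : Tendsto (fun s => slope (Γ'.curve j) u (φ s)) (𝓝[≠] t) (𝓝 b) :=
    (Γ'.hasDerivAt_curve hm' j u).tendsto_slope.comp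
      (tendsto_nhdsWithin_iff.2 ⟨hφc.mono_left nhdsWithin_le_nhds, hne⟩)
  -- the slope of `φ` is the quotient of the slopes of the two curves
  have h3 : Tendsto (fun s => ((slope φ t s : ℝ) : ℂ)) (𝓝[≠] t) (𝓝 (a / b)) := by
    refine (h1.div h2 hb0).congr' ?_
    filter_upwards [hE.filter_mono nhdsWithin_le_nhds, self_mem_nhdsWithin, hne] with s hs hst hsu
    have h4 := reparam_spec Γ Γ' hs
    have h5 : ((s - t : ℝ) : ℂ) ≠ 0 := by exact_mod_cast sub_ne_zero.2 hst
    have h6 : ((φ s - u : ℝ) : ℂ) ≠ 0 := by exact_mod_cast sub_ne_zero.2 hsu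
    have h7 : Γ.curve i s - Γ.curve i t ≠ 0 := by
      rw [← h4.2, ← hspec.2]
      refine sub_ne_zero.2 fun h => hsu ?_
      exact Γ'.injOn j (Ioo_subset_Ico_self h4.1) (Ioo_subset_Ico_self hspec.1) h
    simp only [slope_def_module, Complex.real_smul, Pi.div_apply]
    rw [h4.2, hspec.2, smul_eq_mul, Complex.ofReal_mul, Complex.ofReal_inv, Complex.ofReal_inv,
      ← hu]
    field_simp
  set q := (a / b).re with hq
  have h4 : Tendsto (slope φ t) (𝓝[≠] t) (𝓝 q) := by
    exact ((Complex.continuous_re.tendsto _).comp h3).congr fun s => Complex.ofReal_re _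
  have h5 : a / b = q :=
    tendsto_nhds_unique h3 ((Complex.continuous_ofReal.tendsto _).comp h4)
  have h6 : a = q * b := by rw [← h5]; field_simp
  refine ⟨q, ?_, hasDerivAt_iff_tendsto_slope.2 h4, h6⟩
  -- if `q < 0`, the left side of one curve would be the right side of the other
  have hq0 : q ≠ 0 := by rintro h; rw [h] at h6; simp at h6; exact ha0 h6
  by_contra hneg
  have hneg : q < 0 := lt_of_le_of_ne (not_lt.1 hneg) hq0
  have h7 := Γ.left_right i t
  have h8 := Γ'.left_right j u
  rw [hspec.2] at h8
  have h9 : Tendsto (fun ε : ℝ => ε * (-q)) (𝓝[>] 0) (𝓝[>] 0) := by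
    refine tendsto_nhdsWithin_iff.2 ⟨?_, ?_⟩
    · exact ((continuous_id.mul continuous_const).tendsto' 0 0 (by simp)).mono_left
        nhdsWithin_le_nhds
    · filter_upwards [self_mem_nhdsWithin] with ε hε
      exact mul_pos hε (neg_pos.2 hneg)
  obtain ⟨ε, hε1, hε2⟩ := (h7.and (h9.eventually h8)).exists
  apply hε2.2
  apply subset_closure
  convert hε1.1 using 1
  rw [← ha, ← hb, h6]
  push_cast
  ring

lemma setIntegral_overlap_comm (Γ : BoundaryParametrization D m α) (hm : 1 ≤ m)
    (Γ' : BoundaryParametrization D m' α') (hm' : 1 ≤ m') (i : Fin Γ.n) (j : Fin Γ'.n)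
    (g : ℂ → ℂ) :
    ∫ t in overlap Γ Γ' i j, g (Γ.curve i t) * deriv (Γ.curve i) t =
      ∫ u in overlap Γ' Γ j i, g (Γ'.curve j u) * deriv (Γ'.curve j) u := by
  have himage : reparam Γ Γ' i j '' overlap Γ Γ' i j = overlap Γ' Γ j i := by
    apply subset_antisymm
    · rintro _ ⟨t, ht, rfl⟩
      have h := reparam_spec Γ Γ' ht
      exact ⟨h.1, t, ht.1, h.2.symm⟩
    · rintro u ⟨hu, t, ht, htu⟩
      have hto : t ∈ overlap Γ Γ' i j := ⟨ht, u, hu, htu.symm⟩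
      have h := reparam_spec Γ Γ' hto
      exact ⟨t, hto, Γ'.injOn j (Ioo_subset_Ico_self h.1) (Ioo_subset_Ico_self hu)
        (h.2.trans htu)⟩
  choose! q hq0 hq hqd using fun t (ht : t ∈ overlap Γ Γ' i j) =>
    hasDerivAt_reparam Γ hm Γ' hm' ht
  rw [← himage, MeasureTheory.integral_image_eq_integral_abs_deriv_smul
    (isOpen_overlap Γ Γ' i j).measurableSet (fun t ht => (hq t ht).hasDerivWithinAt)]
  · refine MeasureTheory.setIntegral_congr_fun (isOpen_overlap Γ Γ' i j).measurableSet ?_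
    intro t ht
    simp only
    rw [hqd t ht, (reparam_spec Γ Γ' ht).2, abs_of_pos (hq0 t ht), Complex.real_smul]
    ring
  · intro s hs t ht hst
    refine Γ.injOn i (Ioo_subset_Ico_self hs.1) (Ioo_subset_Ico_self ht.1) ?_
    rw [← (reparam_spec Γ Γ' hs).2, ← (reparam_spec Γ Γ' ht).2, hst]

lemma continuous_contour_integrand (Γ : BoundaryParametrization D m α) (hm : 1 ≤ m) {g : ℂ → ℂ}
    (hg : ContinuousOn g (frontier D)) (j : Fin Γ.n) :
    Continuous fun t => g (Γ.curve j t) * deriv (Γ.curve j) t :=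
  (hg.comp_continuous (Γ.continuous_curve j) (Γ.curve_mem_frontier j)).mul
    (Γ.continuous_deriv hm j)

lemma contourIntegral_eq_sum_overlap (Γ : BoundaryParametrization D m α) (hm : 1 ≤ m)
    (Γ' : BoundaryParametrization D m' α') {g : ℂ → ℂ} (hg : ContinuousOn g (frontier D)) :
    Γ.contourIntegral g =
      ∑ i, ∑ j, ∫ t in overlap Γ Γ' i j, g (Γ.curve i t) * deriv (Γ.curve i) t := by
  refine Finset.sum_congr rfl fun i _ => ?_
  have hL := Γ.period_pos i
  have hsub : (⋃ j, overlap Γ Γ' i j) ⊆ Ioc 0 (Γ.period i) :=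
    iUnion_subset fun j t ht => Ioo_subset_Ioc_self ht.1
  have hae : (⋃ j, overlap Γ Γ' i j) =ᵐ[MeasureTheory.volume] Ioc 0 (Γ.period i) := by
    refine hsub.eventuallyLE.antisymm ?_
    -- only end points of parameter intervals are missing
    have hfin : ({Γ.period i} ∪ ⋃ j, {t | t ∈ Ioo 0 (Γ.period i) ∧
        Γ.curve i t = Γ'.curve j 0}).Finite := by
      refine (finite_singleton _).union (finite_iUnion fun j => ?_)
      refine Set.Subsingleton.finite fun s hs t ht => ?_
      exact Γ.injOn i (Ioo_subset_Ico_self hs.1) (Ioo_subset_Ico_self ht.1)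
        (hs.2.trans ht.2.symm)
    rw [MeasureTheory.ae_le_set]
    refine MeasureTheory.measure_mono_null ?_ (hfin.measure_zero _)
    rintro t ⟨ht, hto⟩
    rcases ht.2.eq_or_lt with h | h
    · exact Or.inl h
    right
    obtain ⟨j, u, hu, hut⟩ := Γ'.exists_mem_Ico (Γ.curve_mem_frontier i t)
    refine mem_iUnion.2 ⟨j, ⟨ht.1, h⟩, ?_⟩
    by_contra h0
    refine hto (mem_iUnion.2 ⟨j, ⟨ht.1, h⟩, u, ⟨lt_of_le_of_ne hu.1 fun h1 => h0 ?_, hu.2⟩, hut⟩)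
    rw [← hut, ← h1]
  rw [intervalIntegral.integral_of_le hL.le, ← MeasureTheory.setIntegral_congr_set hae,
    MeasureTheory.integral_iUnion_fintype (fun j => (isOpen_overlap Γ Γ' i j).measurableSet)]
  · intro j k hjk
    refine Set.disjoint_left.2 ?_
    rintro t ⟨_, u, _, hu⟩ ⟨_, v, _, hv⟩
    exact hjk (Γ'.curve_injective_pair (hu.trans hv.symm))
  · intro j
    refine MeasureTheory.IntegrableOn.mono_set ?_ ((subset_iUnion _ j).trans hsub)
    exact ((Γ.continuous_contour_integrand hm hg i).integrableOn_Icc).mono_set Ioc_subset_Icc_self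

/-- The contour integral along `∂D` does not depend on the parametrization. -/
theorem contourIntegral_eq (Γ : BoundaryParametrization D m α) (hm : 1 ≤ m)
    (Γ' : BoundaryParametrization D m' α') (hm' : 1 ≤ m') {g : ℂ → ℂ}
    (hg : ContinuousOn g (frontier D)) : Γ.contourIntegral g = Γ'.contourIntegral g := by
  rw [Γ.contourIntegral_eq_sum_overlap hm Γ' hg, Γ'.contourIntegral_eq_sum_overlap hm' Γ hg,
    Finset.sum_comm]
  exact Finset.sum_congr rfl fun j _ => Finset.sum_congr rfl fun i _ =>
    setIntegral_overlap_comm Γ hm Γ' hm' i j g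

end BoundaryParametrization

/-! ### Integrals with a parameter over a compact interval -/

section ParametricIntegral

variable {E F : Type*} [NormedAddCommGroup E] [NormedAddCommGroup F]

lemma eventually_norm_le_of_continuousOn {U : Set E} (hU : IsOpen U) {H : E → ℝ → F}
    (hH : ContinuousOn (fun p : E × ℝ => H p.1 p.2) (U ×ˢ univ)) {w : E} (hw : w ∈ U) (a b : ℝ) :
    ∃ M, ∀ᶠ x in 𝓝 w, ∀ t ∈ uIcc a b, ‖H x t‖ ≤ M := by
  have hc : ∀ t, ContinuousAt (fun p : E × ℝ => H p.1 p.2) (w, t) := fun t =>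
    hH.continuousAt ((hU.prod isOpen_univ).mem_nhds ⟨hw, mem_univ _⟩)
  obtain ⟨M, hM⟩ := (isCompact_uIcc (a := a) (b := b)).exists_bound_of_continuousOn
    (f := fun t => H w t) (fun t _ =>
      ((hc t).comp (f := fun t : ℝ => (w, t)) (by fun_prop)).continuousWithinAt)
  refine ⟨M + 1, isCompact_uIcc.eventually_forall_of_forall_eventually fun t ht => ?_⟩
  have h1 : ‖H w t‖ < M + 1 := by linarith [hM t ht]
  exact ((hc t).norm.eventually (gt_mem_nhds h1)).mono fun x hx => hx.le

lemma continuous_slice {U : Set E} {H : E → ℝ → F}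
    (hH : ContinuousOn (fun p : E × ℝ => H p.1 p.2) (U ×ˢ univ)) {w : E} (hw : w ∈ U) :
    Continuous (H w) :=
  hH.comp_continuous (f := fun t : ℝ => (w, t)) (by fun_prop) fun _ => ⟨hw, mem_univ _⟩

lemma continuousOn_intervalIntegral [NormedSpace ℝ F] {U : Set E} (hU : IsOpen U) {H : E → ℝ → F}
    (hH : ContinuousOn (fun p : E × ℝ => H p.1 p.2) (U ×ˢ univ)) (a b : ℝ) :
    ContinuousOn (fun w => ∫ t in a..b, H w t) U := by
  intro w hw
  obtain ⟨M, hM⟩ := eventually_norm_le_of_continuousOn hU hH hw a b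
  refine (intervalIntegral.continuousAt_of_dominated_interval (bound := fun _ => M) ?_ ?_ ?_
    ?_).continuousWithinAt
  · filter_upwards [hU.mem_nhds hw] with x hx
    exact (continuous_slice hH hx).aestronglyMeasurable
  · filter_upwards [hM] with x hx
    exact Eventually.of_forall fun t ht => hx t (uIoc_subset_uIcc ht)
  · exact intervalIntegrable_const
  · refine Eventually.of_forall fun t _ => ?_
    exact (hH.continuousAt ((hU.prod isOpen_univ).mem_nhds ⟨hw, mem_univ t⟩)).comp
      (f := fun x : E => (x, t)) (by fun_prop)

lemma hasFDerivAt_intervalIntegral [NormedSpace ℝ E] {U : Set E} (hU : IsOpen U) {H : E → ℝ → ℂ}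
    {H' : E → ℝ → E →L[ℝ] ℂ}
    (hH : ContinuousOn (fun p : E × ℝ => H p.1 p.2) (U ×ˢ univ))
    (hH' : ContinuousOn (fun p : E × ℝ => H' p.1 p.2) (U ×ˢ univ))
    (hd : ∀ w ∈ U, ∀ t, HasFDerivAt (fun x => H x t) (H' w t) w) {w : E} (hw : w ∈ U) (a b : ℝ) :
    HasFDerivAt (fun x => ∫ t in a..b, H x t) (∫ t in a..b, H' w t) w := by
  obtain ⟨M, hM⟩ := eventually_norm_le_of_continuousOn hU hH' hw a b
  refine intervalIntegral.hasFDerivAt_integral_of_dominated_of_fderiv_le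
    (s := U ∩ {x | ∀ t ∈ uIcc a b, ‖H' x t‖ ≤ M}) (bound := fun _ => M)
    (inter_mem (hU.mem_nhds hw) hM) ?_ ?_ ?_ ?_ ?_ ?_
  · filter_upwards [hU.mem_nhds hw] with x hx
    exact (continuous_slice hH hx).aestronglyMeasurable
  · exact (continuous_slice hH hw).intervalIntegrable _ _
  · exact (continuous_slice hH' hw).aestronglyMeasurable
  · exact Eventually.of_forall fun t ht x hx => hx.2 t (uIoc_subset_uIcc ht)
  · exact intervalIntegrable_const
  · exact Eventually.of_forall fun t _ x hx => hd x hx.1 t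

end ParametricIntegral

/-! ### The Cauchy kernel and its derivative -/

namespace BoundaryParametrization

variable {D : Set ℂ} {m : ℕ} {α : ℝ}

/-- The integral of `a(ζ) / (ζ - z) ^ p` along `∂D`, for a density `a` given as a function of the
parameter. -/
noncomputable def kern (Γ : BoundaryParametrization D m α) (p : ℕ) (a : Fin Γ.n → ℝ → ℂ)
    (z : ℂ) : ℂ :=
  ∑ j, ∫ t in (0 : ℝ)..Γ.period j, a j t * deriv (Γ.curve j) t / (Γ.curve j t - z) ^ p

lemma curve_sub_ne_zero (Γ : BoundaryParametrization D m α) (hD : IsOpen D) {z : ℂ} (hz : z ∈ D)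
    (j : Fin Γ.n) (t : ℝ) : Γ.curve j t - z ≠ 0 := by
  intro h
  have := Γ.curve_mem_frontier j t
  rw [sub_eq_zero.1 h, hD.frontier_eq] at this
  exact this.2 hz

lemma continuous_kern_integrand (Γ : BoundaryParametrization D m α) (hm : 1 ≤ m) (hD : IsOpen D)
    (p : ℕ) {a : Fin Γ.n → ℝ → ℂ} (ha : ∀ j, Continuous (a j)) {z : ℂ} (hz : z ∈ D)
    (j : Fin Γ.n) :
    Continuous fun t => a j t * deriv (Γ.curve j) t / (Γ.curve j t - z) ^ p :=
  ((ha j).mul (Γ.continuous_deriv hm j)).div (((Γ.continuous_curve j).sub continuous_const).pow p)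
    fun t => pow_ne_zero _ (Γ.curve_sub_ne_zero hD hz j t)

lemma kern_add (Γ : BoundaryParametrization D m α) (hm : 1 ≤ m) (hD : IsOpen D)
    (p : ℕ) {a b : Fin Γ.n → ℝ → ℂ} (ha : ∀ j, Continuous (a j)) (hb : ∀ j, Continuous (b j))
    {z : ℂ} (hz : z ∈ D) :
    Γ.kern p (fun j t => a j t + b j t) z = Γ.kern p a z + Γ.kern p b z := by
  unfold kern
  rw [← Finset.sum_add_distrib]
  refine Finset.sum_congr rfl fun j _ => ?_
  rw [← intervalIntegral.integral_add
    ((Γ.continuous_kern_integrand hm hD p ha hz j).intervalIntegrable _ _)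
    ((Γ.continuous_kern_integrand hm hD p hb hz j).intervalIntegrable _ _)]
  congr 1
  ext t
  ring

lemma kern_const_mul (Γ : BoundaryParametrization D m α) (p : ℕ) (a : Fin Γ.n → ℝ → ℂ)
    (c z : ℂ) : Γ.kern p (fun j t => c * a j t) z = c * Γ.kern p a z := by
  unfold kern
  rw [Finset.mul_sum]
  refine Finset.sum_congr rfl fun j _ => ?_
  rw [← intervalIntegral.integral_const_mul]
  congr 1
  ext t
  ring

lemma kern_sub (Γ : BoundaryParametrization D m α) (hm : 1 ≤ m) (hD : IsOpen D)
    (p : ℕ) {a b : Fin Γ.n → ℝ → ℂ} (ha : ∀ j, Continuous (a j)) (hb : ∀ j, Continuous (b j))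
    {z : ℂ} (hz : z ∈ D) :
    Γ.kern p (fun j t => a j t - b j t) z = Γ.kern p a z - Γ.kern p b z := by
  have := Γ.kern_add hm hD p ha (b := fun j t => -1 * b j t) (fun j => by have := hb j; fun_prop) hz
  rw [Γ.kern_const_mul] at this
  rw [sub_eq_add_neg, ← neg_one_mul, ← this]
  congr 1
  ext j t
  ring

/-- Integration by parts along the closed boundary curves. -/
lemma kern_two_eq (Γ : BoundaryParametrization D m α) (hm : 1 ≤ m) (hD : IsOpen D)
    {a a' : Fin Γ.n → ℝ → ℂ} (hd : ∀ j t, HasDerivAt (a j) (a' j t) t)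
    (hper : ∀ j, Function.Periodic (a j) (Γ.period j)) (ha' : ∀ j, Continuous (a' j))
    {z : ℂ} (hz : z ∈ D) :
    Γ.kern 2 a z = Γ.kern 1 (fun j t => a' j t / deriv (Γ.curve j) t) z := by
  unfold kern
  refine Finset.sum_congr rfl fun j _ => ?_
  have hne := Γ.curve_sub_ne_zero hD hz j
  have ha : Continuous (a j) := continuous_iff_continuousAt.2 fun t => (hd j t).continuousAt
  have h1 : ∀ t ∈ uIcc 0 (Γ.period j), HasDerivAt (fun t => a j t * (Γ.curve j t - z)⁻¹)
      (a' j t / deriv (Γ.curve j) t * deriv (Γ.curve j) t / (Γ.curve j t - z) ^ 1 -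
        a j t * deriv (Γ.curve j) t / (Γ.curve j t - z) ^ 2) t := by
    intro t _
    have h2 := (hd j t).fun_mul (((Γ.hasDerivAt_curve hm j t).sub_const z).fun_inv (hne t))
    refine h2.congr_deriv ?_
    have := Γ.deriv_ne_zero j t
    have := hne t
    field_simp
    ring
  have hc1 : Continuous fun t =>
      a' j t / deriv (Γ.curve j) t * deriv (Γ.curve j) t / (Γ.curve j t - z) ^ 1 :=
    (((ha' j).div (Γ.continuous_deriv hm j) (Γ.deriv_ne_zero j)).mul
      (Γ.continuous_deriv hm j)).div (((Γ.continuous_curve j).sub continuous_const).pow 1)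
      fun t => pow_ne_zero _ (hne t)
  have hc2 : Continuous fun t => a j t * deriv (Γ.curve j) t / (Γ.curve j t - z) ^ 2 :=
    (ha.mul (Γ.continuous_deriv hm j)).div (((Γ.continuous_curve j).sub continuous_const).pow 2)
      fun t => pow_ne_zero _ (hne t)
  have h3 := intervalIntegral.integral_eq_sub_of_hasDerivAt h1
    ((hc1.sub hc2).intervalIntegrable _ _)
  rw [intervalIntegral.integral_sub (hc1.intervalIntegrable _ _) (hc2.intervalIntegrable _ _)] at h3
  have h4 : a j (Γ.period j) = a j 0 := (hper j).eq
  have h5 : Γ.curve j (Γ.period j) = Γ.curve j 0 := (Γ.periodic j).eq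
  rw [h4, h5, sub_self] at h3
  exact (sub_eq_zero.1 h3).symm

lemma kern_two_one (Γ : BoundaryParametrization D m α) (hm : 1 ≤ m) (hD : IsOpen D)
    {z : ℂ} (hz : z ∈ D) : Γ.kern 2 (fun _ _ => 1) z = 0 := by
  rw [Γ.kern_two_eq hm hD (a' := fun _ _ => 0) (fun j t => hasDerivAt_const t _)
    (fun j t => rfl) (fun j => continuous_const) hz]
  simp [kern]

lemma hasDerivAt_kern_one (Γ : BoundaryParametrization D m α) (hm : 1 ≤ m) (hD : IsOpen D)
    {a : Fin Γ.n → ℝ → ℂ} (ha : ∀ j, Continuous (a j)) {z : ℂ} (hz : z ∈ D) :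
    HasDerivAt (Γ.kern 1 a) (Γ.kern 2 a z) z := by
  have hc : ∀ p : ℕ, ∀ j, ContinuousOn (fun q : ℂ × ℝ =>
      a j q.2 * deriv (Γ.curve j) q.2 / (Γ.curve j q.2 - q.1) ^ p) (D ×ˢ univ) := by
    intro p j q hq
    have h1 := ha j
    have h2 := Γ.continuous_deriv hm j
    have h3 := Γ.continuous_curve j
    have h4 := pow_ne_zero p (Γ.curve_sub_ne_zero hD hq.1 j q.2)
    have h5 : Continuous fun q : ℂ × ℝ => a j q.2 * deriv (Γ.curve j) q.2 := by fun_prop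
    have h6 : Continuous fun q : ℂ × ℝ => (Γ.curve j q.2 - q.1) ^ p := by fun_prop
    exact (h5.continuousAt.div h6.continuousAt h4).continuousWithinAt
  have key : ∀ j, HasDerivAt
      (fun z => ∫ t in (0 : ℝ)..Γ.period j, a j t * deriv (Γ.curve j) t / (Γ.curve j t - z) ^ 1)
      (∫ t in (0 : ℝ)..Γ.period j, a j t * deriv (Γ.curve j) t / (Γ.curve j t - z) ^ 2) z := by
    intro j
    obtain ⟨M, hM⟩ := eventually_norm_le_of_continuousOn (F := ℂ) hD
      (H := fun z t => a j t * deriv (Γ.curve j) t / (Γ.curve j t - z) ^ 2) (hc 2 j) hz 0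
      (Γ.period j)
    refine (intervalIntegral.hasDerivAt_integral_of_dominated_loc_of_deriv_le
      (F := fun z t => a j t * deriv (Γ.curve j) t / (Γ.curve j t - z) ^ 1)
      (F' := fun z t => a j t * deriv (Γ.curve j) t / (Γ.curve j t - z) ^ 2)
      (bound := fun _ => M) (inter_mem (hD.mem_nhds hz) hM) ?_ ?_ ?_ ?_ ?_ ?_).2
    · filter_upwards [hD.mem_nhds hz] with x hx
      exact (Γ.continuous_kern_integrand hm hD 1 ha hx j).aestronglyMeasurable
    · exact (Γ.continuous_kern_integrand hm hD 1 ha hz j).intervalIntegrable _ _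
    · exact (Γ.continuous_kern_integrand hm hD 2 ha hz j).aestronglyMeasurable
    · exact Eventually.of_forall fun t ht x hx => hx.2 t (uIoc_subset_uIcc ht)
    · exact intervalIntegrable_const
    · refine Eventually.of_forall fun t _ x hx => ?_
      have hne := Γ.curve_sub_ne_zero hD hx.1 j t
      have h1 := (((hasDerivAt_id x).const_sub (Γ.curve j t)).inv hne).const_mul
        (a j t * deriv (Γ.curve j) t)
      simp only [pow_one, div_eq_mul_inv]
      convert! h1 using 1
      simp
  unfold kern
  exact HasDerivAt.fun_sum fun j _ => key j

/-- The Cauchy integral of the constant `1` is bounded on `D`, since it is constant there. -/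
lemma kern_one_one_bounded (Γ : BoundaryParametrization D m α) (hm : 1 ≤ m) (hD : IsOpen D)
    (hc : IsPreconnected D) : ∃ W, ∀ z ∈ D, ‖Γ.kern 1 (fun _ _ => 1) z‖ ≤ W := by
  rcases D.eq_empty_or_nonempty with h | ⟨z₀, hz₀⟩
  · exact ⟨0, fun z hz => absurd hz (h ▸ notMem_empty z)⟩
  refine ⟨‖Γ.kern 1 (fun _ _ => 1) z₀‖, fun z hz => ?_⟩
  have hd : ∀ x ∈ D, HasDerivAt (Γ.kern 1 (fun _ _ => 1)) 0 x := fun x hx => by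
    have := Γ.hasDerivAt_kern_one hm hD (a := fun _ _ => 1) (fun _ => continuous_const) hx
    rwa [Γ.kern_two_one hm hD hx] at this
  rw [hD.is_const_of_deriv_eq_zero hc
    (fun x hx => (hd x hx).differentiableAt.differentiableWithinAt)
    (fun x hx => (hd x hx).deriv) hz hz₀]

lemma exists_nearest (Γ : BoundaryParametrization D m α) (hf : (frontier D).Nonempty) (z : ℂ) :
    ∃ i s, ‖Γ.curve i s - z‖ = Metric.infDist z (frontier D) := by
  obtain ⟨ζ, hζ, h⟩ := Γ.isCompact_frontier.exists_infDist_eq_dist hf z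
  obtain ⟨i, s, rfl⟩ := Γ.exists_of_mem_frontier hζ
  exact ⟨i, s, by rw [h, dist_comm, dist_eq_norm]⟩

lemma integral_abs_symm {G : ℝ → ℝ} {h : ℝ} (hh : 0 ≤ h) (hG : ContinuousOn G (Icc 0 h)) :
    ∫ u in (-h)..h, G |u| = 2 * ∫ u in (0 : ℝ)..h, G u := by
  have hc : ContinuousOn (fun u => G |u|) (Icc (-h) h) :=
    hG.comp continuous_abs.continuousOn fun u hu => ⟨abs_nonneg _, abs_le.2 hu⟩
  have h1 : ∫ u in (-h)..0, G |u| = ∫ u in (0 : ℝ)..h, G u := by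
    have := intervalIntegral.integral_comp_neg (a := 0) (b := h) (fun u => G |u|)
    rw [neg_zero] at this
    rw [← this]
    refine intervalIntegral.integral_congr fun u hu => ?_
    rw [uIcc_of_le hh] at hu
    simp only [abs_neg, abs_of_nonneg hu.1]
  have h2 : ∫ u in (0 : ℝ)..h, G |u| = ∫ u in (0 : ℝ)..h, G u := by
    refine intervalIntegral.integral_congr fun u hu => ?_
    rw [uIcc_of_le hh] at hu
    simp only [abs_of_nonneg hu.1]
  rw [← intervalIntegral.integral_add_adjacent_intervals (b := 0), h1, h2, two_mul]
  · exact (hc.mono (Icc_subset_Icc le_rfl hh)).intervalIntegrable_of_Icc (by linarith)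
  · exact (hc.mono (Icc_subset_Icc (by linarith) le_rfl)).intervalIntegrable_of_Icc hh

/-- The basic estimate of a Cauchy integral through the modulus of continuity `η` of its density.
The value of the density at the boundary point next to `z` is subtracted. -/
lemma norm_kern_le (Γ : BoundaryParametrization D m α) (hm : 1 ≤ m) (hD : IsOpen D)
    (hf : (frontier D).Nonempty) {p : ℕ} {W : ℝ} (hW : ∀ z ∈ D, ‖Γ.kern p (fun _ _ => 1) z‖ ≤ W)
    {R : ℝ} (hR : ∀ j, Γ.period j / 2 ≤ R) :
    ∃ C > 0, ∀ z ∈ D, ∀ (a : Fin Γ.n → ℝ → ℂ) (A : ℝ) (η : ℝ → ℝ), (∀ j, Continuous (a j)) →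
      (∀ j, Function.Periodic (a j) (Γ.period j)) → (∀ j t, ‖a j t‖ ≤ A) →
      ContinuousOn η (Icc 0 R) → (∀ u ∈ Icc 0 R, 0 ≤ η u) →
      (∀ j s t, |t - s| ≤ R → ‖a j t - a j s‖ ≤ η |t - s|) →
      ‖Γ.kern p a z‖ ≤ C * (A + ∫ u in (0 : ℝ)..R,
        η u / (u + Metric.infDist z (frontier D)) ^ p) := by
  obtain ⟨c, hc, hca⟩ := Γ.chord_arc hm
  obtain ⟨d, hd, hsep⟩ := Γ.separated
  obtain ⟨M, hM, hMb⟩ := Γ.exists_norm_deriv_le hm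
  set c' := min (c / 4) (1 / 2) with hc'
  have hc'0 : 0 < c' := by positivity
  have hsum : 0 ≤ ∑ j, 2 * M / (d / 2) ^ p * Γ.period j :=
    Finset.sum_nonneg fun j _ => by have := Γ.period_pos j; positivity
  refine ⟨|W| + ∑ j, 2 * M / (d / 2) ^ p * Γ.period j + 2 * (M / c' ^ p), by positivity,
    fun z hz a A η ha hper hA hη hη0 hmod => ?_⟩
  set δ := Metric.infDist z (frontier D) with hδ
  obtain ⟨i, s, his⟩ := Γ.exists_nearest hf z
  have hδ0 : 0 < δ := by
    rw [hδ, ← his]; exact norm_pos_iff.2 (Γ.curve_sub_ne_zero hD hz i s)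
  have hR0 : 0 ≤ R := le_trans (by have := Γ.period_pos i; positivity) (hR i)
  have hA0 : 0 ≤ A := (norm_nonneg _).trans (hA i s)
  have hδle : ∀ j t, δ ≤ ‖Γ.curve j t - z‖ := fun j t => by
    have := Metric.infDist_le_dist_of_mem (x := z) (Γ.curve_mem_frontier j t)
    rwa [dist_comm, dist_eq_norm] at this
  -- `γᵢ(s)` is next to `z`, so the distance to `z` is at least half the distance to `γᵢ(s)`
  have hfar : ∀ j t, ‖Γ.curve j t - Γ.curve i s‖ ≤ 2 * ‖Γ.curve j t - z‖ := fun j t => by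
    calc _ = ‖(Γ.curve j t - z) - (Γ.curve i s - z)‖ := by congr 1; ring
      _ ≤ ‖Γ.curve j t - z‖ + ‖Γ.curve i s - z‖ := norm_sub_le _ _
      _ ≤ _ := by rw [his]; linarith [hδle j t]
  have hsplit : Γ.kern p a z = Γ.kern p (fun j t => a j t - a i s) z +
      a i s * Γ.kern p (fun _ _ => 1) z := by
    rw [← Γ.kern_const_mul, ← Γ.kern_add hm hD p (a := fun j t => a j t - a i s)
      (b := fun _ _ => a i s * 1) (fun j => (ha j).sub continuous_const)
      (fun j => continuous_const) hz]
    congr 1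
    ext j t
    ring
  set J := ∫ u in (0 : ℝ)..R, η u / (u + δ) ^ p with hJ
  have hGc : ContinuousOn (fun u => η u / (u + δ) ^ p) (Icc 0 R) :=
    hη.div (by fun_prop) fun u hu => by have := hu.1; positivity
  have hG0 : ∀ u ∈ Icc 0 R, 0 ≤ η u / (u + δ) ^ p := fun u hu => by
    have := hη0 u hu; have := hu.1; positivity
  have hJ0 : 0 ≤ J := intervalIntegral.integral_nonneg hR0 hG0
  -- the curve that contains `γᵢ(s)` contributes `J`; the others stay away from `z`
  have hterm : ∀ j, ‖∫ t in (0 : ℝ)..Γ.period j,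
      (a j t - a i s) * deriv (Γ.curve j) t / (Γ.curve j t - z) ^ p‖ ≤
      2 * M / (d / 2) ^ p * Γ.period j * A + if j = i then 2 * (M / c' ^ p) * J else 0 := by
    intro j
    have hL := Γ.period_pos j
    split_ifs with hji
    · subst hji
      set h := Γ.period j / 2 with hh
      have hh0 : 0 < h := by positivity
      have hperi : Function.Periodic (fun t => (a j t - a j s) * deriv (Γ.curve j) t /
          (Γ.curve j t - z) ^ p) (Γ.period j) := fun t => by
        simp only [hper j t, Γ.periodic j t, Γ.deriv_periodic j t]
      have h1 := hperi.intervalIntegral_add_eq 0 (s - h)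
      rw [zero_add] at h1
      rw [h1]
      have h2 : s - h + Γ.period j = s + h := by rw [hh]; ring
      rw [h2]
      have hGc' : ContinuousOn (fun u => M / c' ^ p * (η u / (u + δ) ^ p)) (Icc 0 h) :=
        (continuousOn_const.mul hGc).mono (Icc_subset_Icc le_rfl (hR j))
      have hbound : ‖∫ t in (s - h)..(s + h), (a j t - a j s) * deriv (Γ.curve j) t /
          (Γ.curve j t - z) ^ p‖ ≤
          ∫ t in (s - h)..(s + h), M / c' ^ p * (η |t - s| / (|t - s| + δ) ^ p) := by
        refine intervalIntegral.norm_integral_le_of_norm_le (by linarith) ?_ ?_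
        · refine Eventually.of_forall fun t ht => ?_
          have hts : |t - s| ≤ h := abs_le.2 ⟨by linarith [ht.1], by linarith [ht.2]⟩
          have h3 : c' * (|t - s| + δ) ≤ ‖Γ.curve j t - z‖ := by
            have e1 := hca j s t hts
            have e2 := hfar j t
            have e3 := hδle j t
            have e4 : c' * |t - s| ≤ c / 4 * |t - s| := by gcongr; exact min_le_left _ _
            have e5 : c' * δ ≤ 1 / 2 * δ := by gcongr; exact min_le_right _ _
            linarith
          rw [norm_div, norm_mul, norm_pow]
          have e6 : M / c' ^ p * (η |t - s| / (|t - s| + δ) ^ p) =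
              η |t - s| * M / (c' * (|t - s| + δ)) ^ p := by
            rw [mul_pow]; field_simp
          rw [e6]
          have e7 := hmod j s t (hts.trans (hR j))
          have e8 := hη0 _ ⟨abs_nonneg _, hts.trans (hR j)⟩
          have e9 := hMb j t
          gcongr
        · have hc2 : ContinuousOn (fun t => M / c' ^ p * (η |t - s| / (|t - s| + δ) ^ p))
              (Icc (s - h) (s + h)) :=
            hGc'.comp (f := fun t => |t - s|) (by fun_prop) fun t ht =>
              ⟨abs_nonneg _, abs_le.2 ⟨by linarith [ht.1], by linarith [ht.2]⟩⟩
          exact hc2.intervalIntegrable_of_Icc (by linarith)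
      refine hbound.trans ?_
      rw [intervalIntegral.integral_comp_sub_right
        (fun u => M / c' ^ p * (η |u| / (|u| + δ) ^ p)) s,
        show s - h - s = -h by ring, show s + h - s = h by ring,
        integral_abs_symm (G := fun u => M / c' ^ p * (η u / (u + δ) ^ p)) hh0.le hGc',
        intervalIntegral.integral_const_mul]
      have h5 : ∫ u in (0 : ℝ)..h, η u / (u + δ) ^ p ≤ J := by
        refine intervalIntegral.integral_mono_interval le_rfl hh0.le (hR j) ?_ ?_
        · refine (MeasureTheory.ae_restrict_iff' measurableSet_Ioc).2
            (Eventually.of_forall fun u hu => hG0 u (Ioc_subset_Icc_self hu))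
        · exact hGc.intervalIntegrable_of_Icc hR0
      have h6 : 0 ≤ 2 * M / (d / 2) ^ p * Γ.period j * A := by positivity
      have h7 : M / c' ^ p * ∫ u in (0 : ℝ)..h, η u / (u + δ) ^ p ≤ M / c' ^ p * J := by gcongr
      linarith
    · have h1 : ∀ t ∈ uIoc 0 (Γ.period j), ‖(a j t - a i s) * deriv (Γ.curve j) t /
          (Γ.curve j t - z) ^ p‖ ≤ 2 * A * M / (d / 2) ^ p := by
        intro t _
        have h3 : d / 2 ≤ ‖Γ.curve j t - z‖ := by
          have := hsep j i t s hji
          have := hfar j t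
          linarith
        rw [norm_div, norm_mul, norm_pow]
        have e7 : ‖a j t - a i s‖ ≤ 2 * A :=
          (norm_sub_le _ _).trans (by linarith [hA j t, hA i s])
        have e9 := hMb j t
        gcongr
      have h2 := intervalIntegral.norm_integral_le_of_norm_le_const h1
      rw [sub_zero, abs_of_pos hL] at h2
      refine h2.trans (le_of_eq ?_)
      ring
  have hk1 : ‖Γ.kern p (fun j t => a j t - a i s) z‖ ≤
      (∑ j, 2 * M / (d / 2) ^ p * Γ.period j) * A + 2 * (M / c' ^ p) * J := by
    unfold kern
    refine (norm_sum_le _ _).trans ((Finset.sum_le_sum fun j _ => hterm j).trans ?_)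
    rw [Finset.sum_add_distrib, Finset.sum_mul, Finset.sum_ite_eq' Finset.univ i]
    simp
  have hk2 : ‖a i s * Γ.kern p (fun _ _ => 1) z‖ ≤ |W| * A := by
    rw [norm_mul, mul_comm]
    have := (hW z hz).trans (le_abs_self W)
    have := hA i s
    gcongr
  rw [hsplit]
  refine (norm_add_le _ _).trans ?_
  have e1 : 0 ≤ |W| * J := by positivity
  have e2 : 0 ≤ (∑ j, 2 * M / (d / 2) ^ p * Γ.period j) * J := by positivity
  have e3 : 0 ≤ 2 * (M / c' ^ p) * A := by positivity
  nlinarith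

end BoundaryParametrization

/-! ### Real partial derivatives on `ℂ × 𝕜` -/

section PartialDerivatives

variable {𝕜 : Type*} [RCLike 𝕜]

/-- The real coordinates of `ℂ × 𝕜`, dual to `coordDir`. -/
noncomputable def coordForm (𝕜 : Type*) [RCLike 𝕜] : Fin 4 → (ℂ × 𝕜 →L[ℝ] ℝ) :=
  ![Complex.reCLM ∘L ContinuousLinearMap.fst ℝ ℂ 𝕜, Complex.imCLM ∘L ContinuousLinearMap.fst ℝ ℂ 𝕜,
    RCLike.reCLM ∘L ContinuousLinearMap.snd ℝ ℂ 𝕜, RCLike.imCLM ∘L ContinuousLinearMap.snd ℝ ℂ 𝕜]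

/-- The real linear form on `ℂ × 𝕜` with partial derivatives `c i`. -/
noncomputable def realLin (𝕜 : Type*) [RCLike 𝕜] (c : Fin 4 → ℂ) : ℂ × 𝕜 →L[ℝ] ℂ :=
  ∑ i, (coordForm 𝕜 i).smulRight (c i)

lemma realLin_apply (c : Fin 4 → ℂ) (w : ℂ × 𝕜) :
    realLin 𝕜 c w = w.1.re * c 0 + w.1.im * c 1 + RCLike.re w.2 * c 2 + RCLike.im w.2 * c 3 := by
  simp [realLin, coordForm, Fin.sum_univ_four]

lemma norm_realLin_apply_le {c : Fin 4 → ℂ} {N : ℝ} (hc : ∀ i, ‖c i‖ ≤ N) (w : ℂ × 𝕜) :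
    ‖realLin 𝕜 c w‖ ≤ 2 * N * (‖w.1‖ + ‖w.2‖) := by
  have hN : 0 ≤ N := (norm_nonneg _).trans (hc 0)
  have h : ∀ (x : ℝ) (i : Fin 4) (y : ℝ), |x| ≤ y → ‖(x : ℂ) * c i‖ ≤ y * N := fun x i y hx => by
    have := hc i
    rw [norm_mul, Complex.norm_real, Real.norm_eq_abs]
    have h0 := (abs_nonneg x).trans hx
    gcongr
  rw [realLin_apply]
  refine (norm_add_le _ _).trans ?_
  have h0 := norm_add₃_le (a := (w.1.re : ℂ) * c 0) (b := (w.1.im : ℂ) * c 1)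
    (c := ((RCLike.re w.2 : ℝ) : ℂ) * c 2)
  have h1 := h _ 0 _ (Complex.abs_re_le_norm w.1)
  have h2 := h _ 1 _ (Complex.abs_im_le_norm w.1)
  have h3 := h _ 2 _ (RCLike.abs_re_le_norm w.2)
  have h4 := h _ 3 _ (RCLike.abs_im_le_norm w.2)
  linarith

lemma realLin_coordDir (L : ℂ × 𝕜 →L[ℝ] ℂ) : realLin 𝕜 (fun i => L (coordDir 𝕜 i)) = L := by
  refine ContinuousLinearMap.ext fun w => ?_
  have hw : w = w.1.re • coordDir 𝕜 0 + w.1.im • coordDir 𝕜 1 +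
      (RCLike.re w.2 : ℝ) • coordDir 𝕜 2 + (RCLike.im w.2 : ℝ) • coordDir 𝕜 3 := by
    refine Prod.ext ?_ ?_
    · simp [coordDir, Complex.re_add_im]
    · simp only [coordDir, Prod.snd_add, Prod.smul_snd, Matrix.cons_val]
      simp only [smul_zero, zero_add]
      rw [RCLike.real_smul_eq_coe_mul, RCLike.real_smul_eq_coe_mul, mul_one,
        RCLike.re_add_im]
  rw [realLin_apply]
  conv_rhs => rw [hw]
  simp only [map_add, map_smul, Complex.real_smul]

lemma EqOn.coordDeriv {Ω : Set (ℂ × 𝕜)} (hΩ : IsOpen Ω) {g h : ℂ × 𝕜 → ℂ} (hgh : EqOn g h Ω)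
    (i : Fin 4) : EqOn (coordDeriv i g) (coordDeriv i h) Ω := fun w hw => by
  have : g =ᶠ[𝓝 w] h := hgh.eventuallyEq_of_mem (hΩ.mem_nhds hw)
  simp only [_root_.coordDeriv, this.fderiv_eq]

lemma EqOn.coordDeriv_iterate {Ω : Set (ℂ × 𝕜)} (hΩ : IsOpen Ω) {g h : ℂ × 𝕜 → ℂ}
    (hgh : EqOn g h Ω) (i : Fin 4) (n : ℕ) :
    EqOn ((_root_.coordDeriv i)^[n] g) ((_root_.coordDeriv i)^[n] h) Ω := by
  induction n with
  | zero => exact hgh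
  | succ n ih =>
    rw [Function.iterate_succ_apply', Function.iterate_succ_apply']
    exact EqOn.coordDeriv hΩ ih i

lemma ContDiffOn.coordDeriv {Ω : Set (ℂ × 𝕜)} (hΩ : IsOpen Ω) {g : ℂ × 𝕜 → ℂ} {n : ℕ}
    (hg : ContDiffOn ℝ (n + 1 : ℕ) g Ω) (i : Fin 4) : ContDiffOn ℝ n (coordDeriv i g) Ω := by
  have h : ContDiffOn ℝ n (fderiv ℝ g) Ω :=
    ((contDiffOn_succ_iff_fderiv_of_isOpen hΩ).1 (by exact_mod_cast hg)).2.2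
  exact h.clm_apply contDiffOn_const

lemma ContDiffOn.coordDeriv_iterate {Ω : Set (ℂ × 𝕜)} (hΩ : IsOpen Ω) {g : ℂ × 𝕜 → ℂ} {n p : ℕ}
    (hg : ContDiffOn ℝ (p + n : ℕ) g Ω) (i : Fin 4) :
    ContDiffOn ℝ p ((_root_.coordDeriv i)^[n] g) Ω := by
  induction n generalizing p with
  | zero => exact hg
  | succ n ih =>
    rw [Function.iterate_succ_apply']
    exact ContDiffOn.coordDeriv hΩ (ih (p := p + 1) (by rwa [add_assoc, add_comm 1 n])) i

lemma coordDeriv_comm {Ω : Set (ℂ × 𝕜)} (hΩ : IsOpen Ω) {g : ℂ × 𝕜 → ℂ}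
    (hg : ContDiffOn ℝ 2 g Ω) (i j : Fin 4) :
    EqOn (coordDeriv i (coordDeriv j g)) (coordDeriv j (coordDeriv i g)) Ω := fun w hw => by
  have hgw : ContDiffAt ℝ 2 g w := hg.contDiffAt (hΩ.mem_nhds hw)
  have hs := hgw.isSymmSndFDerivAt (by simp)
  have hd : DifferentiableAt ℝ (fderiv ℝ g) w :=
    (hgw.fderiv_right (m := 1) (by norm_num)).differentiableAt (by norm_num)
  have key : ∀ i j, coordDeriv i (coordDeriv j g) w =
      fderiv ℝ (fderiv ℝ g) w (coordDir 𝕜 i) (coordDir 𝕜 j) := fun i j => by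
    have h1 : HasFDerivAt (fun w => fderiv ℝ g w (coordDir 𝕜 j)) _ w :=
      hd.hasFDerivAt.clm_apply (hasFDerivAt_const (coordDir 𝕜 j) w)
    unfold coordDeriv
    rw [h1.fderiv]
    simp
  rw [key, key]
  exact hs _ _

lemma coordDeriv_iterate_comm {Ω : Set (ℂ × 𝕜)} (hΩ : IsOpen Ω) {n : ℕ} {g : ℂ × 𝕜 → ℂ}
    (hg : ContDiffOn ℝ (n + 1 : ℕ) g Ω) (i j : Fin 4) :
    EqOn (coordDeriv i ((coordDeriv j)^[n] g)) ((coordDeriv j)^[n] (coordDeriv i g)) Ω := by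
  induction n generalizing g with
  | zero => exact eqOn_refl _ _
  | succ n ih =>
    rw [Function.iterate_succ_apply, Function.iterate_succ_apply]
    refine (ih (ContDiffOn.coordDeriv hΩ hg j)).trans (EqOn.coordDeriv_iterate hΩ ?_ j n)
    exact coordDeriv_comm hΩ (hg.of_le (by norm_cast; omega)) i j

lemma contDiffOn_partialDeriv {Ω : Set (ℂ × 𝕜)} (hΩ : IsOpen Ω) {f : ℂ × 𝕜 → ℂ} {k p : ℕ}
    (hf : ContDiffOn ℝ k f Ω) {β : Fin 4 → ℕ} (hβ : ∑ i, β i + p ≤ k) :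
    ContDiffOn ℝ p (partialDeriv β f) Ω := by
  rw [Fin.sum_univ_four] at hβ
  unfold partialDeriv
  refine ContDiffOn.coordDeriv_iterate hΩ ?_ 0
  refine ContDiffOn.coordDeriv_iterate hΩ ?_ 1
  refine ContDiffOn.coordDeriv_iterate hΩ ?_ 2
  refine ContDiffOn.coordDeriv_iterate hΩ ?_ 3
  exact hf.of_le (by exact_mod_cast (by omega))

lemma coordDeriv_partialDeriv {Ω : Set (ℂ × 𝕜)} (hΩ : IsOpen Ω) {f : ℂ × 𝕜 → ℂ} {k : ℕ}
    (hf : ContDiffOn ℝ k f Ω) {β : Fin 4 → ℕ} (hβ : ∑ i, β i < k) (i : Fin 4) :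
    EqOn (coordDeriv i (partialDeriv β f)) (partialDeriv (β + Pi.single i 1) f) Ω := by
  rw [Fin.sum_univ_four] at hβ
  have h3 : ∀ n p, p + n ≤ k → ContDiffOn ℝ p ((coordDeriv 3)^[n] f) Ω := fun n p h =>
    ContDiffOn.coordDeriv_iterate hΩ (hf.of_le (by exact_mod_cast h)) 3
  have h2 : ContDiffOn ℝ (β 0 + β 1 + 1 : ℕ) ((coordDeriv 2)^[β 2] ((coordDeriv 3)^[β 3] f)) Ω :=
    ContDiffOn.coordDeriv_iterate hΩ (h3 _ _ (by omega)) 2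
  have h1 : ContDiffOn ℝ (β 0 + 1 : ℕ) ((coordDeriv 1)^[β 1]
      ((coordDeriv 2)^[β 2] ((coordDeriv 3)^[β 3] f))) Ω :=
    ContDiffOn.coordDeriv_iterate hΩ (h2.of_le (by norm_cast; omega)) 1
  fin_cases i
  · simp only [partialDeriv, Fin.zero_eta, Pi.add_apply, Pi.single_eq_same]
    rw [Function.iterate_succ_apply']
    exact eqOn_refl _ _
  · simp only [partialDeriv, Fin.mk_one, Pi.add_apply, Pi.single_eq_same]
    rw [Function.iterate_succ_apply']
    exact coordDeriv_iterate_comm hΩ h1 1 0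
  · simp only [partialDeriv, Fin.reduceFinMk, Pi.add_apply, Pi.single_eq_same]
    rw [Function.iterate_succ_apply']
    refine (coordDeriv_iterate_comm hΩ h1 2 0).trans (EqOn.coordDeriv_iterate hΩ ?_ 0 _)
    exact coordDeriv_iterate_comm hΩ (h2.of_le (by norm_cast; omega)) 2 1
  · simp only [partialDeriv, Fin.reduceFinMk, Pi.add_apply, Pi.single_eq_same]
    rw [Function.iterate_succ_apply']
    refine (coordDeriv_iterate_comm hΩ h1 3 0).trans (EqOn.coordDeriv_iterate hΩ ?_ 0 _)
    refine (coordDeriv_iterate_comm hΩ (h2.of_le (by norm_cast; omega)) 3 1).trans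
      (EqOn.coordDeriv_iterate hΩ ?_ 1 _)
    exact coordDeriv_iterate_comm hΩ (h3 _ _ (by omega)) 3 2

end PartialDerivatives

/-! ### Jets of log-Hölder functions -/

section Jets

variable {𝕜 : Type*} [RCLike 𝕜]

/-- The family `G` consists of the partial derivatives up to order `k` of a function of norm at
most `N` in `C^{k, L^α Log^ν L}(D × Λ)`. -/
structure IsJet (k : ℕ) (α ν : ℝ) (D : Set ℂ) (Λ : Set 𝕜) (G : (Fin 4 → ℕ) → ℂ × 𝕜 → ℂ)
    (N : ℝ) : Prop where
  nonneg : 0 ≤ N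
  hasFDerivAt : ∀ β, ∑ i, β i < k → ∀ w ∈ D ×ˢ Λ,
    HasFDerivAt (G β) (realLin 𝕜 fun i => G (β + Pi.single i 1) w) w
  continuousOn : ∀ β, ∑ i, β i ≤ k → ContinuousOn (G β) (D ×ˢ Λ)
  norm_le : ∀ β, ∑ i, β i ≤ k → ∀ w ∈ D ×ˢ Λ, ‖G β w‖ ≤ N
  holder : ∀ β, ∑ i, β i = k → ∀ w ∈ D ×ˢ Λ, ∀ w' ∈ D ×ˢ Λ, 0 < euclidDist w w' →
    euclidDist w w' ≤ 1 / 2 → ‖G β w' - G β w‖ ≤ N * logMod α ν (euclidDist w w')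

lemma MemLogHolder.isJet {k : ℕ} {α ν : ℝ} {D : Set ℂ} {Λ : Set 𝕜} (hD : IsOpen D) (hΛ : IsOpen Λ)
    {f : ℂ × 𝕜 → ℂ} (hf : MemLogHolder k α ν (D ×ˢ Λ) f) :
    IsJet k α ν D Λ (fun β => partialDeriv β f) (logHolderNorm k α ν (D ×ˢ Λ) f).toReal where
  nonneg := ENNReal.toReal_nonneg
  hasFDerivAt β hβ w hw := by
    have hΩ := hD.prod hΛ
    have h1 : DifferentiableAt ℝ (partialDeriv β f) w :=
      ((contDiffOn_partialDeriv hΩ hf.1 (p := 1) (by omega)).contDiffAt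
        (hΩ.mem_nhds hw)).differentiableAt (by norm_num)
    refine h1.hasFDerivAt.congr_fderiv ?_
    rw [← realLin_coordDir (fderiv ℝ (partialDeriv β f) w)]
    congr 1
    ext i
    exact coordDeriv_partialDeriv hΩ hf.1 hβ i hw
  continuousOn β hβ :=
    (contDiffOn_partialDeriv (hD.prod hΛ) hf.1 (p := 0) (by omega)).continuousOn
  norm_le β hβ w hw := by
    have h1 : ‖partialDeriv β f w‖ₑ ≤ supNormOn (D ×ˢ Λ) (partialDeriv β f) :=
      le_iSup₂ (f := fun w _ => ‖partialDeriv β f w‖ₑ) w hw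
    have h2 : supNormOn (D ×ˢ Λ) (partialDeriv β f) ≤ logHolderNorm k α ν (D ×ˢ Λ) f := by
      refine le_trans ?_ le_self_add
      refine le_trans ?_ (Finset.single_le_sum (fun _ _ => zero_le)
        (Finset.mem_range.2 (Nat.lt_succ_of_le hβ)))
      exact Finset.single_le_sum (f := fun γ => supNormOn (D ×ˢ Λ) (partialDeriv γ f))
        (fun _ _ => zero_le) (Finset.Nat.mem_antidiagonalTuple.2 rfl)
    have h3 := ENNReal.toReal_mono hf.2.ne (h1.trans h2)
    rwa [toReal_enorm] at h3
  holder β hβ w hw w' hw' h0 h1 := by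
    set d := euclidDist w w'
    have hp : 0 < logMod α ν d := logMod_pos h0 h1
    have h2 : ‖partialDeriv β f w' - partialDeriv β f w‖ₑ / ENNReal.ofReal (logMod α ν d) ≤
        logHolderSeminorm α ν (D ×ˢ Λ) (partialDeriv β f) := by
      unfold logHolderSeminorm
      refine le_trans ?_ (le_iSup₂ w hw)
      refine le_trans ?_ (le_iSup₂ w' hw')
      exact le_iSup_of_le ⟨h0, h1⟩ le_rfl
    have h3 : logHolderSeminorm α ν (D ×ˢ Λ) (partialDeriv β f) ≤
        logHolderNorm k α ν (D ×ˢ Λ) f := by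
      refine le_trans ?_ le_add_self
      exact Finset.single_le_sum (f := fun γ => logHolderSeminorm α ν (D ×ˢ Λ) (partialDeriv γ f))
        (fun _ _ => zero_le) (Finset.Nat.mem_antidiagonalTuple.2 hβ)
    have h4 := h2.trans h3
    rw [ENNReal.div_le_iff (by simpa using hp) ENNReal.ofReal_ne_top] at h4
    have h5 := ENNReal.toReal_mono (ENNReal.mul_ne_top hf.2.ne ENNReal.ofReal_ne_top) h4
    rwa [toReal_enorm, ENNReal.toReal_mul, ENNReal.toReal_ofReal hp.le] at h5

/-- The number of terms in the norm of `C^{k, L^α Log^ν L}`. -/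
def termCount (k : ℕ) : ℕ :=
  (∑ j ∈ Finset.range (k + 1), (Finset.Nat.antidiagonalTuple 4 j).card) +
    (Finset.Nat.antidiagonalTuple 4 k).card

lemma logHolderNorm_le {k : ℕ} {α ν : ℝ} {Ω : Set (ℂ × 𝕜)} {g : ℂ × 𝕜 → ℂ} {B : ℝ}
    (h0 : ∀ β : Fin 4 → ℕ, ∑ i, β i ≤ k → ∀ w ∈ Ω, ‖partialDeriv β g w‖ ≤ B)
    (h1 : ∀ β : Fin 4 → ℕ, ∑ i, β i = k → ∀ w ∈ Ω, ∀ w' ∈ Ω, 0 < euclidDist w w' →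
      euclidDist w w' ≤ 1 / 2 →
      ‖partialDeriv β g w' - partialDeriv β g w‖ ≤ B * logMod α ν (euclidDist w w')) :
    logHolderNorm k α ν Ω g ≤ termCount k * ENNReal.ofReal B := by
  unfold logHolderNorm termCount
  push_cast
  rw [add_mul, Finset.sum_mul]
  refine add_le_add (Finset.sum_le_sum fun j hj => ?_) ?_
  · rw [← nsmul_eq_mul]
    refine Finset.sum_le_card_nsmul _ _ _ fun β hβ => ?_
    refine iSup₂_le fun w hw => ?_
    rw [← ofReal_norm]
    refine ENNReal.ofReal_le_ofReal (h0 β ?_ w hw)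
    rw [Finset.Nat.mem_antidiagonalTuple.1 hβ]
    exact Nat.lt_succ_iff.1 (Finset.mem_range.1 hj)
  · rw [← nsmul_eq_mul]
    refine Finset.sum_le_card_nsmul _ _ _ fun β hβ => ?_
    refine iSup₂_le fun w hw => iSup₂_le fun w' hw' => iSup_le fun hd => ?_
    have hp : 0 < logMod α ν (euclidDist w w') := logMod_pos hd.1 hd.2
    have h2 := h1 β (Finset.Nat.mem_antidiagonalTuple.1 hβ) w hw w' hw' hd.1 hd.2
    have hB : 0 ≤ B := le_of_mul_le_mul_right (by rw [zero_mul]; exact (norm_nonneg _).trans h2) hp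
    rw [ENNReal.div_le_iff (by simpa using! hp) ENNReal.ofReal_ne_top, ← ENNReal.ofReal_mul hB,
      ← ofReal_norm]
    exact ENNReal.ofReal_le_ofReal h2

end Jets

/-! ### Boundary values of functions with a logarithmic modulus of continuity -/

lemma tendsto_extendFrom_of_cutMod {α ν K : ℝ} (hα : 0 < α) (hK : 0 ≤ K) {D : Set ℂ} {g : ℂ → ℂ}
    (hg : ∀ z ∈ D, ∀ z' ∈ D, ‖g z - g z'‖ ≤ K * cutMod α ν ‖z - z'‖) {ζ : ℂ}
    (hζ : ζ ∈ closure D) : Tendsto g (𝓝[D] ζ) (𝓝 (extendFrom D g ζ)) := by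
  have := mem_closure_iff_nhdsWithin_neBot.1 hζ
  apply tendsto_extendFrom
  obtain ⟨C, hC, hCb⟩ := cutMod_le_rpow hα ν
  refine cauchy_map_iff_exists_tendsto.1 (Metric.cauchy_iff.2 ⟨inferInstance, fun ε hε => ?_⟩)
  have h1 : Tendsto (fun u : ℝ => K * (C * (2 * u) ^ (α / 2))) (𝓝[>] 0) (𝓝 0) := by
    have hc : Continuous fun u : ℝ => K * (C * (2 * u) ^ (α / 2)) :=
      continuous_const.mul (continuous_const.mul
        ((continuous_const.mul continuous_id).rpow_const fun _ => Or.inr (by positivity)))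
    refine (hc.tendsto' 0 0 ?_).mono_left nhdsWithin_le_nhds
    rw [mul_zero, Real.zero_rpow (by positivity)]
    ring
  obtain ⟨u, hu, hu0⟩ := ((h1.eventually (gt_mem_nhds hε)).and self_mem_nhdsWithin).exists
  refine ⟨g '' (D ∩ Metric.ball ζ u), image_mem_map (inter_mem self_mem_nhdsWithin
    (mem_nhdsWithin_of_mem_nhds (Metric.ball_mem_nhds _ hu0))), ?_⟩
  rintro _ ⟨z, ⟨hz, hzu⟩, rfl⟩ _ ⟨z', ⟨hz', hzu'⟩, rfl⟩
  rw [dist_eq_norm]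
  have h2 : ‖z - z'‖ ≤ 2 * u := by
    rw [← dist_eq_norm]
    have := dist_triangle_right z z' ζ
    rw [Metric.mem_ball] at hzu hzu'
    linarith
  refine (hg z hz z' hz').trans_lt (lt_of_le_of_lt ?_ hu)
  refine mul_le_mul_of_nonneg_left ((hCb _ (norm_nonneg _)).trans ?_) hK
  gcongr

/-- A modulus of continuity passes to the boundary values, up to a constant. -/
lemma extendFrom_cutMod {α : ℝ} (hα : 0 < α) (ν : ℝ) : ∃ C > 0, ∀ (K : ℝ) (D : Set ℂ) (g : ℂ → ℂ),
    0 ≤ K → (∀ z ∈ D, ∀ z' ∈ D, ‖g z - g z'‖ ≤ K * cutMod α ν ‖z - z'‖) →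
    ∀ z ∈ closure D, ∀ z' ∈ closure D,
      ‖extendFrom D g z - extendFrom D g z'‖ ≤ C * K * cutMod α ν ‖z - z'‖ := by
  obtain ⟨C₁, hC₁, h₁⟩ := cutMod_mono hα ν
  obtain ⟨C₂, hC₂, h₂⟩ := cutMod_dilate hα ν (M := 2) (by norm_num)
  refine ⟨C₁ * C₂, by positivity, fun K D g hK hg z hz z' hz' => ?_⟩
  rcases eq_or_ne z z' with rfl | hne
  · simp [cutMod_zero hα]
  have := mem_closure_iff_nhdsWithin_neBot.1 hz
  have := mem_closure_iff_nhdsWithin_neBot.1 hz'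
  have t1 := tendsto_extendFrom_of_cutMod hα hK hg hz
  have t2 := tendsto_extendFrom_of_cutMod hα hK hg hz'
  have h0 : 0 < ‖z - z'‖ := norm_pos_iff.2 (sub_ne_zero.2 hne)
  have t3 : Tendsto (fun p : ℂ × ℂ => ‖g p.1 - g p.2‖) (𝓝[D] z ×ˢ 𝓝[D] z')
      (𝓝 ‖extendFrom D g z - extendFrom D g z'‖) :=
    ((t1.comp tendsto_fst).sub (t2.comp tendsto_snd)).norm
  have t4 : Tendsto (fun p : ℂ × ℂ => ‖p.1 - p.2‖) (𝓝[D] z ×ˢ 𝓝[D] z') (𝓝 ‖z - z'‖) := by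
    refine ((tendsto_fst.mono_right ?_).sub (tendsto_snd.mono_right ?_)).norm
    · exact nhdsWithin_le_nhds
    · exact nhdsWithin_le_nhds
  refine le_of_tendsto t3 ?_
  have e1 : ∀ᶠ p : ℂ × ℂ in 𝓝[D] z ×ˢ 𝓝[D] z', p.1 ∈ D ∧ p.2 ∈ D :=
    prod_mem_prod self_mem_nhdsWithin self_mem_nhdsWithin
  filter_upwards [e1, t4.eventually (gt_mem_nhds (show ‖z - z'‖ < 2 * ‖z - z'‖ by linarith))]
    with p hp hlt
  refine (hg _ hp.1 _ hp.2).trans ?_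
  calc K * cutMod α ν ‖p.1 - p.2‖ ≤ K * (C₁ * cutMod α ν (2 * ‖z - z'‖)) := by
        gcongr; exact h₁ _ _ (norm_nonneg _) hlt.le
    _ ≤ K * (C₁ * (C₂ * cutMod α ν ‖z - z'‖)) := by
        gcongr; exact h₂ _ h0.le
    _ = _ := by ring

/-! ### Moduli of continuity of jets -/

section JetModulus

variable {𝕜 : Type*} [RCLike 𝕜] {k : ℕ} {α ν : ℝ} {D : Set ℂ} {Λ : Set 𝕜}
  {G : (Fin 4 → ℕ) → ℂ × 𝕜 → ℂ} {N : ℝ}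

lemma norm_fst_le_euclidDist (w w' : ℂ × 𝕜) : ‖w'.1 - w.1‖ ≤ euclidDist w w' :=
  Real.le_sqrt_of_sq_le (by have := sq_nonneg ‖w'.2 - w.2‖; linarith)

lemma norm_snd_le_euclidDist (w w' : ℂ × 𝕜) : ‖w'.2 - w.2‖ ≤ euclidDist w w' :=
  Real.le_sqrt_of_sq_le (by have := sq_nonneg ‖w'.1 - w.1‖; linarith)

lemma euclidDist_of_snd_eq (z z' : ℂ) (l : 𝕜) : euclidDist (z, l) (z', l) = ‖z' - z‖ := by
  simp [euclidDist]

lemma euclidDist_of_fst_eq (z : ℂ) (l l' : 𝕜) : euclidDist (z, l) (z, l') = ‖l' - l‖ := by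
  simp [euclidDist]

lemma IsJet.hasFDerivAt_z (hG : IsJet k α ν D Λ G N) {β : Fin 4 → ℕ} (hβ : ∑ i, β i < k) {l : 𝕜}
    (hl : l ∈ Λ) {z : ℂ} (hz : z ∈ D) :
    HasFDerivAt (fun z => G β (z, l)) (realLin 𝕜 (fun i => G (β + Pi.single i 1) (z, l)) ∘L
      ContinuousLinearMap.inl ℝ ℂ 𝕜) z :=
  (hG.hasFDerivAt β hβ (z, l) ⟨hz, hl⟩).comp z (hasFDerivAt_prodMk_left z l)

lemma IsJet.hasFDerivAt_l (hG : IsJet k α ν D Λ G N) {β : Fin 4 → ℕ} (hβ : ∑ i, β i < k) {l : 𝕜}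
    (hl : l ∈ Λ) {z : ℂ} (hz : z ∈ D) :
    HasFDerivAt (fun l => G β (z, l)) (realLin 𝕜 (fun i => G (β + Pi.single i 1) (z, l)) ∘L
      ContinuousLinearMap.inr ℝ ℂ 𝕜) l :=
  (hG.hasFDerivAt β hβ (z, l) ⟨hz, hl⟩).comp l (hasFDerivAt_prodMk_right z l)

lemma sum_add_single (β : Fin 4 → ℕ) (i : Fin 4) :
    ∑ j, (β + Pi.single i 1 : Fin 4 → ℕ) j = ∑ j, β j + 1 := by
  simp [Finset.sum_add_distrib]

lemma IsJet.norm_realLin_le (hG : IsJet k α ν D Λ G N) {β : Fin 4 → ℕ} (hβ : ∑ i, β i < k) {l : 𝕜}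
    (hl : l ∈ Λ) {z : ℂ} (hz : z ∈ D) (w : ℂ × 𝕜) :
    ‖realLin 𝕜 (fun i => G (β + Pi.single i 1) (z, l)) w‖ ≤ 2 * N * (‖w.1‖ + ‖w.2‖) :=
  norm_realLin_apply_le (fun i => hG.norm_le _ (by rw [sum_add_single]; omega) _ ⟨hz, hl⟩) w

lemma IsJet.lipschitz_z (hG : IsJet k α ν D Λ G N) {β : Fin 4 → ℕ} (hβ : ∑ i, β i < k) {l : 𝕜}
    (hl : l ∈ Λ) {S : Set ℂ} (hS : Convex ℝ S) (hSD : S ⊆ D) {z z' : ℂ} (hz : z ∈ S)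
    (hz' : z' ∈ S) : ‖G β (z, l) - G β (z', l)‖ ≤ 2 * N * ‖z - z'‖ := by
  have hN := hG.nonneg
  refine hS.norm_image_sub_le_of_norm_hasFDerivWithin_le (f := fun z => G β (z, l))
    (fun x hx => (hG.hasFDerivAt_z hβ hl (hSD hx)).hasFDerivWithinAt) (fun x hx => ?_) hz' hz
  refine ContinuousLinearMap.opNorm_le_bound _ (by positivity) fun y => ?_
  have := hG.norm_realLin_le hβ hl (hSD hx) (y, 0)
  simpa using this

lemma segment_subset_of_cone {r : ℝ} {z v : ℂ}
    (h : ∀ w ∈ D, ‖w - z‖ < r → ∀ s, 0 < s → s ≤ r → Metric.ball (w + s * v) (s / 4) ⊆ D)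
    {w : ℂ} (hw : w ∈ D) (hwz : ‖w - z‖ < r) {s : ℝ} (hs0 : 0 ≤ s) (hs : s ≤ r) :
    segment ℝ w (w + s * v) ⊆ D := by
  intro x hx
  rw [segment_eq_image'] at hx
  obtain ⟨θ, hθ, rfl⟩ := hx
  have e : w + θ • (w + s * v - w) = w + (θ * s : ℝ) * v := by
    rw [Complex.real_smul]; push_cast; ring
  simp only [e]
  rcases (mul_nonneg hθ.1 hs0).eq_or_lt with h0 | h0
  · rw [← h0]; simpa using hw
  · have : θ * s ≤ 1 * s := by gcongr; exact hθ.2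
    exact h w hw hwz _ h0 (by linarith) (Metric.mem_ball_self (by positivity))

lemma mem_of_cone_closure {r : ℝ} {z v : ℂ}
    (h : ∀ w ∈ D, ‖w - z‖ < r → ∀ s, 0 < s → s ≤ r → Metric.ball (w + s * v) (s / 4) ⊆ D)
    {w : ℂ} (hw : w ∈ closure D) (hwz : ‖w - z‖ < r) {s : ℝ} (hs0 : 0 < s) (hs : s ≤ r) :
    w + s * v ∈ D := by
  obtain ⟨w', hw', hd⟩ := Metric.mem_closure_iff.1 hw (min (s / 4) (r - ‖w - z‖))
    (lt_min (by positivity) (by linarith))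
  have h1 : ‖w' - z‖ < r := by
    have := norm_sub_le_norm_sub_add_norm_sub w' w z
    have h2 := hd.trans_le (min_le_right _ _)
    rw [dist_comm, dist_eq_norm] at h2
    linarith
  refine h w' hw' h1 s hs0 hs ?_
  rw [Metric.mem_ball, dist_add_right]
  exact hd.trans_le (min_le_left _ _)

/-- Two points of `D` at distance `h` are joined by a path in `D` of length `O(h)`, going into `D`
along the cone directions. -/
lemma exists_modulus_z (hα₀ : 0 < α) (hα₁ : α ≤ 1) (hν : α = 1 → 0 ≤ ν) {r : ℝ} (hr : 0 < r)
    (hcone : UniformCone D r) (k : ℕ) (Λ : Set 𝕜) :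
    ∃ C > 0, ∀ (G : (Fin 4 → ℕ) → ℂ × 𝕜 → ℂ) (N : ℝ), IsJet k α ν D Λ G N →
      ∀ β : Fin 4 → ℕ, ∑ i, β i ≤ k → ∀ l ∈ Λ, ∀ z ∈ D, ∀ z' ∈ D,
        ‖G β (z, l) - G β (z', l)‖ ≤ C * N * cutMod α ν ‖z - z'‖ := by
  obtain ⟨C₁, hC₁, h₁⟩ := cutMod_mono hα₀ ν
  obtain ⟨C₂, hC₂, h₂⟩ := linear_le_cutMod hα₀ hα₁ hν (R := 1) zero_le_one
  set ρ := min (r / 16) (1 / 2) with hρ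
  have hρ0 : 0 < ρ := by positivity
  have hcρ : 0 < cutMod α ν ρ := cutMod_pos hρ0
  refine ⟨1 + 2 * C₁ / cutMod α ν ρ + 34 * C₂, by positivity,
    fun G N hG β hβ l hl z hz z' hz' => ?_⟩
  have hN := hG.nonneg
  rcases (norm_nonneg (z - z')).eq_or_lt with h0 | h0
  · have : z = z' := sub_eq_zero.1 (norm_eq_zero.1 h0.symm)
    subst this
    simp [cutMod_zero hα₀]
  have hp : 0 < cutMod α ν ‖z - z'‖ := cutMod_pos h0
  rcases le_or_gt ρ ‖z - z'‖ with hh | hh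
  · have e1 : ‖G β (z, l) - G β (z', l)‖ ≤ 2 * N :=
      (norm_sub_le _ _).trans (by
        linarith [hG.norm_le β hβ (z, l) ⟨hz, hl⟩, hG.norm_le β hβ (z', l) ⟨hz', hl⟩])
    have e2 := h₁ ρ _ hρ0.le hh
    have e3 : 2 * N ≤ 2 * C₁ / cutMod α ν ρ * N * cutMod α ν ‖z - z'‖ := by
      calc 2 * N = 2 * N / cutMod α ν ρ * cutMod α ν ρ := by field_simp
        _ ≤ 2 * N / cutMod α ν ρ * (C₁ * cutMod α ν ‖z - z'‖) := by gcongr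
        _ = _ := by ring
    refine e1.trans (e3.trans ?_)
    gcongr
    have : 0 ≤ 34 * C₂ := by positivity
    linarith
  have hh2 : ‖z - z'‖ ≤ 1 / 2 := hh.le.trans (min_le_right _ _)
  rcases hβ.eq_or_lt with hβ | hβ
  · have e1 := hG.holder β hβ (z', l) ⟨hz', hl⟩ (z, l) ⟨hz, hl⟩
      (by rwa [euclidDist_of_snd_eq]) (by rwa [euclidDist_of_snd_eq])
    rw [euclidDist_of_snd_eq, ← cutMod_eq hh2] at e1
    refine e1.trans ?_
    rw [mul_assoc]
    refine le_mul_of_one_le_left (by positivity) ?_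
    have : 0 ≤ 2 * C₁ / cutMod α ν ρ + 34 * C₂ := by positivity
    linarith
  · set h := ‖z - z'‖ with hhdef
    have hr16 : h < r / 16 := hh.trans_le (min_le_left _ _)
    obtain ⟨v, hv, hc⟩ := hcone z
    have hz'z : ‖z' - z‖ < r := by rw [norm_sub_rev]; linarith
    have hzz : ‖z - z‖ < r := by simpa using hr
    have hnorm : ∀ w : ℂ, ‖w - (w + (8 * h : ℝ) * v)‖ = 8 * h := fun w => by
      rw [sub_add_cancel_left, norm_neg, norm_mul, hv, mul_one, Complex.norm_real,
        Real.norm_eq_abs, abs_of_pos (by positivity)]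
    have e1 := hG.lipschitz_z hβ hl (convex_segment z (z + (8 * h : ℝ) * v))
      (segment_subset_of_cone hc hz hzz (s := 8 * h) (by positivity) (by linarith))
      (left_mem_segment _ _ _) (right_mem_segment _ _ _)
    have e2 := hG.lipschitz_z hβ hl (convex_segment z' (z' + (8 * h : ℝ) * v))
      (segment_subset_of_cone hc hz' hz'z (s := 8 * h) (by positivity) (by linarith))
      (left_mem_segment _ _ _) (right_mem_segment _ _ _)
    have e3 := hG.lipschitz_z hβ hl (convex_ball (z + (8 * h : ℝ) * v) (8 * h / 4))
      (hc z hz hzz (8 * h) (by positivity) (by linarith))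
      (z := z + (8 * h : ℝ) * v) (z' := z' + (8 * h : ℝ) * v)
      (Metric.mem_ball_self (by positivity))
      (by rw [Metric.mem_ball, dist_add_right, dist_comm, dist_eq_norm]; linarith)
    rw [hnorm] at e1 e2
    rw [add_sub_add_right_eq_sub, ← hhdef] at e3
    have e4 : ‖G β (z, l) - G β (z', l)‖ ≤ 34 * N * h := by
      have : G β (z, l) - G β (z', l) = (G β (z, l) - G β (z + (8 * h : ℝ) * v, l)) +
        (G β (z + (8 * h : ℝ) * v, l) - G β (z' + (8 * h : ℝ) * v, l)) -
        (G β (z', l) - G β (z' + (8 * h : ℝ) * v, l)) := by ring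
      rw [this]
      refine (norm_sub_le _ _).trans ?_
      have := norm_add_le (G β (z, l) - G β (z + (8 * h : ℝ) * v, l))
        (G β (z + (8 * h : ℝ) * v, l) - G β (z' + (8 * h : ℝ) * v, l))
      linarith
    refine e4.trans ?_
    have e5 := h₂ h h0.le (by linarith)
    calc 34 * N * h ≤ 34 * N * (C₂ * cutMod α ν h) := by gcongr
      _ = 34 * C₂ * N * cutMod α ν h := by ring
      _ ≤ _ := by
        gcongr
        have : 0 ≤ 2 * C₁ / cutMod α ν ρ := by positivity
        linarith

/-- The increment of a jet of order below `k` along a Lipschitz path in the parameter space. -/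
lemma IsJet.norm_sub_le_of_path (hG : IsJet k α ν D Λ G N) {β : Fin 4 → ℕ} (hβ : ∑ i, β i < k)
    {z : ℂ} (hz : z ∈ D) {p : ℝ → 𝕜} {K : ℝ≥0} (hp : LipschitzOnWith K p (Icc 0 1))
    (hpΛ : ∀ t ∈ Icc (0 : ℝ) 1, p t ∈ Λ) :
    ‖G β (z, p 1) - G β (z, p 0)‖ ≤ 2 * N * K := by
  have hN := hG.nonneg
  have hd : ∀ t ∈ Icc (0 : ℝ) 1, HasFDerivAt (fun l => G β (z, l))
      (realLin 𝕜 (fun i => G (β + Pi.single i 1) (z, p t)) ∘L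
        ContinuousLinearMap.inr ℝ ℂ 𝕜) (p t) := fun t ht => hG.hasFDerivAt_l hβ (hpΛ t ht) hz
  have hL : ∀ t ∈ Icc (0 : ℝ) 1, ∀ y : 𝕜, ‖(realLin 𝕜 (fun i => G (β + Pi.single i 1) (z, p t)) ∘L
        ContinuousLinearMap.inr ℝ ℂ 𝕜) y‖ ≤ 2 * N * ‖y‖ := fun t ht y => by
    have := hG.norm_realLin_le hβ (hpΛ t ht) hz (0, y)
    simpa using this
  have hcont : ContinuousOn (fun t => ‖G β (z, p t) - G β (z, p 0)‖) (Icc 0 1) := by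
    refine ContinuousOn.norm (ContinuousOn.sub (fun t ht => ?_) continuousOn_const)
    exact (hd t ht).continuousAt.comp_continuousWithinAt (hp.continuousOn t ht)
  have := image_le_of_liminf_slope_right_le_deriv_boundary (a := 0) (b := 1) hcont
    (B := fun t => 2 * N * K * t) (B' := fun _ => 2 * N * K) (by simp) (by fun_prop)
    (fun t _ => by simpa using ((hasDerivAt_id t).const_mul (2 * N * (K : ℝ))).hasDerivWithinAt) ?_
    (right_mem_Icc.2 zero_le_one)
  · simpa using this
  intro t ht q hq
  have ht' : t ∈ Icc (0 : ℝ) 1 := Ico_subset_Icc_self ht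
  obtain ⟨ε, hε, hεq⟩ : ∃ ε > 0, (2 * N + ε) * K < q := by
    have hc : Tendsto (fun ε : ℝ => (2 * N + ε) * K) (𝓝[>] 0) (𝓝 (2 * N * K)) :=
      ((by fun_prop : Continuous fun ε : ℝ => (2 * N + ε) * K).tendsto' 0 _ (by simp)).mono_left
        nhdsWithin_le_nhds
    obtain ⟨ε, h1, h2⟩ := ((hc.eventually (gt_mem_nhds hq)).and self_mem_nhdsWithin).exists
    exact ⟨ε, h2, h1⟩
  have hlin := (hd t ht').isLittleO.def hε
  have hpt : Tendsto p (𝓝[>] t) (𝓝 (p t)) := by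
    have h1 := hp.continuousOn t ht'
    have h2 : 𝓝[>] t = 𝓝[Ioc t 1] t := (nhdsWithin_Ioc_eq_nhdsGT ht.2).symm
    rw [h2]
    exact h1.mono_left (nhdsWithin_mono _ fun y hy => ⟨ht.1.trans hy.1.le, hy.2⟩)
  refine Eventually.frequently ?_
  filter_upwards [hpt.eventually hlin, Ioc_mem_nhdsGT ht.2] with y hy hyt
  have hyt0 : 0 < y - t := sub_pos.2 hyt.1
  have hpy : ‖p y - p t‖ ≤ K * (y - t) := by
    have := hp.dist_le_mul y ⟨ht.1.trans hyt.1.le, hyt.2⟩ t ht'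
    rwa [dist_eq_norm, Real.dist_eq, abs_of_pos hyt0] at this
  rw [slope_def_field, div_lt_iff₀ hyt0]
  have h1 : ‖G β (z, p y) - G β (z, p t)‖ ≤ (2 * N + ε) * ‖p y - p t‖ := by
    have h2 := hL t ht' (p y - p t)
    have h3 := norm_add_le (G β (z, p y) - G β (z, p t) - (realLin 𝕜 (fun i => G (β + Pi.single i 1)
      (z, p t)) ∘L ContinuousLinearMap.inr ℝ ℂ 𝕜) (p y - p t)) ((realLin 𝕜 (fun i =>
      G (β + Pi.single i 1) (z, p t)) ∘L ContinuousLinearMap.inr ℝ ℂ 𝕜) (p y - p t))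
    rw [sub_add_cancel] at h3
    linarith
  have h4 : ‖G β (z, p y) - G β (z, p 0)‖ - ‖G β (z, p t) - G β (z, p 0)‖ ≤
      ‖G β (z, p y) - G β (z, p t)‖ := by
    refine (norm_sub_norm_le _ _).trans (le_of_eq ?_)
    congr 1; ring
  calc _ ≤ (2 * N + ε) * ‖p y - p t‖ := h4.trans h1
    _ ≤ (2 * N + ε) * (K * (y - t)) := by gcongr
    _ = (2 * N + ε) * K * (y - t) := by ring
    _ < _ := by gcongr

/-- The modulus of continuity in the parameter. It is available for derivatives of order `k`, and
for those of order between `1` and `k - 1`, but not for the function itself if `k ≥ 1`. -/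
lemma exists_modulus_l (hα₀ : 0 < α) (hα₁ : α ≤ 1) (hν : α = 1 → 0 ≤ ν) (k : ℕ) (D : Set ℂ)
    (Λ : Set 𝕜) (hqc : 2 ≤ k → LocallyQuasiconvex Λ) :
    ∃ C > 0, ∀ (G : (Fin 4 → ℕ) → ℂ × 𝕜 → ℂ) (N : ℝ), IsJet k α ν D Λ G N →
      ∀ β : Fin 4 → ℕ, ∑ i, β i ≤ k → (∑ i, β i = 0 → k = 0) → ∀ z ∈ D, ∀ l ∈ Λ, ∀ l' ∈ Λ,
        ‖G β (z, l) - G β (z, l')‖ ≤ C * N * cutMod α ν ‖l - l'‖ := by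
  obtain ⟨C₁, hC₁, h₁⟩ := cutMod_mono hα₀ ν
  obtain ⟨C₂, hC₂, h₂⟩ := linear_le_cutMod hα₀ hα₁ hν (R := 1) zero_le_one
  obtain ⟨M, δ, hδ, hM⟩ : ∃ (M : ℝ≥0) (δ : ℝ), 0 < δ ∧ (2 ≤ k → ∀ x ∈ Λ, ∀ y ∈ Λ, dist x y < δ →
    ∃ p : ℝ → 𝕜, p 0 = x ∧ p 1 = y ∧ (∀ t ∈ Icc (0 : ℝ) 1, p t ∈ Λ) ∧
      LipschitzOnWith (M * nndist x y) p (Icc 0 1)) := by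
    by_cases hk : 2 ≤ k
    · obtain ⟨M, δ, hδ, h⟩ := hqc hk
      exact ⟨M, δ, hδ, fun _ => h⟩
    · exact ⟨0, 1, one_pos, fun h => absurd h hk⟩
  set ρ := min δ (1 / 2) with hρ
  have hρ0 : 0 < ρ := by positivity
  have hcρ : 0 < cutMod α ν ρ := cutMod_pos hρ0
  refine ⟨1 + 2 * C₁ / cutMod α ν ρ + 2 * M * C₂, by positivity,
    fun G N hG β hβ hβ0 z hz l hl l' hl' => ?_⟩
  have hN := hG.nonneg
  rcases (norm_nonneg (l - l')).eq_or_lt with h0 | h0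
  · have : l = l' := sub_eq_zero.1 (norm_eq_zero.1 h0.symm)
    subst this
    simp [cutMod_zero hα₀]
  have hp : 0 < cutMod α ν ‖l - l'‖ := cutMod_pos h0
  rcases le_or_gt ρ ‖l - l'‖ with hh | hh
  · have e1 : ‖G β (z, l) - G β (z, l')‖ ≤ 2 * N :=
      (norm_sub_le _ _).trans (by
        linarith [hG.norm_le β hβ (z, l) ⟨hz, hl⟩, hG.norm_le β hβ (z, l') ⟨hz, hl'⟩])
    have e2 := h₁ ρ _ hρ0.le hh
    have e3 : 2 * N ≤ 2 * C₁ / cutMod α ν ρ * N * cutMod α ν ‖l - l'‖ := by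
      calc 2 * N = 2 * N / cutMod α ν ρ * cutMod α ν ρ := by field_simp
        _ ≤ 2 * N / cutMod α ν ρ * (C₁ * cutMod α ν ‖l - l'‖) := by gcongr
        _ = _ := by ring
    refine e1.trans (e3.trans ?_)
    gcongr
    have : 0 ≤ 2 * M * C₂ := by positivity
    linarith
  have hh2 : ‖l - l'‖ ≤ 1 / 2 := hh.le.trans (min_le_right _ _)
  rcases hβ.eq_or_lt with hβ | hβ
  · have e1 := hG.holder β hβ (z, l') ⟨hz, hl'⟩ (z, l) ⟨hz, hl⟩
      (by rwa [euclidDist_of_fst_eq]) (by rwa [euclidDist_of_fst_eq])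
    rw [euclidDist_of_fst_eq, ← cutMod_eq hh2] at e1
    refine e1.trans ?_
    rw [mul_assoc]
    refine le_mul_of_one_le_left (by positivity) ?_
    have : 0 ≤ 2 * C₁ / cutMod α ν ρ + 2 * M * C₂ := by positivity
    linarith
  -- here `1 ≤ |β| < k`, so that `2 ≤ k` and the paths in `Λ` are available
  · obtain ⟨p, hp0, hp1, hpΛ, hpL⟩ := hM (by omega) l' hl' l hl (by
      rw [dist_comm, dist_eq_norm]; exact hh.trans_le (min_le_left _ _))
    have e1 := hG.norm_sub_le_of_path hβ hz hpL hpΛ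
    rw [hp0, hp1] at e1
    refine e1.trans ?_
    have e5 := h₂ _ h0.le (by linarith)
    rw [NNReal.coe_mul, coe_nndist, dist_comm, dist_eq_norm]
    calc 2 * N * (M * ‖l - l'‖) ≤ 2 * N * (M * (C₂ * cutMod α ν ‖l - l'‖)) := by gcongr
      _ = 2 * M * C₂ * N * cutMod α ν ‖l - l'‖ := by ring
      _ ≤ _ := by
        gcongr
        have : 0 ≤ 2 * C₁ / cutMod α ν ρ := by positivity
        linarith

end JetModulus

/-! ### Boundary values of jets -/

lemma tendsto_cutMod_zero {ι : Type*} {l : Filter ι} {α : ℝ} (hα : 0 < α) (ν : ℝ) {u : ι → ℝ}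
    (hu0 : ∀ i, 0 ≤ u i) (hu : Tendsto u l (𝓝 0)) :
    Tendsto (fun i => cutMod α ν (u i)) l (𝓝 0) := by
  obtain ⟨C, hC, h⟩ := cutMod_le_rpow hα ν
  refine squeeze_zero (fun i => cutMod_nonneg hα (hu0 i)) (fun i => h _ (hu0 i)) ?_
  have hc : Continuous fun u : ℝ => C * u ^ (α / 2) :=
    continuous_const.mul (continuous_id.rpow_const fun _ => Or.inr (by positivity))
  exact (hc.tendsto' 0 0 (by rw [Real.zero_rpow (by positivity), mul_zero])).comp hu

section BoundaryJets

variable {𝕜 : Type*} [RCLike 𝕜]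

lemma realLin_sub (c c' : Fin 4 → ℂ) :
    realLin 𝕜 c - realLin 𝕜 c' = realLin 𝕜 (fun i => c i - c' i) := by
  refine ContinuousLinearMap.ext fun w => ?_
  simp only [_root_.sub_apply, realLin_apply]
  ring

lemma norm_realLin_comp_inr_le {c : Fin 4 → ℂ} {N : ℝ} (hc : ∀ i, ‖c i‖ ≤ N) :
    ‖realLin 𝕜 c ∘L ContinuousLinearMap.inr ℝ ℂ 𝕜‖ ≤ 2 * N := by
  have hN : 0 ≤ N := (norm_nonneg _).trans (hc 0)
  refine ContinuousLinearMap.opNorm_le_bound _ (by positivity) fun y => ?_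
  simpa using norm_realLin_apply_le (𝕜 := 𝕜) hc (0, y)

/-- The properties of the boundary values `E β` of the partial derivatives `G β` of a function in
`C^{k, L^α Log^ν L}(D × Λ)` that are used in estimates of the Cauchy integral. -/
structure IsBoundaryJet {D : Set ℂ} {m : ℕ} {α' : ℝ} (Γ : BoundaryParametrization D m α')
    (k : ℕ) (α ν : ℝ) (Λ : Set 𝕜) (E : (Fin 4 → ℕ) → ℂ → 𝕜 → ℂ) (N : ℝ) : Prop where
  nonneg : 0 ≤ N
  norm_le : ∀ β, ∑ i, β i ≤ k → ∀ ζ ∈ frontier D, ∀ l ∈ Λ, ‖E β ζ l‖ ≤ N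
  mod_z : ∀ β, ∑ i, β i ≤ k → ∀ ζ ∈ frontier D, ∀ ζ' ∈ frontier D, ∀ l ∈ Λ,
    ‖E β ζ l - E β ζ' l‖ ≤ N * cutMod α ν ‖ζ - ζ'‖
  mod_l : ∀ β, ∑ i, β i ≤ k → (∑ i, β i = 0 → k = 0) → ∀ ζ ∈ frontier D, ∀ l ∈ Λ, ∀ l' ∈ Λ,
    ‖E β ζ l - E β ζ l'‖ ≤ N * cutMod α ν ‖l - l'‖
  continuousOn : ∀ β, ∑ i, β i ≤ k →
    ContinuousOn (fun q : ℂ × 𝕜 => E β q.1 q.2) (frontier D ×ˢ Λ)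
  hasDerivAt_t : ∀ β, ∑ i, β i < k → ∀ l ∈ Λ, ∀ j t,
    HasDerivAt (fun t => E β (Γ.curve j t) l)
      ((deriv (Γ.curve j) t).re * E (β + Pi.single 0 1) (Γ.curve j t) l +
        (deriv (Γ.curve j) t).im * E (β + Pi.single 1 1) (Γ.curve j t) l) t
  hasFDerivAt_l : ∀ β, ∑ i, β i < k → ∀ ζ ∈ frontier D, ∀ l ∈ Λ,
    HasFDerivAt (fun l => E β ζ l) (realLin 𝕜 (fun i => E (β + Pi.single i 1) ζ l) ∘L
      ContinuousLinearMap.inr ℝ ℂ 𝕜) l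

variable {D : Set ℂ} {m : ℕ} {α' : ℝ} (Γ : BoundaryParametrization D m α') {α ν : ℝ}

/-- The derivative along the boundary of the boundary values of a jet. The curve is pushed into `D`
along a cone direction, where the chain rule applies. -/
lemma hasDerivAt_boundaryValue (hm : 1 ≤ m) (hα₀ : 0 < α) {r : ℝ} (hr : 0 < r)
    (hcone : UniformCone D r) {k : ℕ} {Λ : Set 𝕜} {G : (Fin 4 → ℕ) → ℂ × 𝕜 → ℂ} {N K : ℝ}
    (hG : IsJet k α ν D Λ G N) {β : Fin 4 → ℕ} (hβ : ∑ i, β i < k) {l : 𝕜}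
    (hl : l ∈ Λ)
    (hlim : ∀ ζ ∈ closure D,
      Tendsto (fun z => G β (z, l)) (𝓝[D] ζ) (𝓝 (boundaryValue D (G β) ζ l)))
    (hmod' : ∀ i, ∀ z ∈ closure D, ∀ z' ∈ D,
      ‖boundaryValue D (G (β + Pi.single i 1)) z l - G (β + Pi.single i 1) (z', l)‖ ≤
        K * cutMod α ν ‖z - z'‖) (j : Fin Γ.n) (t₀ : ℝ) :
    HasDerivAt (fun t => boundaryValue D (G β) (Γ.curve j t) l)
      ((deriv (Γ.curve j) t₀).re *
        boundaryValue D (G (β + Pi.single 0 1)) (Γ.curve j t₀) l +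
        (deriv (Γ.curve j) t₀).im *
          boundaryValue D (G (β + Pi.single 1 1)) (Γ.curve j t₀) l) t₀ := by
  obtain ⟨M, hM, hMb⟩ := Γ.exists_norm_deriv_le hm
  have hfc : frontier D ⊆ closure D := frontier_subset_closure
  obtain ⟨v, hv, hc⟩ := hcone (Γ.curve j t₀)
  set S : Set ℝ := {t | ‖Γ.curve j t - Γ.curve j t₀‖ < r} with hS
  have hSo : IsOpen S := isOpen_lt ((Γ.continuous_curve j).sub continuous_const).norm
    continuous_const
  have hmem : ∀ t ∈ S, ∀ s : ℝ, 0 < s → s ≤ r → Γ.curve j t + s * v ∈ D := fun t ht s h0 hs =>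
    mem_of_cone_closure hc (hfc (Γ.curve_mem_frontier j t)) ht h0 hs
  have hs : ∀ᶠ s : ℝ in 𝓝[>] 0, 0 < s ∧ s ≤ r := Ioc_mem_nhdsGT hr
  have hnorm : ∀ (w : ℂ) (s : ℝ), 0 < s → ‖w - (w + s * v)‖ = s := fun w s h0 => by
    rw [sub_add_cancel_left, norm_neg, norm_mul, hv, mul_one, Complex.norm_real,
      Real.norm_eq_abs, abs_of_pos h0]
  have hcut0 : Tendsto (fun s : ℝ => cutMod α ν |s|) (𝓝[>] 0) (𝓝 0) :=
    tendsto_cutMod_zero hα₀ ν (fun s => abs_nonneg s)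
      ((continuous_abs.tendsto' 0 0 (by simp)).mono_left nhdsWithin_le_nhds)
  let F : ℝ → ℝ → ℂ := fun s t => G β (Γ.curve j t + s * v, l)
  let F' : ℝ → ℝ → ℂ := fun s t =>
    (deriv (Γ.curve j) t).re * G (β + Pi.single 0 1) (Γ.curve j t + s * v, l) +
      (deriv (Γ.curve j) t).im * G (β + Pi.single 1 1) (Γ.curve j t + s * v, l)
  let B : ℝ → ℂ := fun t => boundaryValue D (G β) (Γ.curve j t) l
  let B' : ℝ → ℂ := fun t =>
    (deriv (Γ.curve j) t).re * boundaryValue D (G (β + Pi.single 0 1)) (Γ.curve j t) l +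
      (deriv (Γ.curve j) t).im * boundaryValue D (G (β + Pi.single 1 1)) (Γ.curve j t) l
  have hU : TendstoUniformlyOn F' B' (𝓝[>] 0) S := by
    rw [Metric.tendstoUniformlyOn_iff]
    intro ε hε
    have h5 : Tendsto (fun s : ℝ => 2 * M * K * cutMod α ν |s|) (𝓝[>] 0) (𝓝 0) := by
      simpa using hcut0.const_mul (2 * M * K)
    filter_upwards [hs, h5.eventually (gt_mem_nhds hε)] with s hsr hsε t ht
    have key : ∀ i : Fin 4, ‖boundaryValue D (G (β + Pi.single i 1)) (Γ.curve j t) l -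
        G (β + Pi.single i 1) (Γ.curve j t + s * v, l)‖ ≤ K * cutMod α ν |s| := fun i => by
      have := hmod' i (Γ.curve j t)
        (hfc (Γ.curve_mem_frontier j t)) _ (hmem t ht s hsr.1 hsr.2)
      rw [hnorm _ _ hsr.1] at this
      rwa [abs_of_pos hsr.1]
    rw [dist_eq_norm]
    refine lt_of_le_of_lt ?_ hsε
    rw [add_sub_add_comm, ← mul_sub, ← mul_sub]
    refine (norm_add_le _ _).trans ?_
    rw [norm_mul, norm_mul, Complex.norm_real, Complex.norm_real]
    have k1 := (Complex.abs_re_le_norm (deriv (Γ.curve j) t)).trans (hMb j t)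
    have k2 := (Complex.abs_im_le_norm (deriv (Γ.curve j) t)).trans (hMb j t)
    have k3 := mul_le_mul k1 (key 0) (norm_nonneg _) hM.le
    have k4 := mul_le_mul k2 (key 1) (norm_nonneg _) hM.le
    rw [Real.norm_eq_abs, Real.norm_eq_abs]
    linarith
  have hF : ∀ᶠ s in 𝓝[>] (0 : ℝ), ∀ t ∈ S, HasDerivAt (F s) (F' s t) t := by
    filter_upwards [hs] with s hsr t ht
    have h6 := (hG.hasFDerivAt_z hβ hl (hmem t ht s hsr.1 hsr.2)).comp_hasDerivAt t
      ((Γ.hasDerivAt_curve hm j t).add_const (s * v))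
    simpa [realLin_apply, Function.comp_def] using h6
  have hB : ∀ t ∈ S, Tendsto (fun s => F s t) (𝓝[>] 0) (𝓝 (B t)) := by
    intro t ht
    refine (hlim (Γ.curve j t) (hfc (Γ.curve_mem_frontier j t))).comp ?_
    refine tendsto_nhdsWithin_iff.2 ⟨?_, ?_⟩
    · exact ((by fun_prop : Continuous fun s : ℝ => Γ.curve j t + s * v).tendsto' 0 _
        (by simp)).mono_left nhdsWithin_le_nhds
    · filter_upwards [hs] with s hsr
      exact hmem t ht s hsr.1 hsr.2
  have ht₀ : t₀ ∈ S := by simpa [hS] using hr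
  exact hasDerivAt_of_tendstoUniformlyOn hSo hU hF hB ht₀

/-- The partial derivatives of `f` in `D × Λ` have boundary values; these inherit the moduli of
continuity, and the relations between derivatives pass to the limit by uniform convergence. -/
lemma exists_isBoundaryJet (hm : 1 ≤ m) (hD : IsOpen D) (hf : (frontier D).Nonempty)
    (hα₀ : 0 < α) (hα₁ : α ≤ 1) (hν : α = 1 → 0 ≤ ν) (k : ℕ) {Λ : Set 𝕜} (hΛ : IsOpen Λ)
    (hqc : 2 ≤ k → LocallyQuasiconvex Λ) :
    ∃ C > 0, ∀ (G : (Fin 4 → ℕ) → ℂ × 𝕜 → ℂ) (N : ℝ), IsJet k α ν D Λ G N →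
      (∀ β, ∑ i, β i ≤ k → ∀ l ∈ Λ, ∀ ζ ∈ closure D,
        Tendsto (fun z => G β (z, l)) (𝓝[D] ζ) (𝓝 (boundaryValue D (G β) ζ l))) ∧
      IsBoundaryJet Γ k α ν Λ (fun β => boundaryValue D (G β)) (C * N) := by
  obtain ⟨r, hr, hcone⟩ := Γ.exists_uniformCone hm hD hf
  obtain ⟨C₁, hC₁, h₁⟩ := exists_modulus_z hα₀ hα₁ hν hr hcone k Λ
  obtain ⟨C₂, hC₂, h₂⟩ := exists_modulus_l hα₀ hα₁ hν k D Λ hqc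
  obtain ⟨C₃, hC₃, h₃⟩ := extendFrom_cutMod hα₀ ν
  set C := 1 + C₃ * C₁ + C₂ with hC
  have hC0 : 0 < C := by positivity
  refine ⟨C, hC0, fun G N hG => ?_⟩
  have hN := hG.nonneg
  have hfc : frontier D ⊆ closure D := frontier_subset_closure
  have hlim : ∀ β, ∑ i, β i ≤ k → ∀ l ∈ Λ, ∀ ζ ∈ closure D,
      Tendsto (fun z => G β (z, l)) (𝓝[D] ζ) (𝓝 (boundaryValue D (G β) ζ l)) :=
    fun β hβ l hl ζ hζ => tendsto_extendFrom_of_cutMod hα₀ (K := C₁ * N) (by positivity)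
      (fun z hz z' hz' => h₁ G N hG β hβ l hl z hz z' hz') hζ
  have hCN : C₃ * (C₁ * N) ≤ C * N := by
    rw [← mul_assoc, hC]
    gcongr
    linarith
  have hmod : ∀ β, ∑ i, β i ≤ k → ∀ l ∈ Λ, ∀ z ∈ closure D, ∀ z' ∈ closure D,
      ‖boundaryValue D (G β) z l - boundaryValue D (G β) z' l‖ ≤
        C * N * cutMod α ν ‖z - z'‖ := fun β hβ l hl z hz z' hz' => by
    refine (h₃ (C₁ * N) D _ (by positivity)
      (fun z hz z' hz' => h₁ G N hG β hβ l hl z hz z' hz') z hz z' hz').trans ?_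
    have := cutMod_nonneg (μ := ν) hα₀ (norm_nonneg (z - z'))
    gcongr
  have hcontz : ∀ β, ∑ i, β i ≤ k → ∀ l ∈ Λ, ContinuousOn (fun z => G β (z, l)) D :=
    fun β hβ l hl => (hG.continuousOn β hβ).comp (by fun_prop) fun z hz => ⟨hz, hl⟩
  have hin : ∀ β, ∑ i, β i ≤ k → ∀ l ∈ Λ, ∀ z ∈ D, boundaryValue D (G β) z l = G β (z, l) :=
    fun β hβ l hl z hz => extendFrom_extends (hcontz β hβ l hl) z hz
  have hmod' : ∀ β, ∑ i, β i ≤ k → ∀ l ∈ Λ, ∀ z ∈ closure D, ∀ z' ∈ D,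
      ‖boundaryValue D (G β) z l - G β (z', l)‖ ≤ C * N * cutMod α ν ‖z - z'‖ :=
    fun β hβ l hl z hz z' hz' => by
      rw [← hin β hβ l hl z' hz']
      exact hmod β hβ l hl z hz z' (subset_closure hz')
  refine ⟨hlim, by positivity, fun β hβ ζ hζ l hl => ?_,
    fun β hβ ζ hζ ζ' hζ' l hl => hmod β hβ l hl ζ (hfc hζ) ζ' (hfc hζ'),
    fun β hβ hβ0 ζ hζ l hl l' hl' => ?_, fun β hβ => ?_, fun β hβ l hl j t₀ => ?_,
    fun β hβ ζ hζ l hl => ?_⟩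
  · have := mem_closure_iff_nhdsWithin_neBot.1 (hfc hζ)
    refine (le_of_tendsto (hlim β hβ l hl ζ (hfc hζ)).norm ?_).trans
      (le_mul_of_one_le_left hN (show 1 ≤ C from ?_))
    · filter_upwards [self_mem_nhdsWithin] with z hz
      exact hG.norm_le β hβ (z, l) ⟨hz, hl⟩
    · rw [hC, add_assoc]
      have : 0 ≤ C₃ * C₁ + C₂ := by positivity
      linarith
  · have := mem_closure_iff_nhdsWithin_neBot.1 (hfc hζ)
    have hcut := cutMod_nonneg (μ := ν) hα₀ (norm_nonneg (l - l'))
    refine (le_of_tendsto ((hlim β hβ l hl ζ (hfc hζ)).sub (hlim β hβ l' hl' ζ (hfc hζ))).norm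
      (b := C₂ * N * cutMod α ν ‖l - l'‖) ?_).trans ?_
    · filter_upwards [self_mem_nhdsWithin] with z hz
      exact h₂ G N hG β hβ hβ0 z hz l hl l' hl'
    · gcongr
      rw [hC]
      have : 0 ≤ C₃ * C₁ := by positivity
      linarith
  · -- approximate by the interior values on a slice through a point of `D` close to `ζ₀`
    rintro ⟨ζ₀, l₀⟩ ⟨hζ₀, hl₀⟩
    rw [ContinuousWithinAt, Metric.tendsto_nhds]
    intro ε hε
    have hu : Tendsto (fun u : ℝ => C * N * cutMod α ν (2 * |u|)) (𝓝[>] 0) (𝓝 0) := by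
      have : Tendsto (fun u : ℝ => 2 * |u|) (𝓝[>] 0) (𝓝 0) :=
        ((by fun_prop : Continuous fun u : ℝ => 2 * |u|).tendsto' 0 0 (by simp)).mono_left
          nhdsWithin_le_nhds
      simpa using (tendsto_cutMod_zero hα₀ ν (fun u => by positivity) this).const_mul (C * N)
    obtain ⟨C₄, hC₄, h₄⟩ := cutMod_mono hα₀ ν
    have hε4 : 0 < ε / (3 * C₄) := by positivity
    obtain ⟨u, hu1, hu0⟩ := ((hu.eventually (gt_mem_nhds hε4)).and self_mem_nhdsWithin).exists
    have hu0 : 0 < u := hu0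
    obtain ⟨z, hz, hzζ⟩ := Metric.mem_closure_iff.1 (hfc hζ₀) u hu0
    rw [dist_eq_norm] at hzζ
    have hbd : ∀ x : ℝ, 0 ≤ x → x ≤ 2 * u → C * N * cutMod α ν x ≤ ε / 3 := fun x hx hxu => by
      rw [abs_of_pos hu0] at hu1
      calc C * N * cutMod α ν x ≤ C * N * (C₄ * cutMod α ν (2 * u)) := by
            gcongr; exact h₄ _ _ hx hxu
        _ = C₄ * (C * N * cutMod α ν (2 * u)) := by ring
        _ ≤ C₄ * (ε / (3 * C₄)) := by gcongr
        _ = ε / 3 := by field_simp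
    have hGc : ContinuousAt (fun l => G β (z, l)) l₀ :=
      ((hG.continuousOn β hβ).continuousAt (x := (z, l₀))
        ((hD.prod hΛ).mem_nhds ⟨hz, hl₀⟩)).comp (f := fun l : 𝕜 => (z, l)) (by fun_prop)
    have e1 : ∀ᶠ q : ℂ × 𝕜 in 𝓝[frontier D ×ˢ Λ] (ζ₀, l₀), dist (G β (z, q.2)) (G β (z, l₀)) < ε / 3 :=
      nhdsWithin_le_nhds ((continuous_snd.tendsto (ζ₀, l₀)).eventually
        (Metric.tendsto_nhds.1 hGc _ (by positivity)))
    have e2 : ∀ᶠ q : ℂ × 𝕜 in 𝓝[frontier D ×ˢ Λ] (ζ₀, l₀), dist q.1 ζ₀ < u :=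
      nhdsWithin_le_nhds ((continuous_fst.tendsto (ζ₀, l₀)).eventually (Metric.ball_mem_nhds _ hu0))
    filter_upwards [e1, e2, self_mem_nhdsWithin] with q hq1 hq2 hq3
    rw [dist_eq_norm] at hq1 hq2 ⊢
    have f1 := (hmod' β hβ q.2 hq3.2 q.1 (hfc hq3.1) z hz).trans (hbd _ (norm_nonneg _) (by
      have := norm_sub_le_norm_sub_add_norm_sub q.1 ζ₀ z
      linarith))
    have f2 := (hmod' β hβ l₀ hl₀ ζ₀ (hfc hζ₀) z hz).trans (hbd _ (norm_nonneg _) (by linarith))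
    have : boundaryValue D (G β) q.1 q.2 - boundaryValue D (G β) ζ₀ l₀ =
      (boundaryValue D (G β) q.1 q.2 - G β (z, q.2)) + (G β (z, q.2) - G β (z, l₀)) -
      (boundaryValue D (G β) ζ₀ l₀ - G β (z, l₀)) := by ring
    rw [this]
    refine (norm_sub_le _ _).trans_lt ?_
    have := norm_add_le (boundaryValue D (G β) q.1 q.2 - G β (z, q.2))
      (G β (z, q.2) - G β (z, l₀))
    linarith
  · exact hasDerivAt_boundaryValue Γ hm hα₀ hr hcone hG (K := C * N)
      hβ hl (hlim β hβ.le l hl) (fun i => hmod' _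
      (by rw [sum_add_single]; omega) l hl) j t₀
  · obtain ⟨z, hz, hzζ⟩ := mem_closure_iff_seq_limit.1 (hfc hζ)
    let F' : ℕ → 𝕜 → 𝕜 →L[ℝ] ℂ := fun n l =>
      realLin 𝕜 (fun i => G (β + Pi.single i 1) (z n, l)) ∘L ContinuousLinearMap.inr ℝ ℂ 𝕜
    let B' : 𝕜 → 𝕜 →L[ℝ] ℂ := fun l =>
      realLin 𝕜 (fun i => boundaryValue D (G (β + Pi.single i 1)) ζ l) ∘L
        ContinuousLinearMap.inr ℝ ℂ 𝕜
    have hU : TendstoUniformlyOn F' B' atTop Λ := by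
      rw [Metric.tendstoUniformlyOn_iff]
      intro ε hε
      have h5 : Tendsto (fun n => 2 * (C * N * cutMod α ν ‖ζ - z n‖)) atTop (𝓝 0) := by
        have h6 : Tendsto (fun n => ‖ζ - z n‖) atTop (𝓝 0) := by
          have := (tendsto_const_nhds (x := ζ)).sub hzζ
          rw [sub_self] at this
          simpa using this.norm
        simpa using ((tendsto_cutMod_zero hα₀ ν (fun n => norm_nonneg _) h6).const_mul
          (C * N)).const_mul 2
      filter_upwards [h5.eventually (gt_mem_nhds hε)] with n hn l hl
      rw [dist_eq_norm, ← ContinuousLinearMap.sub_comp, realLin_sub]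
      refine (norm_realLin_comp_inr_le fun i => ?_).trans_lt hn
      exact hmod' _ (by rw [sum_add_single]; omega) l hl ζ (hfc hζ) (z n) (hz n)
    have hB : ∀ l ∈ Λ, Tendsto (fun n => G β (z n, l)) atTop (𝓝 (boundaryValue D (G β) ζ l)) := by
      intro l hl
      exact (hlim β hβ.le l hl ζ (hfc hζ)).comp
        (tendsto_nhdsWithin_iff.2 ⟨hzζ, Eventually.of_forall hz⟩)
    exact hasFDerivAt_of_tendstoUniformlyOn hΛ hU
      (fun n l hl => hG.hasFDerivAt_l hβ hl (hz n)) hB hl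

end BoundaryJets

/-! ### Periodic functions of class `C^{r, α}` -/

/-- Periodic complex functions on the line of class `C^{r, α}`. -/
def PerHolder (L α : ℝ) : ℕ → (ℝ → ℂ) → Prop
  | 0, c => Continuous c ∧ Function.Periodic c L ∧ ∃ M, ∀ s t, ‖c s - c t‖ ≤ M * |s - t| ^ α
  | r + 1, c => Differentiable ℝ c ∧ Function.Periodic c L ∧ PerHolder L α r (deriv c)

namespace PerHolder

variable {L α : ℝ} {r : ℕ} {c d : ℝ → ℂ}

lemma periodic (h : PerHolder L α r c) : Function.Periodic c L := by
  cases r with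
  | zero => exact h.2.1
  | succ r => exact h.2.1

lemma continuous (h : PerHolder L α r c) : Continuous c := by
  cases r with
  | zero => exact h.1
  | succ r => exact h.1.continuous

lemma const (x : ℂ) : PerHolder L α r fun _ => x := by
  induction r generalizing x with
  | zero => exact ⟨continuous_const, fun _ => rfl, 0, fun s t => by simp⟩
  | succ r ih =>
    refine ⟨differentiable_const x, fun _ => rfl, ?_⟩
    have : deriv (fun _ : ℝ => x) = fun _ => 0 := by ext; simp
    rw [this]
    exact ih 0

lemma lipschitz (hL : 0 < L) (h : PerHolder L α (r + 1) c) :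
    ∃ M > 0, ∀ s t, ‖c s - c t‖ ≤ M * |s - t| := by
  obtain ⟨M, hM⟩ := h.2.2.periodic.exists_norm_le hL h.2.2.continuous
  refine ⟨max M 1, by positivity, fun s t => ?_⟩
  exact convex_univ.norm_image_sub_le_of_norm_deriv_le (fun x _ => h.1 x)
    (fun x _ => (hM x).trans (le_max_left _ _)) (mem_univ t) (mem_univ s)

lemma of_succ (hL : 0 < L) (hα₀ : 0 < α) (hα₁ : α ≤ 1) (h : PerHolder L α (r + 1) c) :
    PerHolder L α r c := by
  induction r generalizing c with
  | zero =>
    obtain ⟨M, hM, hMb⟩ := h.lipschitz hL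
    obtain ⟨B, hB⟩ := h.periodic.exists_norm_le hL h.continuous
    have hB0 : 0 ≤ B := (norm_nonneg _).trans (hB 0)
    refine ⟨h.continuous, h.periodic, M + 2 * B, fun s t => ?_⟩
    rcases le_total |s - t| 1 with hst | hst
    · have h1 : |s - t| ≤ |s - t| ^ α := by
        conv_lhs => rw [← Real.rpow_one |s - t|]
        exact Real.rpow_le_rpow_of_exponent_ge' (abs_nonneg _) hst hα₀.le hα₁
      have h2 : 0 ≤ |s - t| ^ α := by positivity
      have := hMb s t
      nlinarith
    · have h1 : 1 ≤ |s - t| ^ α := Real.one_le_rpow hst hα₀.le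
      have := norm_sub_le (c s) (c t)
      nlinarith [hB s, hB t]
  | succ r ih => exact ⟨h.1, h.2.1, ih h.2.2⟩

lemma mono (hL : 0 < L) (hα₀ : 0 < α) (hα₁ : α ≤ 1) {p : ℕ} (hp : p ≤ r)
    (h : PerHolder L α r c) : PerHolder L α p c := by
  induction r with
  | zero => rwa [Nat.le_zero.1 hp]
  | succ r ih =>
    rcases hp.eq_or_lt with rfl | hp
    · exact h
    · exact ih (Nat.lt_succ_iff.1 hp) (h.of_succ hL hα₀ hα₁)

lemma holder (hL : 0 < L) (hα₀ : 0 < α) (hα₁ : α ≤ 1) (h : PerHolder L α r c) :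
    ∃ M > 0, ∀ s t, ‖c s - c t‖ ≤ M * |s - t| ^ α := by
  obtain ⟨_, _, M, hM⟩ := h.mono hL hα₀ hα₁ (Nat.zero_le r)
  refine ⟨max M 1, by positivity, fun s t => (hM s t).trans ?_⟩
  gcongr
  exact le_max_left _ _

lemma add (hc : PerHolder L α r c) (hd : PerHolder L α r d) :
    PerHolder L α r fun t => c t + d t := by
  induction r generalizing c d with
  | zero =>
    obtain ⟨h1, h2, M, h3⟩ := hc
    obtain ⟨h1', h2', M', h3'⟩ := hd
    refine ⟨h1.add h1', h2.add h2', M + M', fun s t => ?_⟩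
    rw [add_sub_add_comm, add_mul]
    exact (norm_add_le _ _).trans (add_le_add (h3 s t) (h3' s t))
  | succ r ih =>
    refine ⟨hc.1.add hd.1, hc.2.1.add hd.2.1, ?_⟩
    have : deriv (fun t => c t + d t) = fun t => deriv c t + deriv d t := by
      ext t
      exact deriv_fun_add (hc.1 t) (hd.1 t)
    rw [this]
    exact ih hc.2.2 hd.2.2

lemma mul (hL : 0 < L) (hα₀ : 0 < α) (hα₁ : α ≤ 1) (hc : PerHolder L α r c)
    (hd : PerHolder L α r d) : PerHolder L α r fun t => c t * d t := by
  induction r generalizing c d with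
  | zero =>
    obtain ⟨M, hM, h3⟩ := hc.holder hL hα₀ hα₁
    obtain ⟨M', hM', h3'⟩ := hd.holder hL hα₀ hα₁
    obtain ⟨B, hB⟩ := hc.periodic.exists_norm_le hL hc.continuous
    obtain ⟨B', hB'⟩ := hd.periodic.exists_norm_le hL hd.continuous
    have hB0 : 0 ≤ B := (norm_nonneg _).trans (hB 0)
    refine ⟨hc.1.mul hd.1, hc.2.1.mul hd.2.1, M * B' + B * M', fun s t => ?_⟩
    have : c s * d s - c t * d t = (c s - c t) * d s + c t * (d s - d t) := by ring
    rw [this]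
    refine (norm_add_le _ _).trans ?_
    rw [norm_mul, norm_mul]
    have e1 := mul_le_mul (h3 s t) (hB' s) (norm_nonneg _) (by positivity)
    have e2 := mul_le_mul (hB t) (h3' s t) (norm_nonneg _) hB0
    linarith
  | succ r ih =>
    refine ⟨hc.1.mul hd.1, hc.2.1.mul hd.2.1, ?_⟩
    have : deriv (fun t => c t * d t) = fun t => deriv c t * d t + c t * deriv d t := by
      ext t
      exact deriv_fun_mul (hc.1 t) (hd.1 t)
    rw [this]
    exact (ih hc.2.2 (hd.of_succ hL hα₀ hα₁)).add (ih (hc.of_succ hL hα₀ hα₁) hd.2.2)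

lemma inv (hL : 0 < L) (hα₀ : 0 < α) (hα₁ : α ≤ 1) (hc : PerHolder L α r c)
    (h0 : ∀ t, c t ≠ 0) : PerHolder L α r fun t => (c t)⁻¹ := by
  induction r with
  | zero =>
    obtain ⟨M, hM, h3⟩ := hc.holder hL hα₀ hα₁
    have hcont : Continuous fun t => (c t)⁻¹ := hc.continuous.inv₀ h0
    have hper : Function.Periodic (fun t => (c t)⁻¹) L := fun t => by
      simp only [hc.periodic t]
    obtain ⟨B, hB⟩ := hper.exists_norm_le hL hcont
    have hB0 : 0 ≤ B := (norm_nonneg _).trans (hB 0)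
    refine ⟨hcont, hper, B * M * B, fun s t => ?_⟩
    have : (c s)⁻¹ - (c t)⁻¹ = (c s)⁻¹ * (c t - c s) * (c t)⁻¹ := by
      have := h0 s
      have := h0 t
      field_simp
    rw [this, norm_mul, norm_mul, norm_sub_rev]
    calc ‖(c s)⁻¹‖ * ‖c s - c t‖ * ‖(c t)⁻¹‖ ≤ B * (M * |s - t| ^ α) * B := by
          gcongr
          · exact hB s
          · exact h3 s t
          · exact hB t
      _ = _ := by ring
  | succ r ih =>
    have h1 := ih (hc.of_succ hL hα₀ hα₁)
    refine ⟨hc.1.fun_inv h0, fun t => by simp only [hc.periodic t], ?_⟩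
    have : deriv (fun t => (c t)⁻¹) = fun t => -1 * deriv c t * ((c t)⁻¹ * (c t)⁻¹) := by
      ext t
      rw [deriv_fun_inv'' (hc.1 t) (h0 t)]
      have := h0 t
      field_simp
    rw [this]
    exact ((const (-1)).mul hL hα₀ hα₁ hc.2.2).mul hL hα₀ hα₁ (h1.mul hL hα₀ hα₁ h1)

lemma comp_clm (hc : PerHolder L α r c) (T : ℂ →L[ℝ] ℂ) : PerHolder L α r fun t => T (c t) := by
  induction r generalizing c with
  | zero =>
    obtain ⟨h1, h2, M, h3⟩ := hc
    refine ⟨T.continuous.comp h1, h2.comp T, ‖T‖ * M, fun s t => ?_⟩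
    rw [← map_sub, mul_assoc]
    exact (T.le_opNorm _).trans (mul_le_mul_of_nonneg_left (h3 s t) (norm_nonneg _))
  | succ r ih =>
    refine ⟨T.differentiable.comp hc.1, hc.2.1.comp T, ?_⟩
    have : deriv (fun t => T (c t)) = fun t => T (deriv c t) := by
      ext t
      exact (T.hasFDerivAt.comp_hasDerivAt t (hc.1 t).hasDerivAt).deriv
    rw [this]
    exact ih hc.2.2

lemma of_contDiff (hc : ContDiff ℝ r c) (hp : Function.Periodic c L)
    (hh : ∃ M : ℝ, ∀ s t, ‖iteratedDeriv r c s - iteratedDeriv r c t‖ ≤ M * |s - t| ^ α) :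
    PerHolder L α r c := by
  induction r generalizing c with
  | zero => exact ⟨hc.continuous, hp, by simpa using hh⟩
  | succ r ih =>
    have h1 := contDiff_succ_iff_deriv.1 (show ContDiff ℝ ((r : WithTop ℕ∞) + 1) c by exact_mod_cast hc)
    refine ⟨h1.1, hp, ih h1.2.2 hp.deriv_periodic ?_⟩
    simpa only [iteratedDeriv_succ'] using hh

end PerHolder

lemma BoundaryParametrization.perHolder_deriv {D : Set ℂ} {m : ℕ} {α : ℝ}
    (Γ : BoundaryParametrization D m α) (hα₀ : 0 < α) (hα₁ : α ≤ 1) (j : Fin Γ.n) {p : ℕ}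
    (hp : p + 1 ≤ m) : PerHolder (Γ.period j) α p (deriv (Γ.curve j)) :=
  ((PerHolder.of_contDiff (Γ.contDiff j) (Γ.periodic j) (Γ.holder j)).mono (Γ.period_pos j)
    hα₀ hα₁ hp).2.2

/-! ### Boundary differential operators and their Cauchy integrals -/

section Symbols

variable {𝕜 : Type*} {D : Set ℂ} {m : ℕ} {α : ℝ}

/-- A differential operator on boundary values: the formal sum of the terms `c(ζ) D^β`, where the
coefficient `c` is given as a function of the parameters of the boundary curves. -/
abbrev BoundaryOp (n : ℕ) := List ((Fin n → ℝ → ℂ) × (Fin 4 → ℕ))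

namespace BoundaryOp

variable (Γ : BoundaryParametrization D m α)

/-- The operator `s` applied to the function with boundary derivatives `E β`. -/
def eval (E : (Fin 4 → ℕ) → ℂ → 𝕜 → ℂ) (s : BoundaryOp Γ.n) (j : Fin Γ.n) (t : ℝ) (l : 𝕜) : ℂ :=
  (s.map fun q => q.1 j t * E q.2 (Γ.curve j t) l).sum

/-- The composition of `s` with the complex tangential derivative `d/dζ = γ'(t)⁻¹ d/dt` along the
boundary. -/
noncomputable def tangential (s : BoundaryOp Γ.n) : BoundaryOp Γ.n :=
  s.flatMap fun q =>
    [(fun j t => deriv (q.1 j) t * (deriv (Γ.curve j) t)⁻¹, q.2),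
      (fun j t => q.1 j t * (((deriv (Γ.curve j) t).re : ℝ) : ℂ) * (deriv (Γ.curve j) t)⁻¹,
        q.2 + Pi.single 0 1),
      (fun j t => q.1 j t * (((deriv (Γ.curve j) t).im : ℝ) : ℂ) * (deriv (Γ.curve j) t)⁻¹,
        q.2 + Pi.single 1 1)]

/-- The composition of `s` with the coordinate derivative number `i`. -/
def shift (i : Fin 4) (s : BoundaryOp Γ.n) : BoundaryOp Γ.n :=
  s.map fun q => (q.1, q.2 + Pi.single i 1)

/-- The operators have order at most `r` and coefficients of class `C^{p, α}`. -/
def Regular (p r : ℕ) (s : BoundaryOp Γ.n) : Prop :=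
  ∀ q ∈ s, (∀ j, PerHolder (Γ.period j) α p (q.1 j)) ∧ ∑ i, q.2 i ≤ r

variable {Γ}

lemma eval_cons (E : (Fin 4 → ℕ) → ℂ → 𝕜 → ℂ) (q : (Fin Γ.n → ℝ → ℂ) × (Fin 4 → ℕ))
    (s : BoundaryOp Γ.n) (j : Fin Γ.n) (t : ℝ) (l : 𝕜) :
    eval Γ E (q :: s) j t l = q.1 j t * E q.2 (Γ.curve j t) l + eval Γ E s j t l := by
  simp [eval]

lemma Regular.tail {p r : ℕ} {q : (Fin Γ.n → ℝ → ℂ) × (Fin 4 → ℕ)} {s : BoundaryOp Γ.n}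
    (h : Regular Γ p r (q :: s)) : Regular Γ p r s := fun x hx => h x (List.mem_cons_of_mem _ hx)

lemma Regular.head {p r : ℕ} {q : (Fin Γ.n → ℝ → ℂ) × (Fin 4 → ℕ)} {s : BoundaryOp Γ.n}
    (h : Regular Γ p r (q :: s)) :
    (∀ j, PerHolder (Γ.period j) α p (q.1 j)) ∧ ∑ i, q.2 i ≤ r := h q (List.mem_cons_self)

lemma Regular.mono {p p' r : ℕ} {s : BoundaryOp Γ.n} (hα₀ : 0 < α) (hα₁ : α ≤ 1)
    (h : Regular Γ p r s) (hp : p' ≤ p) : Regular Γ p' r s := fun q hq =>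
  ⟨fun j => ((h q hq).1 j).mono (Γ.period_pos j) hα₀ hα₁ hp, (h q hq).2⟩

lemma Regular.shift {p r : ℕ} {s : BoundaryOp Γ.n} (h : Regular Γ p r s) (i : Fin 4) :
    Regular Γ p (r + 1) (shift Γ i s) := by
  intro q hq
  obtain ⟨x, hx, rfl⟩ := List.mem_map.1 hq
  exact ⟨(h x hx).1, by rw [sum_add_single]; exact Nat.add_le_add_right (h x hx).2 1⟩

lemma Regular.tangential {p r : ℕ} {s : BoundaryOp Γ.n} (hα₀ : 0 < α) (hα₁ : α ≤ 1)
    (hp : p + 1 ≤ m) (h : Regular Γ (p + 1) r s) : Regular Γ p (r + 1) (tangential Γ s) := by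
  intro q hq
  obtain ⟨x, hx, hq⟩ := List.mem_flatMap.1 hq
  obtain ⟨hx1, hx2⟩ := h x hx
  have hL := Γ.period_pos
  have hγ := fun j => Γ.perHolder_deriv hα₀ hα₁ j hp
  have hinv := fun j => (hγ j).inv (hL j) hα₀ hα₁ (Γ.deriv_ne_zero j)
  have hc := fun j => (hx1 j).of_succ (hL j) hα₀ hα₁
  simp only [List.mem_cons, List.not_mem_nil, or_false] at hq
  rcases hq with rfl | rfl | rfl
  · exact ⟨fun j => (hx1 j).2.2.mul (hL j) hα₀ hα₁ (hinv j), le_trans hx2 (Nat.le_succ r)⟩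
  · refine ⟨fun j => ((hc j).mul (hL j) hα₀ hα₁ ((hγ j).comp_clm
      (Complex.ofRealCLM ∘L Complex.reCLM))).mul (hL j) hα₀ hα₁ (hinv j), ?_⟩
    rw [sum_add_single]; omega
  · refine ⟨fun j => ((hc j).mul (hL j) hα₀ hα₁ ((hγ j).comp_clm
      (Complex.ofRealCLM ∘L Complex.imCLM))).mul (hL j) hα₀ hα₁ (hinv j), ?_⟩
    rw [sum_add_single]; omega

lemma eval_periodic {E : (Fin 4 → ℕ) → ℂ → 𝕜 → ℂ} (s : BoundaryOp Γ.n) {p r : ℕ}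
    (hs : Regular Γ p r s) (j : Fin Γ.n) (l : 𝕜) :
    Function.Periodic (fun t => eval Γ E s j t l) (Γ.period j) := by
  induction s with
  | nil => intro t; simp [eval]
  | cons q s ih =>
    intro t
    have h1 := ih hs.tail t
    simp only at h1
    simp only [eval_cons, h1, (hs.head.1 j).periodic t, Γ.periodic j t]

section Jet

variable [RCLike 𝕜] {k : ℕ} {ν : ℝ} {Λ : Set 𝕜} {E : (Fin 4 → ℕ) → ℂ → 𝕜 → ℂ} {N : ℝ}

lemma continuousOn_eval (hE : IsBoundaryJet Γ k α ν Λ E N) {s : BoundaryOp Γ.n} {p r : ℕ}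
    (hs : Regular Γ p r s) (hr : r ≤ k) (j : Fin Γ.n) :
    ContinuousOn (fun q : 𝕜 × ℝ => eval Γ E s j q.2 q.1) (Λ ×ˢ univ) := by
  induction s with
  | nil => simpa [eval] using continuousOn_const
  | cons q s ih =>
    simp only [eval_cons]
    refine ContinuousOn.add (ContinuousOn.mul ?_ ?_) (ih hs.tail)
    · exact ((hs.head.1 j).continuous.comp continuous_snd).continuousOn
    · refine (hE.continuousOn q.2 (hs.head.2.trans hr)).comp
        (f := fun x : 𝕜 × ℝ => (Γ.curve j x.2, x.1)) ?_ fun x hx =>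
          ⟨Γ.curve_mem_frontier j _, hx.1⟩
      have := Γ.continuous_curve j
      fun_prop

lemma continuous_eval (hE : IsBoundaryJet Γ k α ν Λ E N) {s : BoundaryOp Γ.n} {p r : ℕ}
    (hs : Regular Γ p r s) (hr : r ≤ k) (j : Fin Γ.n) {l : 𝕜} (hl : l ∈ Λ) :
    Continuous fun t => eval Γ E s j t l :=
  (continuousOn_eval hE hs hr j).comp_continuous (f := fun t : ℝ => (l, t)) (by fun_prop)
    fun _ => ⟨hl, mem_univ _⟩

lemma hasDerivAt_eval_t (hE : IsBoundaryJet Γ k α ν Λ E N) {s : BoundaryOp Γ.n} {p r : ℕ}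
    (hs : Regular Γ (p + 1) r s) (hr : r < k) (j : Fin Γ.n) {l : 𝕜} (hl : l ∈ Λ) (t : ℝ) :
    HasDerivAt (fun t => eval Γ E s j t l)
      (eval Γ E (tangential Γ s) j t l * deriv (Γ.curve j) t) t := by
  induction s with
  | nil => simpa [eval, tangential] using hasDerivAt_const t (0 : ℂ)
  | cons q s ih =>
    simp only [eval_cons]
    have h1 := ((hs.head.1 j).1 t).hasDerivAt.fun_mul
      (hE.hasDerivAt_t q.2 (hs.head.2.trans_lt hr) l hl j t)
    refine (h1.fun_add (ih hs.tail)).congr_deriv ?_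
    have h2 : tangential Γ (q :: s) = _ ++ tangential Γ s := List.flatMap_cons ..
    rw [h2]
    simp only [List.cons_append, List.nil_append, eval_cons]
    have := Γ.deriv_ne_zero j t
    field_simp
    ring

lemma hasFDerivAt_eval_l (hE : IsBoundaryJet Γ k α ν Λ E N) {s : BoundaryOp Γ.n} {p r : ℕ}
    (hs : Regular Γ p r s) (hr : r < k) (j : Fin Γ.n) {l : 𝕜} (hl : l ∈ Λ) (t : ℝ) :
    HasFDerivAt (fun l => eval Γ E s j t l) (realLin 𝕜 (fun i => eval Γ E (shift Γ i s) j t l) ∘L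
      ContinuousLinearMap.inr ℝ ℂ 𝕜) l := by
  induction s with
  | nil =>
    refine (hasFDerivAt_const (0 : ℂ) l).congr_fderiv ?_
    refine ContinuousLinearMap.ext fun y => ?_
    simp [eval, shift, realLin_apply]
  | cons q s ih =>
    simp only [eval_cons]
    have h1 := (hE.hasFDerivAt_l q.2 (hs.head.2.trans_lt hr) _ (Γ.curve_mem_frontier j t) l
      hl).const_mul (q.1 j t)
    refine (h1.fun_add (ih hs.tail)).congr_fderiv ?_
    refine ContinuousLinearMap.ext fun y => ?_
    simp [shift, eval_cons, realLin_apply]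
    ring

end Jet

end BoundaryOp

end Symbols

/-! ### Derivatives of the Cauchy integral of a boundary operator -/

section CauchyOperator

variable {𝕜 : Type*} [RCLike 𝕜] {D : Set ℂ} {m : ℕ} {α : ℝ}

lemma exists_clm_eq_realLin : ∃ L : (Fin 4 → ℂ) →L[ℝ] (ℂ × 𝕜 →L[ℝ] ℂ), ∀ c, L c = realLin 𝕜 c := by
  let L : (Fin 4 → ℂ) →ₗ[ℝ] (ℂ × 𝕜 →L[ℝ] ℂ) :=
    { toFun := realLin 𝕜
      map_add' := fun c d => by
        refine ContinuousLinearMap.ext fun w => ?_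
        simp only [_root_.add_apply, realLin_apply, Pi.add_apply]
        ring
      map_smul' := fun x c => by
        refine ContinuousLinearMap.ext fun w => ?_
        simp only [_root_.smul_apply, realLin_apply, Pi.smul_apply, Complex.real_smul,
          RingHom.id_apply]
        ring }
  exact ⟨LinearMap.toContinuousLinearMap L, fun c => rfl⟩

lemma intervalIntegral_realLin {c : ℝ → Fin 4 → ℂ} (hc : Continuous c) (a b : ℝ) :
    ∫ t in a..b, realLin 𝕜 (c t) = realLin 𝕜 fun i => ∫ t in a..b, c t i := by
  obtain ⟨L, hL⟩ := exists_clm_eq_realLin (𝕜 := 𝕜)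
  simp only [← hL]
  refine (ContinuousLinearMap.intervalIntegral_comp_comm (𝕜 := ℝ) (E := Fin 4 → ℂ)
    (F := ℂ × 𝕜 →L[ℝ] ℂ) L (μ := MeasureTheory.volume) (hc.intervalIntegrable _ _)).trans ?_
  congr 1
  ext i
  exact ((ContinuousLinearMap.proj (R := ℝ) (φ := fun _ : Fin 4 => ℂ) i).intervalIntegral_comp_comm
    (hc.intervalIntegrable _ _)).symm

namespace BoundaryOp

variable (Γ : BoundaryParametrization D m α)

/-- The Cauchy integral (without the factor `1 / (2πi)`) of the operator `s` applied to the function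
with boundary derivatives `E β`. -/
noncomputable def cauchyOp (E : (Fin 4 → ℕ) → ℂ → 𝕜 → ℂ) (s : BoundaryOp Γ.n) (w : ℂ × 𝕜) : ℂ :=
  Γ.kern 1 (fun j t => eval Γ E s j t w.2) w.1

/-- The operator whose Cauchy integral is, up to the factor `diffFactor i`, the derivative number
`i` of the Cauchy integral of `s`. -/
noncomputable def diff (i : Fin 4) (s : BoundaryOp Γ.n) : BoundaryOp Γ.n :=
  ![tangential Γ s, tangential Γ s, shift Γ 2 s, shift Γ 3 s] i

/-- The factors in the coordinate derivatives of a Cauchy integral. The last one is zero if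
`𝕜 = ℝ`. -/
noncomputable def diffFactor (𝕜 : Type*) [RCLike 𝕜] : Fin 4 → ℂ :=
  ![1, Complex.I, 1, (RCLike.im (RCLike.I : 𝕜) : ℝ)]

lemma norm_diffFactor_le (i : Fin 4) : ‖diffFactor 𝕜 i‖ ≤ 1 := by
  fin_cases i
  · simp [diffFactor]
  · simp [diffFactor]
  · simp [diffFactor]
  · rcases RCLike.I_eq_zero_or_im_I_eq_one (K := 𝕜) with h | h
    · simp [diffFactor, h]
    · simp [diffFactor, h]

variable {Γ}

lemma Regular.diff {p r : ℕ} {s : BoundaryOp Γ.n} (hα₀ : 0 < α) (hα₁ : α ≤ 1)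
    (hp : p + 1 ≤ m) (h : Regular Γ (p + 1) r s) (i : Fin 4) :
    Regular Γ p (r + 1) (diff Γ i s) := by
  have h1 := h.tangential hα₀ hα₁ hp
  have h2 := fun i => (h.mono hα₀ hα₁ (Nat.le_succ p)).shift i
  fin_cases i
  · exact h1
  · exact h1
  · exact h2 2
  · exact h2 3

variable {k : ℕ} {ν : ℝ} {Λ : Set 𝕜} {E : (Fin 4 → ℕ) → ℂ → 𝕜 → ℂ} {N : ℝ}

lemma continuousOn_cauchyOp_integrand (hE : IsBoundaryJet Γ k α ν Λ E N) (hm : 1 ≤ m)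
    (hD : IsOpen D) {s : BoundaryOp Γ.n} {q r : ℕ} (hs : Regular Γ q r s) (hr : r ≤ k)
    (p : ℕ) (j : Fin Γ.n) :
    ContinuousOn (fun x : (ℂ × 𝕜) × ℝ =>
      eval Γ E s j x.2 x.1.2 * deriv (Γ.curve j) x.2 / (Γ.curve j x.2 - x.1.1) ^ p)
      ((D ×ˢ Λ) ×ˢ univ) := by
  have h2 := Γ.continuous_deriv hm j
  have h3 := Γ.continuous_curve j
  refine ContinuousOn.div (ContinuousOn.mul ?_ ?_) ?_ fun x hx =>
    pow_ne_zero p (Γ.curve_sub_ne_zero hD hx.1.1 j x.2)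
  · exact (continuousOn_eval hE hs hr j).comp (f := fun x : (ℂ × 𝕜) × ℝ => (x.1.2, x.2))
      (by fun_prop) fun x hx => ⟨hx.1.2, mem_univ _⟩
  · fun_prop
  · fun_prop

lemma continuousOn_cauchyOp (hE : IsBoundaryJet Γ k α ν Λ E N) (hm : 1 ≤ m)
    (hD : IsOpen D) (hΛ : IsOpen Λ) {s : BoundaryOp Γ.n} {q r : ℕ} (hs : Regular Γ q r s)
    (hr : r ≤ k) : ContinuousOn (cauchyOp Γ E s) (D ×ˢ Λ) := by
  unfold cauchyOp BoundaryParametrization.kern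
  exact continuousOn_finsetSum _ fun j _ => continuousOn_intervalIntegral (hD.prod hΛ)
    (continuousOn_cauchyOp_integrand hE hm hD hs hr 1 j) _ _

lemma kern_two_eval (hE : IsBoundaryJet Γ k α ν Λ E N) (hα₀ : 0 < α) (hα₁ : α ≤ 1) (hm : 1 ≤ m)
    (hD : IsOpen D) {s : BoundaryOp Γ.n} {p r : ℕ} (hp : p + 1 ≤ m) (hs : Regular Γ (p + 1) r s)
    (hr : r < k) {w : ℂ × 𝕜} (hw : w ∈ D ×ˢ Λ) :
    Γ.kern 2 (fun j t => eval Γ E s j t w.2) w.1 = cauchyOp Γ E (tangential Γ s) w := by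
  have hT := hs.tangential hα₀ hα₁ hp
  rw [Γ.kern_two_eq hm hD (fun j t => hasDerivAt_eval_t hE hs hr j hw.2 t)
    (fun j => eval_periodic s hs j w.2)
    (fun j => (continuous_eval hE hT hr j hw.2).mul (Γ.continuous_deriv hm j)) hw.1]
  unfold cauchyOp
  congr 1
  ext j t
  rw [mul_div_cancel_right₀ _ (Γ.deriv_ne_zero j t)]

/-- The total derivative of a Cauchy integral. It is complex linear in `z`, whence the factor `i` in
the second coordinate direction. -/
lemma hasFDerivAt_cauchyOp (hE : IsBoundaryJet Γ k α ν Λ E N) (hα₀ : 0 < α) (hα₁ : α ≤ 1)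
    (hm : 1 ≤ m) (hD : IsOpen D) (hΛ : IsOpen Λ) {s : BoundaryOp Γ.n} {p r : ℕ} (hp : p + 1 ≤ m)
    (hs : Regular Γ (p + 1) r s) (hr : r < k) {w : ℂ × 𝕜} (hw : w ∈ D ×ˢ Λ) :
    HasFDerivAt (cauchyOp Γ E s) (realLin 𝕜 fun i =>
      (![1, Complex.I, 1, 1] : Fin 4 → ℂ) i * cauchyOp Γ E (diff Γ i s) w) w := by
  obtain ⟨L, hL⟩ := exists_clm_eq_realLin (𝕜 := 𝕜)
  have hS := fun i => hs.shift i
  set c : Fin Γ.n → ℂ × 𝕜 → ℝ → Fin 4 → ℂ := fun j w t =>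
    ![eval Γ E s j t w.2 * deriv (Γ.curve j) t / (Γ.curve j t - w.1) ^ 2,
      Complex.I * (eval Γ E s j t w.2 * deriv (Γ.curve j) t / (Γ.curve j t - w.1) ^ 2),
      eval Γ E (shift Γ 2 s) j t w.2 * deriv (Γ.curve j) t / (Γ.curve j t - w.1) ^ 1,
      eval Γ E (shift Γ 3 s) j t w.2 * deriv (Γ.curve j) t / (Γ.curve j t - w.1) ^ 1] with hc
  have hcc : ∀ j, ContinuousOn (fun x : (ℂ × 𝕜) × ℝ => c j x.1 x.2) ((D ×ˢ Λ) ×ˢ univ) := by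
    intro j
    refine continuousOn_pi.2 fun i => ?_
    fin_cases i
    · exact continuousOn_cauchyOp_integrand hE hm hD hs hr.le 2 j
    · exact continuousOn_const.mul (continuousOn_cauchyOp_integrand hE hm hD hs hr.le 2 j)
    · exact continuousOn_cauchyOp_integrand hE hm hD (hS 2) hr 1 j
    · exact continuousOn_cauchyOp_integrand hE hm hD (hS 3) hr 1 j
  have key : ∀ j, HasFDerivAt (fun w : ℂ × 𝕜 => ∫ t in (0 : ℝ)..Γ.period j,
      eval Γ E s j t w.2 * deriv (Γ.curve j) t / (Γ.curve j t - w.1) ^ 1)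
      (realLin 𝕜 fun i => ∫ t in (0 : ℝ)..Γ.period j, c j w t i) w := by
    intro j
    rw [← intervalIntegral_realLin (continuous_slice (hcc j) hw)]
    refine hasFDerivAt_intervalIntegral (hD.prod hΛ) (H' := fun w t => realLin 𝕜 (c j w t))
      (continuousOn_cauchyOp_integrand hE hm hD hs hr.le 1 j) ?_ ?_ hw _ _
    · simp only [← hL]
      exact L.continuous.comp_continuousOn (hcc j)
    · intro x hx t
      have hne := Γ.curve_sub_ne_zero hD hx.1 j t
      have h1 := (hasFDerivAt_eval_l hE hs hr j hx.2 t).comp x (hasFDerivAt_snd (𝕜 := ℝ))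
      have h2 := (((hasDerivAt_id x.1).const_sub (Γ.curve j t)).inv hne).hasFDerivAt.restrictScalars
        ℝ
      have h3 := (h2.comp x (hasFDerivAt_fst (𝕜 := ℝ))).const_mul (deriv (Γ.curve j) t)
      have h4 := h1.mul h3
      simp only [pow_one]
      refine (h4.congr_of_eventuallyEq (Eventually.of_forall fun y => ?_)).congr_fderiv ?_
      · simp [div_eq_mul_inv, mul_assoc]
      · refine ContinuousLinearMap.ext fun y => ?_
        simp only [realLin_apply, hc]
        simp [realLin_apply]
        conv_lhs => rw [← Complex.re_add_im y.1]
        field_simp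
        ring
  have hsum := HasFDerivAt.fun_sum fun j (_ : j ∈ Finset.univ) => key j
  refine HasFDerivAt.congr_fderiv (f := cauchyOp Γ E s) hsum ?_
  simp only [← hL]
  rw [← map_sum]
  congr 1
  ext i
  have h2 := kern_two_eval hE hα₀ hα₁ hm hD hp hs hr hw
  rw [Finset.sum_apply]
  fin_cases i
  · simpa [hc, diff, BoundaryParametrization.kern] using h2
  · simp only [hc, diff]
    simp only [Fin.mk_one, Matrix.cons_val]
    rw [← h2]
    simp only [intervalIntegral.integral_const_mul, ← Finset.mul_sum]
    rfl
  · simp [hc, diff, cauchyOp, BoundaryParametrization.kern]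
  · simp [hc, diff, cauchyOp, BoundaryParametrization.kern]

lemma coordDeriv_cauchyOp (hE : IsBoundaryJet Γ k α ν Λ E N) (hα₀ : 0 < α) (hα₁ : α ≤ 1)
    (hm : 1 ≤ m) (hD : IsOpen D) (hΛ : IsOpen Λ) {s : BoundaryOp Γ.n} {p r : ℕ} (hp : p + 1 ≤ m)
    (hs : Regular Γ (p + 1) r s) (hr : r < k) (i : Fin 4) :
    EqOn (coordDeriv i (cauchyOp Γ E s))
      (fun w => diffFactor 𝕜 i * cauchyOp Γ E (diff Γ i s) w) (D ×ˢ Λ) := by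
  intro w hw
  unfold coordDeriv
  rw [(hasFDerivAt_cauchyOp hE hα₀ hα₁ hm hD hΛ hp hs hr hw).fderiv, realLin_apply]
  fin_cases i <;> simp [coordDir, diffFactor]

lemma contDiffOn_cauchyOp (hE : IsBoundaryJet Γ k α ν Λ E N) (hα₀ : 0 < α) (hα₁ : α ≤ 1)
    (hm : 1 ≤ m) (hD : IsOpen D) (hΛ : IsOpen Λ) {n : ℕ} (hn : n ≤ m) {s : BoundaryOp Γ.n} {r : ℕ}
    (hs : Regular Γ n r s) (hr : r + n ≤ k) : ContDiffOn ℝ n (cauchyOp Γ E s) (D ×ˢ Λ) := by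
  induction n generalizing s r with
  | zero => exact contDiffOn_zero.2 (continuousOn_cauchyOp hE hm hD hΛ hs (by omega))
  | succ n ih =>
    have hd := fun w (hw : w ∈ D ×ˢ Λ) =>
      hasFDerivAt_cauchyOp hE hα₀ hα₁ hm hD hΛ hn hs (by omega) hw
    obtain ⟨L, hL⟩ := exists_clm_eq_realLin (𝕜 := 𝕜)
    push_cast
    refine (contDiffOn_succ_iff_fderiv_of_isOpen (hD.prod hΛ)).2
      ⟨fun w hw => (hd w hw).differentiableAt.differentiableWithinAt, fun h => ?_, ?_⟩
    · exact absurd h (by simp)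
    · refine ContDiffOn.congr (f := fun w => L fun i =>
        (![1, Complex.I, 1, 1] : Fin 4 → ℂ) i * cauchyOp Γ E (diff Γ i s) w) ?_
        fun w hw => by rw [(hd w hw).fderiv, hL]
      have hLc : ContDiff ℝ n L :=
        ContinuousLinearMap.contDiff (𝕜 := ℝ) (E := Fin 4 → ℂ) (F := ℂ × 𝕜 →L[ℝ] ℂ) L
      refine hLc.comp_contDiffOn (f := fun w i =>
        (![1, Complex.I, 1, 1] : Fin 4 → ℂ) i * cauchyOp Γ E (diff Γ i s) w)
        (contDiffOn_pi.2 fun i => contDiffOn_const.mul ?_)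
      exact ih (by omega) (hs.diff hα₀ hα₁ hn i) (by omega)

end BoundaryOp

end CauchyOperator

section IteratedDerivatives

variable {𝕜 : Type*} [RCLike 𝕜] {D : Set ℂ} {m : ℕ} {α : ℝ}

namespace BoundaryOp

variable (Γ : BoundaryParametrization D m α)

/-- The operator whose Cauchy integral is, up to a constant factor, the partial derivative `D^γ` of
the Cauchy integral of `s`. -/
noncomputable def iterDiff (γ : Fin 4 → ℕ) (s : BoundaryOp Γ.n) : BoundaryOp Γ.n :=
  (diff Γ 0)^[γ 0] ((diff Γ 1)^[γ 1] ((diff Γ 2)^[γ 2] ((diff Γ 3)^[γ 3] s)))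

/-- The identity operator. -/
def one : BoundaryOp Γ.n := [(fun _ _ => 1, 0)]

/-- The operator `s` of order `r` has coefficients of class `C^{p, α}` and arises from the identity
by `r` derivatives. Its terms of order zero are trivial if `0 < r`, since the derivative of a
constant is zero; this matters because the boundary values themselves need not be log-Hölder in the
parameter `l` if `0 < k`. -/
def Admissible (p r : ℕ) (s : BoundaryOp Γ.n) : Prop :=
  Regular Γ p r s ∧ (∀ q ∈ s, ∑ i, q.2 i = 0 → ∀ j, ∃ x, q.1 j = fun _ => x) ∧
    (r ≠ 0 → ∀ q ∈ s, ∑ i, q.2 i = 0 → ∀ j, q.1 j = fun _ => 0)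

variable {Γ}

lemma admissible_one (p : ℕ) : Admissible Γ p 0 (one Γ) := by
  refine ⟨fun q hq => ?_, fun q hq _ j => ⟨1, ?_⟩, fun h => absurd rfl h⟩
  · rw [one, List.mem_singleton] at hq
    subst hq
    exact ⟨fun j => PerHolder.const 1, by simp⟩
  · rw [one, List.mem_singleton] at hq
    subst hq
    rfl

lemma Admissible.diff {p r : ℕ} {s : BoundaryOp Γ.n} (hα₀ : 0 < α) (hα₁ : α ≤ 1)
    (hp : p + 1 ≤ m) (h : Admissible Γ (p + 1) r s) (i : Fin 4) :
    Admissible Γ p (r + 1) (diff Γ i s) := by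
  have hT : ∀ q ∈ tangential Γ s, ∑ i, q.2 i = 0 → ∀ j, q.1 j = fun _ => 0 := by
    intro q hq h0 j
    obtain ⟨x, hx, hq⟩ := List.mem_flatMap.1 hq
    simp only [List.mem_cons, List.not_mem_nil, or_false] at hq
    rcases hq with rfl | rfl | rfl
    · obtain ⟨y, hy⟩ := h.2.1 x hx h0 j
      simp [hy]
    · rw [sum_add_single] at h0; omega
    · rw [sum_add_single] at h0; omega
  have hS : ∀ i, ∀ q ∈ shift Γ i s, ∑ i, q.2 i = 0 → ∀ j, q.1 j = fun _ => 0 := by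
    intro i q hq h0 j
    obtain ⟨x, hx, rfl⟩ := List.mem_map.1 hq
    rw [sum_add_single] at h0
    omega
  have h0 : ∀ q ∈ BoundaryOp.diff Γ i s, ∑ i, q.2 i = 0 → ∀ j, q.1 j = fun _ => 0 := by
    fin_cases i
    · exact hT
    · exact hT
    · exact hS 2
    · exact hS 3
  exact ⟨h.1.diff hα₀ hα₁ hp i, fun q hq hs j => ⟨0, h0 q hq hs j⟩, fun _ => h0⟩

lemma Admissible.diff_iterate {p r n : ℕ} {s : BoundaryOp Γ.n} (hα₀ : 0 < α) (hα₁ : α ≤ 1)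
    (hp : p + n ≤ m) (h : Admissible Γ (p + n) r s) (i : Fin 4) :
    Admissible Γ p (r + n) ((BoundaryOp.diff Γ i)^[n] s) := by
  induction n generalizing p with
  | zero => exact h
  | succ n ih =>
    rw [Function.iterate_succ_apply']
    exact (ih (p := p + 1) (by omega) (by rwa [add_assoc, add_comm 1 n])).diff hα₀ hα₁ (by omega) i

lemma admissible_iterDiff (hα₀ : 0 < α) (hα₁ : α ≤ 1) {γ : Fin 4 → ℕ} {p : ℕ}
    (hγ : p + ∑ i, γ i ≤ m) : Admissible Γ p (∑ i, γ i) (iterDiff Γ γ (one Γ)) := by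
  rw [Fin.sum_univ_four] at hγ ⊢
  have h3 := (admissible_one (Γ := Γ) (p + γ 0 + γ 1 + γ 2 + γ 3)).diff_iterate hα₀ hα₁
    (by omega) 3
  have h2 := h3.diff_iterate hα₀ hα₁ (by omega) 2
  have h1 := h2.diff_iterate hα₀ hα₁ (by omega) 1
  have h0 := h1.diff_iterate hα₀ hα₁ (by omega) 0
  rwa [show 0 + γ 3 + γ 2 + γ 1 + γ 0 = γ 0 + γ 1 + γ 2 + γ 3 by ring] at h0

variable {k : ℕ} {ν : ℝ} {Λ : Set 𝕜} {E : (Fin 4 → ℕ) → ℂ → 𝕜 → ℂ} {N : ℝ}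

/-- Differentiation of a multiple `g` of the Cauchy integral of `s`. Only the values of `g` in the open
set `D × Λ` matter. -/
lemma coordDeriv_iterate_cauchyOp (hE : IsBoundaryJet Γ k α ν Λ E N) (hα₀ : 0 < α) (hα₁ : α ≤ 1)
    (hm : 1 ≤ m) (hD : IsOpen D) (hΛ : IsOpen Λ) {s : BoundaryOp Γ.n} {p r n : ℕ}
    (hp : p + n ≤ m) (hs : Admissible Γ (p + n) r s) (hr : r + n ≤ k) (i : Fin 4)
    {g : ℂ × 𝕜 → ℂ} (hg : ∃ c : ℂ, ‖c‖ ≤ 1 ∧ EqOn g (fun w => c * cauchyOp Γ E s w) (D ×ˢ Λ)) :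
    ∃ c : ℂ, ‖c‖ ≤ 1 ∧ EqOn ((coordDeriv i)^[n] g)
      (fun w => c * cauchyOp Γ E ((diff Γ i)^[n] s) w) (D ×ˢ Λ) := by
  induction n generalizing p with
  | zero => exact hg
  | succ n ih =>
    obtain ⟨c, hc, h⟩ := ih (p := p + 1) (by omega) (by rwa [add_assoc, add_comm 1 n]) (by omega)
    have hn : Admissible Γ (p + 1) (r + n) ((diff Γ i)^[n] s) :=
      Admissible.diff_iterate hα₀ hα₁ (by omega) (by rwa [add_assoc, add_comm 1 n]) i
    rw [Function.iterate_succ_apply', Function.iterate_succ_apply']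
    refine ⟨c * diffFactor 𝕜 i, ?_, fun w hw => ?_⟩
    · rw [norm_mul]
      exact mul_le_one₀ hc (norm_nonneg _) (norm_diffFactor_le i)
    · rw [EqOn.coordDeriv (hD.prod hΛ) h i hw]
      have hd := (hasFDerivAt_cauchyOp hE hα₀ hα₁ hm hD hΛ (by omega) hn.1 (by omega)
        hw).differentiableAt
      have := coordDeriv_cauchyOp hE hα₀ hα₁ hm hD hΛ (by omega) hn.1 (by omega) i hw
      simp only at this ⊢
      rw [mul_assoc, ← this]
      unfold coordDeriv
      rw [fderiv_const_mul hd]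
      rfl

lemma partialDeriv_eq_cauchyOp (hE : IsBoundaryJet Γ k α ν Λ E N) (hα₀ : 0 < α) (hα₁ : α ≤ 1)
    (hm : 1 ≤ m) (hD : IsOpen D) (hΛ : IsOpen Λ) {γ : Fin 4 → ℕ} (hγ : ∑ i, γ i ≤ k) (hk : k ≤ m)
    {g : ℂ × 𝕜 → ℂ}
    (hg : ∃ c : ℂ, ‖c‖ ≤ 1 ∧ EqOn g (fun w => c * cauchyOp Γ E (one Γ) w) (D ×ˢ Λ)) :
    ∃ c : ℂ, ‖c‖ ≤ 1 ∧ EqOn (partialDeriv γ g)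
      (fun w => c * cauchyOp Γ E (iterDiff Γ γ (one Γ)) w) (D ×ˢ Λ) := by
  rw [Fin.sum_univ_four] at hγ
  have a4 := admissible_one (Γ := Γ) (0 + γ 0 + γ 1 + γ 2 + γ 3)
  have a3 := a4.diff_iterate hα₀ hα₁ (by omega) 3
  have a2 := a3.diff_iterate hα₀ hα₁ (by omega) 2
  have a1 := a2.diff_iterate hα₀ hα₁ (by omega) 1
  have h3 := coordDeriv_iterate_cauchyOp hE hα₀ hα₁ hm hD hΛ (by omega) a4 (by omega) 3 hg
  have h2 := coordDeriv_iterate_cauchyOp hE hα₀ hα₁ hm hD hΛ (by omega) a3 (by omega) 2 h3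
  have h1 := coordDeriv_iterate_cauchyOp hE hα₀ hα₁ hm hD hΛ (by omega) a2 (by omega) 1 h2
  exact coordDeriv_iterate_cauchyOp hE hα₀ hα₁ hm hD hΛ (by omega) a1 (by omega) 0 h1

end BoundaryOp

end IteratedDerivatives

/-! ### Moduli of continuity of the densities -/

section Densities

variable {𝕜 : Type*} [RCLike 𝕜] {D : Set ℂ} {m : ℕ} {α : ℝ} {Γ : BoundaryParametrization D m α}

namespace BoundaryOp

lemma Regular.exists_norm_head_le {p r : ℕ} {q : (Fin Γ.n → ℝ → ℂ) × (Fin 4 → ℕ)}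
    {s : BoundaryOp Γ.n} (hs : Regular Γ p r (q :: s)) : ∃ B > 0, ∀ j t, ‖q.1 j t‖ ≤ B := by
  choose B hB using fun j =>
    (hs.head.1 j).periodic.exists_norm_le (Γ.period_pos j) (hs.head.1 j).continuous
  obtain ⟨B', hB', h⟩ := exists_pos_forall_ge B
  exact ⟨B', hB', fun j t => (hB j t).trans (h j)⟩

lemma exists_norm_eval_le {p r k : ℕ} (ν : ℝ) (Λ : Set 𝕜) {s : BoundaryOp Γ.n}
    (hs : Regular Γ p r s) (hr : r ≤ k) :
    ∃ C > 0, ∀ (E : (Fin 4 → ℕ) → ℂ → 𝕜 → ℂ) (N : ℝ), IsBoundaryJet Γ k α ν Λ E N →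
      ∀ l ∈ Λ, ∀ j t, ‖eval Γ E s j t l‖ ≤ C * N := by
  induction s with
  | nil =>
    refine ⟨1, one_pos, fun E N hE l hl j t => ?_⟩
    have := hE.nonneg
    simpa [eval] using this
  | cons q s ih =>
    obtain ⟨C₁, hC₁, h₁⟩ := ih hs.tail
    obtain ⟨B, hB, hBb⟩ := hs.exists_norm_head_le
    refine ⟨B + C₁, by positivity, fun E N hE l hl j t => ?_⟩
    rw [eval_cons, add_mul]
    refine (norm_add_le _ _).trans (add_le_add ?_ (h₁ E N hE l hl j t))
    rw [norm_mul]
    exact mul_le_mul (hBb j t) (hE.norm_le _ (hs.head.2.trans hr) _ (Γ.curve_mem_frontier j t) l hl)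
      (norm_nonneg _) hB.le

lemma exists_cutMod_curve_le (hα₀ : 0 < α) (hm : 1 ≤ m) (ν : ℝ) :
    ∃ C > 0, ∀ j t u, cutMod α ν ‖Γ.curve j t - Γ.curve j u‖ ≤ C * cutMod α ν |t - u| := by
  obtain ⟨M, hM, -, hMl⟩ := Γ.exists_lipschitz hm
  obtain ⟨C₁, hC₁, h₁⟩ := cutMod_mono hα₀ ν
  obtain ⟨C₂, hC₂, h₂⟩ := cutMod_dilate hα₀ ν hM.le
  refine ⟨C₁ * C₂, by positivity, fun j t u => ?_⟩
  refine (h₁ _ _ (norm_nonneg _) (hMl j u t)).trans ?_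
  rw [mul_assoc]
  gcongr
  exact h₂ _ (abs_nonneg _)

/-- If `ω` dominates the modulus of continuity of the coefficients of `s` and the modulus
`cutMod α ν`, then it dominates that of the densities. -/
lemma exists_modulus_eval {p r k : ℕ} {ν R : ℝ} (hα₀ : 0 < α) (hm : 1 ≤ m) (Λ : Set 𝕜)
    {s : BoundaryOp Γ.n} (hs : Regular Γ p r s) (hr : r ≤ k) {ω : ℝ → ℝ}
    (hω0 : ∀ x, 0 ≤ x → 0 ≤ ω x)
    (hω : ∃ C > 0, ∀ x, 0 ≤ x → x ≤ R → cutMod α ν x ≤ C * ω x)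
    (hcoef : ∀ q ∈ s, ∀ j, ∃ M, ∀ t u, |t - u| ≤ R → ‖q.1 j t - q.1 j u‖ ≤ M * ω |t - u|) :
    ∃ C > 0, ∀ (E : (Fin 4 → ℕ) → ℂ → 𝕜 → ℂ) (N : ℝ), IsBoundaryJet Γ k α ν Λ E N →
      ∀ l ∈ Λ, ∀ j t u, |t - u| ≤ R →
        ‖eval Γ E s j t l - eval Γ E s j u l‖ ≤ C * N * ω |t - u| := by
  induction s with
  | nil =>
    refine ⟨1, one_pos, fun E N hE l hl j t u htu => ?_⟩
    have := mul_nonneg hE.nonneg (hω0 _ (abs_nonneg (t - u)))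
    simpa [eval] using this
  | cons q s ih =>
    obtain ⟨C₁, hC₁, h₁⟩ := ih hs.tail fun x hx => hcoef x (List.mem_cons_of_mem _ hx)
    obtain ⟨C₂, hC₂, h₂⟩ := hω
    obtain ⟨C₃, hC₃, h₃⟩ := exists_cutMod_curve_le (Γ := Γ) hα₀ hm ν
    obtain ⟨B, hB, hBb⟩ := hs.exists_norm_head_le
    obtain ⟨M, hM, hMb⟩ : ∃ M > 0, ∀ j t u, |t - u| ≤ R →
        ‖q.1 j t - q.1 j u‖ ≤ M * ω |t - u| := by
      choose M hM using hcoef q List.mem_cons_self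
      obtain ⟨M', hM', h⟩ := exists_pos_forall_ge M
      exact ⟨M', hM', fun j t u htu => (hM j t u htu).trans
        (mul_le_mul_of_nonneg_right (h j) (hω0 _ (abs_nonneg _)))⟩
    refine ⟨M + B * (C₃ * C₂) + C₁, by positivity, fun E N hE l hl j t u htu => ?_⟩
    have hβ := hs.head.2.trans hr
    have hf := Γ.curve_mem_frontier j
    have e : eval Γ E (q :: s) j t l - eval Γ E (q :: s) j u l =
        (q.1 j t - q.1 j u) * E q.2 (Γ.curve j t) l +
        q.1 j u * (E q.2 (Γ.curve j t) l - E q.2 (Γ.curve j u) l) +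
        (eval Γ E s j t l - eval Γ E s j u l) := by
      rw [eval_cons, eval_cons]; ring
    have hN := hE.nonneg
    have hω1 := hω0 _ (abs_nonneg (t - u))
    have f1 : ‖(q.1 j t - q.1 j u) * E q.2 (Γ.curve j t) l‖ ≤ M * ω |t - u| * N := by
      rw [norm_mul]
      exact mul_le_mul (hMb j t u htu) (hE.norm_le _ hβ _ (hf t) l hl) (norm_nonneg _)
        (by positivity)
    have f2 : ‖q.1 j u * (E q.2 (Γ.curve j t) l - E q.2 (Γ.curve j u) l)‖ ≤
        B * (N * (C₃ * (C₂ * ω |t - u|))) := by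
      rw [norm_mul]
      refine mul_le_mul (hBb j u) ?_ (norm_nonneg _) hB.le
      refine (hE.mod_z _ hβ _ (hf t) _ (hf u) l hl).trans ?_
      gcongr
      refine (h₃ j t u).trans ?_
      gcongr
      exact h₂ _ (abs_nonneg _) htu
    have f3 := h₁ E N hE l hl j t u htu
    rw [e]
    refine (norm_add₃_le).trans ((add_le_add (add_le_add f1 f2) f3).trans (le_of_eq ?_))
    ring

/-- The increments in `l` of the density are small, and their increments along the boundary are
controlled both by the modulus in `ζ` and by the modulus in `l`. -/
lemma exists_modulus_eval_sub {p r k : ℕ} {ν : ℝ} (hα₀ : 0 < α) (hα₁ : α ≤ 1) (hm : 1 ≤ m)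
    (Λ : Set 𝕜) {s : BoundaryOp Γ.n} (hs : Regular Γ p r s) (hr : r ≤ k)
    (hlow : ∀ q ∈ s, (∑ i, q.2 i = 0 → k = 0) ∨ ∀ j, q.1 j = fun _ => 0) :
    ∃ C > 0, ∀ (E : (Fin 4 → ℕ) → ℂ → 𝕜 → ℂ) (N : ℝ), IsBoundaryJet Γ k α ν Λ E N →
      ∀ l ∈ Λ, ∀ l' ∈ Λ, ∀ j,
        (∀ t, ‖eval Γ E s j t l - eval Γ E s j t l'‖ ≤ C * N * cutMod α ν ‖l - l'‖) ∧
        ∀ t u, ‖(eval Γ E s j t l - eval Γ E s j t l') -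
          (eval Γ E s j u l - eval Γ E s j u l')‖ ≤
          C * N * (min (cutMod α ν |t - u|) (cutMod α ν ‖l - l'‖) +
            cutMod α ν ‖l - l'‖ * |t - u| ^ α) := by
  have hpos : ∀ x : 𝕜, 0 ≤ cutMod α ν ‖x‖ := fun x => cutMod_nonneg hα₀ (norm_nonneg _)
  have hpos' : ∀ x : ℝ, 0 ≤ cutMod α ν |x| := fun x => cutMod_nonneg hα₀ (abs_nonneg _)
  induction s with
  | nil =>
    refine ⟨1, one_pos, fun E N hE l hl l' hl' j => ⟨fun t => ?_, fun t u => ?_⟩⟩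
    · simpa [eval] using mul_nonneg hE.nonneg (hpos (l - l'))
    · have h1 : 0 ≤ min (cutMod α ν |t - u|) (cutMod α ν ‖l - l'‖) :=
        le_min (hpos' _) (hpos _)
      have h2 := hpos (l - l')
      have h3 := hE.nonneg
      simp only [eval, List.map_nil, List.sum_nil, sub_zero, norm_zero]
      positivity
  | cons q s ih =>
    obtain ⟨C₁, hC₁, h₁⟩ := ih hs.tail fun x hx => hlow x (List.mem_cons_of_mem _ hx)
    obtain ⟨C₃, hC₃, h₃⟩ := exists_cutMod_curve_le (Γ := Γ) hα₀ hm ν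
    obtain ⟨B, hB, hBb⟩ := hs.exists_norm_head_le
    obtain ⟨M, hM, hMb⟩ : ∃ M > 0, ∀ j t u, ‖q.1 j t - q.1 j u‖ ≤ M * |t - u| ^ α := by
      choose M hM0 hM using fun j => (hs.head.1 j).holder (Γ.period_pos j) hα₀ hα₁
      obtain ⟨M', hM', h⟩ := exists_pos_forall_ge M
      exact ⟨M', hM', fun j t u => (hM j t u).trans
        (mul_le_mul_of_nonneg_right (h j) (by positivity))⟩
    refine ⟨B + M + B * (2 * C₃ + 2) + C₁, by positivity, fun E N hE l hl l' hl' j => ?_⟩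
    have hβ := hs.head.2.trans hr
    have hf := Γ.curve_mem_frontier j
    have hN := hE.nonneg
    have hp := hpos (l - l')
    -- the increment of the term `q`
    have g1 : ∀ t, q.1 j t = 0 ∨ ‖E q.2 (Γ.curve j t) l - E q.2 (Γ.curve j t) l'‖ ≤
        N * cutMod α ν ‖l - l'‖ := fun t => by
      rcases hlow q List.mem_cons_self with h | h
      · exact Or.inr (hE.mod_l _ hβ h _ (hf t) l hl l' hl')
      · exact Or.inl (by rw [h])
    obtain ⟨k1, k2⟩ := h₁ E N hE l hl l' hl' j
    refine ⟨fun t => ?_, fun t u => ?_⟩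
    · have e : eval Γ E (q :: s) j t l - eval Γ E (q :: s) j t l' =
          q.1 j t * (E q.2 (Γ.curve j t) l - E q.2 (Γ.curve j t) l') +
          (eval Γ E s j t l - eval Γ E s j t l') := by
        rw [eval_cons, eval_cons]; ring
      have f1 : ‖q.1 j t * (E q.2 (Γ.curve j t) l - E q.2 (Γ.curve j t) l')‖ ≤
          B * (N * cutMod α ν ‖l - l'‖) := by
        rw [norm_mul]
        rcases g1 t with h | h
        · rw [h, norm_zero, zero_mul]; positivity
        · exact mul_le_mul (hBb j t) h (norm_nonneg _) hB.le
      rw [e]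
      refine (norm_add_le _ _).trans ((add_le_add f1 (k1 t)).trans ?_)
      have h0 : 0 ≤ N * cutMod α ν ‖l - l'‖ := by positivity
      have : (B + M + B * (2 * C₃ + 2) + C₁) * N * cutMod α ν ‖l - l'‖ =
        B * (N * cutMod α ν ‖l - l'‖) + C₁ * N * cutMod α ν ‖l - l'‖ +
          (M + B * (2 * C₃ + 2)) * (N * cutMod α ν ‖l - l'‖) := by ring
      rw [this]
      exact le_add_of_nonneg_right (by positivity)
    · set dE := fun t => E q.2 (Γ.curve j t) l - E q.2 (Γ.curve j t) l' with hdE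
      have e : (eval Γ E (q :: s) j t l - eval Γ E (q :: s) j t l') -
          (eval Γ E (q :: s) j u l - eval Γ E (q :: s) j u l') =
          (q.1 j t - q.1 j u) * dE t + q.1 j u * (dE t - dE u) +
          ((eval Γ E s j t l - eval Γ E s j t l') -
            (eval Γ E s j u l - eval Γ E s j u l')) := by
        simp only [eval_cons, hdE]; ring
      set mn := min (cutMod α ν |t - u|) (cutMod α ν ‖l - l'‖) with hmn
      have hmn0 : 0 ≤ mn := le_min (hpos' _) hp
      set T := cutMod α ν ‖l - l'‖ * |t - u| ^ α with hT
      have hT0 : 0 ≤ T := by positivity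
      have f : ‖(q.1 j t - q.1 j u) * dE t + q.1 j u * (dE t - dE u)‖ ≤
          M * (N * T) + B * ((2 * C₃ + 2) * N * mn) := by
        rcases hlow q List.mem_cons_self with h | h
        · have f1 : ‖(q.1 j t - q.1 j u) * dE t‖ ≤ M * (N * T) := by
            rw [norm_mul]
            have := mul_le_mul (hMb j t u) (hE.mod_l _ hβ h _ (hf t) l hl l' hl')
              (norm_nonneg _) (by positivity)
            refine this.trans (le_of_eq ?_)
            rw [hT]; ring
          have f2 : ‖dE t - dE u‖ ≤ (2 * C₃ + 2) * N * mn := by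
            have x1 : ‖dE t - dE u‖ ≤ 2 * N * cutMod α ν ‖l - l'‖ := by
              have a1 := hE.mod_l _ hβ h _ (hf t) l hl l' hl'
              have a2 := hE.mod_l _ hβ h _ (hf u) l hl l' hl'
              have := norm_sub_le (dE t) (dE u)
              simp only [hdE] at this ⊢
              linarith
            have x2 : ‖dE t - dE u‖ ≤ 2 * C₃ * N * cutMod α ν |t - u| := by
              have a1 := hE.mod_z _ hβ _ (hf t) _ (hf u) l hl
              have a2 := hE.mod_z _ hβ _ (hf t) _ (hf u) l' hl'
              have a3 := mul_le_mul_of_nonneg_left (h₃ j t u) hN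
              have a4 : dE t - dE u = (E q.2 (Γ.curve j t) l - E q.2 (Γ.curve j u) l) -
                (E q.2 (Γ.curve j t) l' - E q.2 (Γ.curve j u) l') := by
                simp only [hdE]; ring
              rw [a4]
              refine (norm_sub_le _ _).trans ?_
              linarith
            rcases le_total (cutMod α ν |t - u|) (cutMod α ν ‖l - l'‖) with hle | hle
            · rw [hmn, min_eq_left hle]
              have := hpos' (t - u)
              refine x2.trans ?_
              gcongr
              linarith
            · rw [hmn, min_eq_right hle]
              refine x1.trans ?_
              gcongr
              linarith
          refine (norm_add_le _ _).trans (add_le_add f1 ?_)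
          rw [norm_mul]
          exact mul_le_mul (hBb j u) f2 (norm_nonneg _) hB.le
        · simp only [h, sub_zero, zero_mul, add_zero, norm_zero]
          positivity
      rw [e]
      refine (norm_add_le _ _).trans ((add_le_add f (k2 t u)).trans ?_)
      have h0 : (B + M + B * (2 * C₃ + 2) + C₁) * N * (mn + T) =
        M * (N * T) + B * ((2 * C₃ + 2) * N * mn) + C₁ * N * (mn + T) +
          (B * N * (mn + T) + M * (N * mn) + B * ((2 * C₃ + 2) * N * T)) := by ring
      rw [h0]
      exact le_add_of_nonneg_right (by positivity)

end BoundaryOp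

end Densities

/-! ### Elementary integrals -/

section Integrals

/-- Integrals are estimated by differentiable majorants of their primitives, which need not be
differentiable at `0`. -/
lemma integral_le_sub_of_hasDerivAt {φ g g' : ℝ → ℝ} {R : ℝ} (hR : 0 ≤ R)
    (hφ : ContinuousOn φ (Icc 0 R)) (hg : ContinuousOn g (Icc 0 R))
    (hd : ∀ u, 0 < u → HasDerivAt g (g' u) u) (hle : ∀ u, 0 < u → φ u ≤ g' u) :
    ∫ u in (0 : ℝ)..R, φ u ≤ g R - g 0 :=
  intervalIntegral.integral_le_sub_of_hasDeriv_right_of_le hR hg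
    (fun u hu => (hd u hu.1).hasDerivWithinAt) hφ.integrableOn_Icc fun u hu => hle u hu.1

lemma integral_rpow_div_le {a δ R : ℝ} (ha : 0 < a) (hδ : 0 < δ) (hR : 0 ≤ R) :
    ∫ u in (0 : ℝ)..R, u ^ a / (u + δ) ^ 1 ≤ R ^ a / a := by
  have hc : Continuous fun u : ℝ => u ^ a := continuous_id.rpow_const fun _ => Or.inr ha.le
  have := integral_le_sub_of_hasDerivAt (φ := fun u => u ^ a / (u + δ) ^ 1)
    (g := fun u => u ^ a / a) (g' := fun u => u ^ (a - 1)) hR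
    (hc.continuousOn.div (by fun_prop) fun u hu => by have := hu.1; positivity)
    (by fun_prop) (fun u hu => ?_) fun u hu => ?_
  · simpa [Real.zero_rpow ha.ne'] using this
  · refine ((Real.hasDerivAt_rpow_const (p := a) (Or.inl hu.ne')).div_const a).congr_deriv ?_
    field_simp
  · rw [pow_one, Real.rpow_sub_one hu.ne']
    gcongr
    linarith

lemma integral_rpow_div_sq_le {a δ R : ℝ} (ha : 0 < a) (ha1 : a < 1) (hδ : 0 < δ) (hR : 0 ≤ R) :
    ∫ u in (0 : ℝ)..R, u ^ a / (u + δ) ^ 2 ≤ δ ^ (a - 1) / (1 - a) := by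
  have hc : Continuous fun u : ℝ => u ^ a := continuous_id.rpow_const fun _ => Or.inr ha.le
  have h1a : 0 < 1 - a := by linarith
  have := integral_le_sub_of_hasDerivAt (φ := fun u => u ^ a / (u + δ) ^ 2)
    (g := fun u => -((u + δ) ^ (a - 1) / (1 - a))) (g' := fun u => (u + δ) ^ (a - 2)) hR
    (hc.continuousOn.div (by fun_prop) fun u hu => by have := hu.1; positivity)
    ?_ (fun u hu => ?_) fun u hu => ?_
  · refine this.trans ?_
    have : 0 ≤ (R + δ) ^ (a - 1) / (1 - a) := by positivity
    simp only [zero_add]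
    linarith
  · refine (ContinuousOn.div_const (ContinuousOn.rpow_const (by fun_prop) fun u hu => ?_) _).neg
    left
    have := hu.1
    positivity
  · have hp : u + δ ≠ 0 := by positivity
    refine ((((hasDerivAt_id u).add_const δ).rpow_const (p := a - 1)
      (Or.inl hp)).div_const (1 - a)).neg.congr_deriv ?_
    rw [show a - 1 - 1 = a - 2 by ring]
    simp only [id]
    field_simp
    ring
  · have hp : 0 < u + δ := by positivity
    rw [Real.rpow_sub hp, Real.rpow_two]
    gcongr
    linarith

lemma integral_linear_div_sq_le {δ R : ℝ} (hδ : 0 < δ) (hR : 0 ≤ R) :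
    ∫ u in (0 : ℝ)..R, (1 + u / δ) / (u + δ) ^ 2 ≤ Real.log ((R + δ) / δ) / δ := by
  have := integral_le_sub_of_hasDerivAt (φ := fun u => (1 + u / δ) / (u + δ) ^ 2)
    (g := fun u => Real.log (u + δ) / δ) (g' := fun u => 1 / (u + δ) / δ) hR
    (ContinuousOn.div (by fun_prop) (by fun_prop) fun u hu => by have := hu.1; positivity)
    ?_ (fun u hu => ?_) fun u hu => ?_
  · refine this.trans (le_of_eq ?_)
    rw [Real.log_div (by positivity) hδ.ne']
    simp only [zero_add]
    ring
  · refine ContinuousOn.div_const (ContinuousOn.log (by fun_prop) fun u hu => ?_) _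
    have := hu.1
    positivity
  · have hp : u + δ ≠ 0 := by positivity
    exact (((hasDerivAt_id u).add_const δ).log hp).div_const δ
  · refine le_of_eq ?_
    field_simp
    ring

lemma integral_saturated_div_le {a h δ R : ℝ} (ha : 0 < a) (hh : 0 < h) (hδ : 0 < δ)
    (hR : 0 ≤ R) : ∫ u in (0 : ℝ)..R, u ^ a / (u ^ a + h ^ a) / (u + δ) ^ 1 ≤
      Real.log ((R ^ a + h ^ a) / h ^ a) / a := by
  have hc : Continuous fun u : ℝ => u ^ a := continuous_id.rpow_const fun _ => Or.inr ha.le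
  have hha : 0 < h ^ a := by positivity
  have := integral_le_sub_of_hasDerivAt (φ := fun u => u ^ a / (u ^ a + h ^ a) / (u + δ) ^ 1)
    (g := fun u => Real.log (u ^ a + h ^ a) / a)
    (g' := fun u => a * u ^ (a - 1) / (u ^ a + h ^ a) / a) hR
    (ContinuousOn.div (hc.continuousOn.div (by fun_prop) fun u hu => ?_) (by fun_prop)
      fun u hu => by have := hu.1; positivity)
    ?_ (fun u hu => ?_) fun u hu => ?_
  · refine this.trans (le_of_eq ?_)
    simp only [Real.zero_rpow ha.ne', zero_add]
    rw [Real.log_div (by positivity) hha.ne']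
    ring
  · have := hu.1
    positivity
  · refine ContinuousOn.div_const (ContinuousOn.log (by fun_prop) fun u hu => ?_) _
    have := hu.1
    positivity
  · have hp : u ^ a + h ^ a ≠ 0 := by positivity
    exact (((Real.hasDerivAt_rpow_const (p := a) (Or.inl hu.ne')).add_const (h ^ a)).log
      hp).div_const a
  · rw [pow_one, Real.rpow_sub_one hu.ne']
    have : u ^ a / (u ^ a + h ^ a) / (u + δ) ≤ u ^ a / (u ^ a + h ^ a) / u := by
      gcongr
      linarith
    refine this.trans (le_of_eq ?_)
    field_simp

/-- A fixed multiple of `|ln h|` bounds the logarithms that arise in the integrals above, because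
`|ln h|` is bounded below for `h ≤ 1 / 2`. -/
lemma log_add_div_le {a c R h : ℝ} (ha : 0 < a) (hc : 0 ≤ c) (hh : 0 < h) (hh1 : h ≤ 1 / 2)
    (hR : c ≤ R) :
    Real.log ((c + h ^ a) / h ^ a) ≤ (Real.log (R + 1) / Real.log 2 + a) * |Real.log h| := by
  have hR0 := hc.trans hR
  have h1 : h ^ a ≤ 1 := Real.rpow_le_one hh.le (by linarith) ha.le
  have hha : 0 < h ^ a := by positivity
  have h2 := log_two_le_abs_log hh hh1
  have h3 : |Real.log h| = -Real.log h := abs_of_neg (Real.log_neg hh (by linarith))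
  rw [Real.log_div (by positivity) hha.ne', Real.log_rpow hh]
  have h4 : Real.log (c + h ^ a) ≤ Real.log (R + 1) :=
    Real.log_le_log (by positivity) (by linarith)
  have h5 : Real.log (R + 1) ≤ Real.log (R + 1) / Real.log 2 * |Real.log h| := by
    have h6 : 0 ≤ Real.log (R + 1) := Real.log_nonneg (by linarith)
    have h7 : 0 < Real.log 2 := Real.log_pos (by norm_num)
    rw [div_mul_eq_mul_div, le_div_iff₀ h7]
    gcongr
  rw [add_mul]
  have h6 : a * |Real.log h| = -(a * Real.log h) := by rw [h3]; ring
  linarith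

end Integrals

/-! ### Estimates of Cauchy integrals with log-Hölder densities -/

lemma infDist_frontier_pos {D : Set ℂ} (hD : IsOpen D) (hf : (frontier D).Nonempty) {z : ℂ}
    (hz : z ∈ D) : 0 < Metric.infDist z (frontier D) := by
  refine (isClosed_frontier.notMem_iff_infDist_pos hf).1 fun h => ?_
  rw [hD.frontier_eq] at h
  exact h.2 hz

lemma exists_infDist_frontier_le {D : Set ℂ} (hb : Bornology.IsBounded D)
    (hf : (frontier D).Nonempty) : ∃ B > 0, ∀ z ∈ D, Metric.infDist z (frontier D) ≤ B := by
  obtain ⟨ζ, hζ⟩ := hf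
  refine ⟨Metric.diam (closure D) + 1, by positivity, fun z hz => ?_⟩
  have h1 := Metric.infDist_le_dist_of_mem (x := z) hζ
  have h2 := Metric.dist_le_diam_of_mem hb.closure (subset_closure hz)
    (frontier_subset_closure hζ)
  linarith

namespace BoundaryParametrization

variable {D : Set ℂ} {m : ℕ} {α : ℝ} (Γ : BoundaryParametrization D m α)

/-- Boundedness of Cauchy integrals with Hölder densities. -/
lemma exists_kern_one_bound (hm : 1 ≤ m) (hD : IsOpen D) (hc : IsPreconnected D)
    (hf : (frontier D).Nonempty) {R : ℝ} (hR0 : 0 ≤ R) (hR : ∀ j, Γ.period j / 2 ≤ R) {e : ℝ}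
    (he : 0 < e) :
    ∃ C > 0, ∀ z ∈ D, ∀ (a : Fin Γ.n → ℝ → ℂ) (K : ℝ), 0 ≤ K → (∀ j, Continuous (a j)) →
      (∀ j, Function.Periodic (a j) (Γ.period j)) → (∀ j t, ‖a j t‖ ≤ K) →
      (∀ j t u, |t - u| ≤ R → ‖a j t - a j u‖ ≤ K * |t - u| ^ e) → ‖Γ.kern 1 a z‖ ≤ C * K := by
  obtain ⟨W, hW⟩ := Γ.kern_one_one_bounded hm hD hc
  obtain ⟨C, hC, h⟩ := Γ.norm_kern_le hm hD hf hW hR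
  refine ⟨C * (1 + R ^ e / e), by positivity, fun z hz a K hK ha hper hb hmod => ?_⟩
  have hcont : Continuous fun u : ℝ => K * u ^ e :=
    continuous_const.mul (continuous_id.rpow_const fun _ => Or.inr he.le)
  refine (h z hz a K (fun u => K * u ^ e) ha hper hb hcont.continuousOn
    (fun u hu => by have := hu.1; positivity) fun j s t hst => hmod j t s hst).trans ?_
  simp only [mul_div_assoc]
  rw [intervalIntegral.integral_const_mul, mul_assoc]
  have := integral_rpow_div_le he (infDist_frontier_pos hD hf hz) hR0
  have h2 := mul_le_mul_of_nonneg_left this hK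
  refine mul_le_mul_of_nonneg_left ?_ hC.le
  linarith

/-- The derivative of a Cauchy integral near the boundary. One logarithm is lost. -/
lemma exists_kern_two_bound (hm : 1 ≤ m) (hD : IsOpen D) (hb : Bornology.IsBounded D)
    (hf : (frontier D).Nonempty) {R : ℝ} (hR0 : 0 ≤ R) (hR : ∀ j, Γ.period j / 2 ≤ R)
    (hα₀ : 0 < α) (hα₁ : α ≤ 1) {ν : ℝ} (hν : α = 1 → 0 ≤ ν) :
    ∃ C > 0, ∀ z ∈ D, ∀ (a : Fin Γ.n → ℝ → ℂ) (K : ℝ), 0 ≤ K → (∀ j, Continuous (a j)) →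
      (∀ j, Function.Periodic (a j) (Γ.period j)) → (∀ j t, ‖a j t‖ ≤ K) →
      (∀ j t u, |t - u| ≤ R → ‖a j t - a j u‖ ≤ K * cutMod α ν |t - u|) →
      ‖Γ.kern 2 a z‖ ≤ C * K * (cutMod α (ν + 1) (Metric.infDist z (frontier D)) /
        Metric.infDist z (frontier D)) := by
  obtain ⟨C, hC, h⟩ := Γ.norm_kern_le hm hD hf (p := 2) (W := 0)
    (fun z hz => by rw [Γ.kern_two_one hm hD hz, norm_zero]) hR
  obtain ⟨B, hB, hBz⟩ := exists_infDist_frontier_le hb hf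
  obtain ⟨C₁, hC₁, h₁⟩ := cutMod_growth_linear hα₀ hα₁ hν
  obtain ⟨C₂, hC₂, h₂⟩ := linear_le_cutMod hα₀ hα₁ (μ := ν + 1)
    (fun h => by linarith [hν h]) hB.le
  set c := Real.log (R + 1) / Real.log 2 + 1 with hc
  have hc0 : 0 < c := by
    have : 0 ≤ Real.log (R + 1) := Real.log_nonneg (by linarith)
    have : 0 < Real.log 2 := Real.log_pos one_lt_two
    positivity
  refine ⟨C * (C₂ + C₁ * c), by positivity, fun z hz a K hK ha hper hbd hmod => ?_⟩
  set δ := Metric.infDist z (frontier D) with hδ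
  have hδ0 : 0 < δ := infDist_frontier_pos hD hf hz
  have hp := cutMod_pos (α := α) (μ := ν) hδ0
  have hp1 := cutMod_pos (α := α) (μ := ν + 1) hδ0
  refine (h z hz a K (fun u => (K * C₁ * cutMod α ν δ) * (1 + u / δ)) ha hper hbd (by fun_prop)
    (fun u hu => by have := hu.1; positivity) fun j s t hst => ?_).trans ?_
  · refine (hmod j t s hst).trans ?_
    rw [mul_assoc, mul_assoc]
    refine mul_le_mul_of_nonneg_left ((h₁ δ _ hδ0 (abs_nonneg _)).trans (le_of_eq ?_)) hK
    ring
  simp only [mul_div_assoc]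
  rw [intervalIntegral.integral_const_mul]
  -- the logarithm of the integral is absorbed by the modulus
  have hlog : cutMod α ν δ * Real.log ((R + δ) / δ) ≤ c * cutMod α (ν + 1) δ := by
    set d := min δ (1 / 2) with hd
    have hd0 : 0 < d := by positivity
    have hd1 : d ≤ 1 / 2 := min_le_right _ _
    have e1 : Real.log ((R + δ) / δ) ≤ Real.log ((R + d ^ (1 : ℝ)) / d ^ (1 : ℝ)) := by
      rw [Real.rpow_one]
      refine Real.log_le_log (by positivity) ?_
      rw [add_div, add_div, div_self hδ0.ne', div_self hd0.ne']
      have : d ≤ δ := min_le_left _ _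
      gcongr
    have e2 := e1.trans (log_add_div_le one_pos hR0 hd0 hd1 le_rfl)
    have e3 : cutMod α ν d * |Real.log d| = cutMod α (ν + 1) d := cutMod_mul_abs_log hd0 hd1
    have e4 : ∀ μ, cutMod α μ d = cutMod α μ δ := fun μ => by
      rw [cutMod, cutMod, hd, min_assoc, min_self]
    rw [e4, e4] at e3
    rw [← e3]
    have := mul_le_mul_of_nonneg_left e2 hp.le
    refine this.trans (le_of_eq ?_)
    ring
  have hA : K ≤ K * (C₂ * cutMod α (ν + 1) δ / δ) := by
    refine le_mul_of_one_le_right hK ?_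
    rw [one_le_div hδ0]
    exact h₂ δ hδ0.le (hBz z hz)
  have hI : K * C₁ * cutMod α ν δ * ∫ u in (0 : ℝ)..R, (1 + u / δ) / (u + δ) ^ 2 ≤
      K * C₁ * (c * cutMod α (ν + 1) δ) / δ := by
    have e1 := mul_le_mul_of_nonneg_left (integral_linear_div_sq_le hδ0 hR0)
      (show 0 ≤ K * C₁ * cutMod α ν δ by positivity)
    refine e1.trans ?_
    have e2 := mul_le_mul_of_nonneg_left hlog (show 0 ≤ K * C₁ / δ by positivity)
    have e3 : K * C₁ * cutMod α ν δ * (Real.log ((R + δ) / δ) / δ) =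
      K * C₁ / δ * (cutMod α ν δ * Real.log ((R + δ) / δ)) := by ring
    rw [e3]
    refine e2.trans (le_of_eq ?_)
    ring
  have := mul_le_mul_of_nonneg_left (add_le_add hA hI) hC.le
  refine this.trans (le_of_eq ?_)
  ring

/-- The derivative near the boundary of a Cauchy integral with a Hölder density. -/
lemma exists_kern_two_bound_of_holder (hm : 1 ≤ m) (hD : IsOpen D) (hb : Bornology.IsBounded D)
    (hf : (frontier D).Nonempty) {R : ℝ} (hR0 : 0 ≤ R) (hR : ∀ j, Γ.period j / 2 ≤ R)
    (hα₀ : 0 < α) (hα₁ : α < 1) {μ : ℝ} (hμ : 0 ≤ μ) :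
    ∃ C > 0, ∀ z ∈ D, ∀ (a : Fin Γ.n → ℝ → ℂ) (K : ℝ), 0 ≤ K → (∀ j, Continuous (a j)) →
      (∀ j, Function.Periodic (a j) (Γ.period j)) → (∀ j t, ‖a j t‖ ≤ K) →
      (∀ j t u, |t - u| ≤ R → ‖a j t - a j u‖ ≤ K * |t - u| ^ α) →
      ‖Γ.kern 2 a z‖ ≤ C * K * (cutMod α μ (Metric.infDist z (frontier D)) /
        Metric.infDist z (frontier D)) := by
  obtain ⟨C, hC, h⟩ := Γ.norm_kern_le hm hD hf (p := 2) (W := 0)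
    (fun z hz => by rw [Γ.kern_two_one hm hD hz, norm_zero]) hR
  obtain ⟨B, hB, hBz⟩ := exists_infDist_frontier_le hb hf
  obtain ⟨C₁, hC₁, h₁⟩ := rpow_le_cutMod hα₀ hμ hB.le
  obtain ⟨C₂, hC₂, h₂⟩ := linear_le_cutMod hα₀ hα₁.le (μ := μ) (fun _ => hμ) hB.le
  have h1α : 0 < 1 - α := by linarith
  refine ⟨C * (C₂ + C₁ / (1 - α)), by positivity, fun z hz a K hK ha hper hbd hmod => ?_⟩
  set δ := Metric.infDist z (frontier D) with hδ
  have hδ0 : 0 < δ := infDist_frontier_pos hD hf hz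
  have hcont : Continuous fun u : ℝ => K * u ^ α :=
    continuous_const.mul (continuous_id.rpow_const fun _ => Or.inr hα₀.le)
  refine (h z hz a K (fun u => K * u ^ α) ha hper hbd hcont.continuousOn
    (fun u hu => by have := hu.1; positivity) fun j s t hst => hmod j t s hst).trans ?_
  simp only [mul_div_assoc]
  rw [intervalIntegral.integral_const_mul]
  have hA : K ≤ K * (C₂ * cutMod α μ δ / δ) := by
    refine le_mul_of_one_le_right hK ?_
    rw [one_le_div hδ0]
    exact h₂ δ hδ0.le (hBz z hz)
  have hI : K * ∫ u in (0 : ℝ)..R, u ^ α / (u + δ) ^ 2 ≤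
      K * (C₁ * cutMod α μ δ / δ / (1 - α)) := by
    refine mul_le_mul_of_nonneg_left ((integral_rpow_div_sq_le hα₀ hα₁ hδ0 hR0).trans ?_) hK
    rw [Real.rpow_sub_one hδ0.ne']
    have := h₁ δ hδ0.le (hBz z hz)
    gcongr
  have := mul_le_mul_of_nonneg_left (add_le_add hA hI) hC.le
  refine this.trans (le_of_eq ?_)
  ring

/-- Cauchy integrals with small densities. One logarithm of the size `cutMod α ν h` of the density
is lost. -/
lemma exists_kern_one_bound_of_small (hm : 1 ≤ m) (hD : IsOpen D) (hc : IsPreconnected D)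
    (hf : (frontier D).Nonempty) {R : ℝ} (hR0 : 0 ≤ R) (hR : ∀ j, Γ.period j / 2 ≤ R)
    (hα₀ : 0 < α) (ν : ℝ) :
    ∃ C > 0, ∀ z ∈ D, ∀ (a : Fin Γ.n → ℝ → ℂ) (K h : ℝ), 0 ≤ K → 0 < h → h ≤ 1 / 2 →
      (∀ j, Continuous (a j)) → (∀ j, Function.Periodic (a j) (Γ.period j)) →
      (∀ j t, ‖a j t‖ ≤ K * cutMod α ν h) →
      (∀ j t u, ‖a j t - a j u‖ ≤
        K * (min (cutMod α ν |t - u|) (cutMod α ν h) + cutMod α ν h * |t - u| ^ α)) →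
      ‖Γ.kern 1 a z‖ ≤ C * K * cutMod α (ν + 1) h := by
  obtain ⟨W, hW⟩ := Γ.kern_one_one_bounded hm hD hc
  obtain ⟨C, hC, hk⟩ := Γ.norm_kern_le hm hD hf hW hR
  obtain ⟨C₁', -, h₁'⟩ := cutMod_decay hα₀ ν
  set C₁ := max C₁' 1 with hC₁
  have hC₁1 : 1 ≤ C₁ := le_max_right _ _
  have hl2 : 0 < Real.log 2 := Real.log_pos one_lt_two
  set c := Real.log (R ^ (α / 2) + 1) / Real.log 2 + α / 2 with hc'
  have hc0 : 0 < c := by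
    have : 0 ≤ Real.log (R ^ (α / 2) + 1) := Real.log_nonneg (by
      have : 0 ≤ R ^ (α / 2) := by positivity
      linarith)
    positivity
  refine ⟨C * ((1 + R ^ α / α) / Real.log 2 + 2 * C₁ * (c / (α / 2))), by positivity,
    fun z hz a K h hK h0 h1 ha hper hbd hmod => ?_⟩
  set δ := Metric.infDist z (frontier D) with hδ
  have hδ0 : 0 < δ := infDist_frontier_pos hD hf hz
  have hθ := cutMod_pos (α := α) (μ := ν) h0
  set θ := cutMod α ν h with hθd
  have hha : 0 < h ^ (α / 2) := by positivity
  -- the minimum of the two moduli, majorized by a continuous function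
  have hmin : ∀ u : ℝ, 0 ≤ u → min (cutMod α ν u) θ ≤
      2 * C₁ * θ * (u ^ (α / 2) / (u ^ (α / 2) + h ^ (α / 2))) := by
    intro u hu
    have hua : 0 ≤ u ^ (α / 2) := by positivity
    have hp : 0 < u ^ (α / 2) + h ^ (α / 2) := by positivity
    rcases le_total u h with huh | huh
    · refine (min_le_left _ _).trans ((h₁' u h hu huh h0 h1).trans ?_)
      rw [Real.div_rpow hu h0.le]
      have e1 : u ^ (α / 2) / h ^ (α / 2) ≤ 2 * (u ^ (α / 2) / (u ^ (α / 2) + h ^ (α / 2))) := by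
        rw [mul_div_assoc', div_le_div_iff₀ hha hp]
        have : u ^ (α / 2) ≤ h ^ (α / 2) := Real.rpow_le_rpow hu huh (by positivity)
        nlinarith
      have e2 : C₁' * (u ^ (α / 2) / h ^ (α / 2)) ≤
          C₁ * (2 * (u ^ (α / 2) / (u ^ (α / 2) + h ^ (α / 2)))) :=
        mul_le_mul (le_max_left _ _) e1 (by positivity) (by linarith)
      refine (mul_le_mul_of_nonneg_right e2 hθ.le).trans (le_of_eq ?_)
      ring
    · refine (min_le_right _ _).trans ?_
      have e1 : 1 ≤ 2 * (u ^ (α / 2) / (u ^ (α / 2) + h ^ (α / 2))) := by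
        rw [mul_div_assoc', one_le_div hp]
        have : h ^ (α / 2) ≤ u ^ (α / 2) := Real.rpow_le_rpow h0.le huh (by positivity)
        linarith
      have e2 := one_le_mul_of_one_le_of_one_le hC₁1 e1
      refine (le_mul_of_one_le_right hθ.le e2).trans (le_of_eq ?_)
      ring
  have hc1 : Continuous fun u : ℝ => u ^ (α / 2) :=
    continuous_id.rpow_const fun _ => Or.inr (by positivity)
  have hc2 : Continuous fun u : ℝ => u ^ α := continuous_id.rpow_const fun _ => Or.inr hα₀.le
  have hs : ContinuousOn (fun u : ℝ => u ^ (α / 2) / (u ^ (α / 2) + h ^ (α / 2))) (Icc 0 R) :=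
    hc1.continuousOn.div (by fun_prop) fun u hu => by
      have := hu.1
      positivity
  have hi1 : IntervalIntegrable (fun u : ℝ => u ^ (α / 2) / (u ^ (α / 2) + h ^ (α / 2)) /
      (u + δ) ^ 1) MeasureTheory.volume 0 R :=
    (hs.div (by fun_prop) fun u hu => by
      have := hu.1
      positivity).intervalIntegrable_of_Icc hR0
  have hi2 : IntervalIntegrable (fun u : ℝ => u ^ α / (u + δ) ^ 1) MeasureTheory.volume 0 R :=
    (hc2.continuousOn.div (by fun_prop) fun u hu => by
      have := hu.1
      positivity).intervalIntegrable_of_Icc hR0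
  refine (hk z hz a (K * θ) (fun u => 2 * C₁ * (K * θ) * (u ^ (α / 2) /
    (u ^ (α / 2) + h ^ (α / 2))) + K * θ * u ^ α) ha hper hbd ?_
    (fun u hu => by have := hu.1; positivity) fun j s t hst => ?_).trans ?_
  · exact (continuousOn_const.mul hs).add (by fun_prop)
  · refine (hmod j t s).trans ?_
    have := mul_le_mul_of_nonneg_left (hmin _ (abs_nonneg (t - s))) hK
    linarith
  have e0 : ∀ u : ℝ, (2 * C₁ * (K * θ) * (u ^ (α / 2) / (u ^ (α / 2) + h ^ (α / 2))) +
      K * θ * u ^ α) / (u + δ) ^ 1 = 2 * C₁ * (K * θ) * (u ^ (α / 2) /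
      (u ^ (α / 2) + h ^ (α / 2)) / (u + δ) ^ 1) + K * θ * (u ^ α / (u + δ) ^ 1) := fun u => by
    ring
  simp only [← hδ, e0]
  rw [intervalIntegral.integral_add (hi1.const_mul _) (hi2.const_mul _),
    intervalIntegral.integral_const_mul, intervalIntegral.integral_const_mul]
  have hKθ : 0 ≤ K * θ := by positivity
  have f1 := integral_saturated_div_le (half_pos hα₀) h0 hδ0 hR0
  have f2 := log_add_div_le (half_pos hα₀) (by positivity) h0 h1 (le_refl (R ^ (α / 2)))
  have f3 := integral_rpow_div_le hα₀ hδ0 hR0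
  have f4 : 1 ≤ |Real.log h| / Real.log 2 := by
    rw [one_le_div hl2]
    exact log_two_le_abs_log h0 h1
  have f5 : ∫ u in (0 : ℝ)..R, u ^ (α / 2) / (u ^ (α / 2) + h ^ (α / 2)) / (u + δ) ^ 1 ≤
      c * |Real.log h| / (α / 2) := f1.trans (by gcongr)
  have g1 : 2 * C₁ * (K * θ) * ∫ u in (0 : ℝ)..R, u ^ (α / 2) / (u ^ (α / 2) + h ^ (α / 2)) /
      (u + δ) ^ 1 ≤ 2 * C₁ * (K * θ) * (c * |Real.log h| / (α / 2)) :=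
    mul_le_mul_of_nonneg_left f5 (by positivity)
  have g2 : K * θ * ∫ u in (0 : ℝ)..R, u ^ α / (u + δ) ^ 1 ≤
      K * θ * (R ^ α / α) * (|Real.log h| / Real.log 2) :=
    (mul_le_mul_of_nonneg_left f3 hKθ).trans (le_mul_of_one_le_right (by positivity) f4)
  have g3 : K * θ ≤ K * θ * (|Real.log h| / Real.log 2) := le_mul_of_one_le_right hKθ f4
  rw [← cutMod_mul_abs_log h0 h1, ← hθd]
  refine (mul_le_mul_of_nonneg_left (add_le_add g3 (add_le_add g1 g2)) hC.le).trans (le_of_eq ?_)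
  ring

end BoundaryParametrization

/-! ### Holomorphic functions with controlled derivative -/

section HardyLittlewood

variable {D : Set ℂ} {α : ℝ}

/-- A Hardy–Littlewood lemma: a holomorphic function whose derivative is bounded by `θ(δ) / δ`, where
`δ` is the distance to the boundary, has modulus of continuity `θ`. Two points at distance `h` are
joined by moving both of them by `8 h` into the domain, along a common cone direction. -/
lemma exists_holder_of_norm_deriv_le (hD : IsOpen D) (hf : (frontier D).Nonempty) {r : ℝ}
    (hr : 0 < r) (hcone : UniformCone D r) (hα₀ : 0 < α) (hα₁ : α ≤ 1) {μ : ℝ}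
    (hμ : α = 1 → 0 ≤ μ) :
    ∃ C > 0, ∀ (g g' : ℂ → ℂ) (K : ℝ), 0 ≤ K → (∀ z ∈ D, HasDerivAt g (g' z) z) →
      (∀ z ∈ D, ‖g z‖ ≤ K) → (∀ z ∈ D, ‖g' z‖ ≤ K * (cutMod α μ (Metric.infDist z (frontier D)) /
        Metric.infDist z (frontier D))) →
      ∀ z ∈ D, ∀ w ∈ D, ‖g z - g w‖ ≤ C * K * cutMod α μ ‖z - w‖ := by
  obtain ⟨C₁, hC₁, h₁⟩ := cutMod_growth_linear hα₀ hα₁ hμ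
  obtain ⟨C₂, hC₂, h₂⟩ := cutMod_mono hα₀ μ
  obtain ⟨C₃, hC₃, h₃⟩ := cutMod_decay hα₀ μ
  obtain ⟨C₄, hC₄, h₄⟩ := cutMod_dilate hα₀ μ (show (0 : ℝ) ≤ 8 by norm_num)
  set r' := min r (1 / 2) with hr'
  have hr'0 : 0 < r' := by positivity
  have hθr := cutMod_pos (α := α) (μ := μ) (show 0 < r' / 8 by positivity)
  set c := 8 * C₁ * C₂ * C₃ / (α / 2) with hc
  refine ⟨2 * C₂ / cutMod α μ (r' / 8) + 2 * (c * C₄) + 2 * C₁, by positivity,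
    fun g g' K hK hg hgK hg'K z hz w hw => ?_⟩
  -- the bound of the derivative in terms of any lower bound of the distance to the boundary
  have hball : ∀ x ρ, 0 < ρ → Metric.ball x ρ ⊆ D →
      ‖g' x‖ ≤ K * (2 * C₁ * (cutMod α μ ρ / ρ)) := by
    intro x ρ hρ hx
    have hxD : x ∈ D := hx (Metric.mem_ball_self hρ)
    refine (hg'K x hxD).trans (mul_le_mul_of_nonneg_left ?_ hK)
    have hδ : ρ ≤ Metric.infDist x (frontier D) := by
      refine (Metric.le_infDist hf).2 fun y hy => ?_
      by_contra! hlt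
      rw [hD.frontier_eq] at hy
      exact hy.2 (hx (by rwa [Metric.mem_ball, dist_comm]))
    set δ := Metric.infDist x (frontier D)
    have hδ0 : 0 < δ := hρ.trans_le hδ
    have hp := cutMod_pos (α := α) (μ := μ) hρ
    have e1 := h₁ ρ δ hρ hδ0.le
    rw [div_le_iff₀ hδ0]
    refine e1.trans ?_
    have e2 : 1 + δ / ρ ≤ 2 * (δ / ρ) := by
      have : 1 ≤ δ / ρ := (one_le_div hρ).2 hδ
      linarith
    have e3 : C₁ * (1 + δ / ρ) * cutMod α μ ρ ≤ C₁ * (2 * (δ / ρ)) * cutMod α μ ρ := by gcongr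
    refine e3.trans (le_of_eq ?_)
    ring
  set h := ‖z - w‖ with hh
  have hh0 : 0 ≤ h := norm_nonneg _
  have hθh : 0 ≤ cutMod α μ h := cutMod_nonneg hα₀ hh0
  rcases hh0.eq_or_lt with h0 | h0
  · have : z = w := by rw [← sub_eq_zero, ← norm_eq_zero]; exact h0.symm
    rw [this, sub_self, norm_zero]
    positivity
  rcases le_or_gt (r' / 8) h with hbig | hsmall
  · have e1 : ‖g z - g w‖ ≤ 2 * K := (norm_sub_le _ _).trans (by linarith [hgK z hz, hgK w hw])
    have e2 : 1 ≤ C₂ * cutMod α μ h / cutMod α μ (r' / 8) := by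
      rw [one_le_div hθr]
      exact h₂ _ _ (by positivity) hbig
    have e3 : 2 * K ≤ 2 * C₂ / cutMod α μ (r' / 8) * K * cutMod α μ h := by
      refine (le_mul_of_one_le_right (by positivity : 0 ≤ 2 * K) e2).trans (le_of_eq ?_)
      ring
    refine e1.trans (e3.trans ?_)
    gcongr
    have : 0 < 2 * (c * C₄) + 2 * C₁ := by positivity
    linarith
  set H := 8 * h with hH
  have hH0 : 0 < H := by positivity
  have hHr : H < r' := by linarith
  have hHr2 : H ≤ r := hHr.le.trans (min_le_left _ _)
  have hH1 : H ≤ 1 / 2 := hHr.le.trans (min_le_right _ _)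
  obtain ⟨v, hv, hcv⟩ := hcone z
  have hθH := cutMod_pos (α := α) (μ := μ) hH0
  have hvert : ∀ x ∈ D, ‖x - z‖ < r → ‖g (x + H * v) - g x‖ ≤ K * c * cutMod α μ H := by
    intro x hx hxz
    have hpD : ∀ s : ℝ, 0 < s → s ≤ H → x + s * v ∈ D := fun s hs hsH =>
      hcv x hx hxz s hs (hsH.trans hHr2) (Metric.mem_ball_self (by positivity))
    have hds : ∀ s : ℝ, 0 < s → s ≤ H →
        HasDerivAt (fun s : ℝ => g (x + s * v)) (g' (x + s * v) * v) s := fun s hs hsH => by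
      have e1 : HasDerivAt (fun s : ℝ => x + s * v) v s := by
        simpa using ((Complex.ofRealCLM.hasDerivAt (x := s)).mul_const v).const_add x
      exact (hg _ (hpD s hs hsH)).comp s e1
    set A := K * (8 * C₁ * C₂ * C₃) * cutMod α μ H * (H ^ (α / 2))⁻¹ with hA
    have hbd : ∀ s : ℝ, 0 < s → s ≤ H → ‖g' (x + s * v) * v‖ ≤ A * s ^ (α / 2 - 1) := by
      intro s hs hsH
      rw [norm_mul, hv, mul_one]
      have e1 := hball _ (s / 4) (by positivity) (hcv x hx hxz s hs (hsH.trans hHr2))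
      have e2 := h₂ (s / 4) s (by positivity) (by linarith)
      have e3 := h₃ s H hs.le hsH hH0 hH1
      have e4 : cutMod α μ (s / 4) ≤ C₂ * (C₃ * (s / H) ^ (α / 2) * cutMod α μ H) :=
        e2.trans (by gcongr)
      refine e1.trans ?_
      have e5 : K * (2 * C₁ * (cutMod α μ (s / 4) / (s / 4))) ≤
        K * (2 * C₁ * (C₂ * (C₃ * (s / H) ^ (α / 2) * cutMod α μ H) / (s / 4))) := by gcongr
      refine e5.trans (le_of_eq ?_)
      rw [hA, Real.div_rpow hs.le hH0.le, Real.rpow_sub_one hs.ne']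
      field_simp
      ring
    have hA0 : 0 ≤ A := by positivity
    -- the majorant `s ^ (α / 2 - 1)` of the derivative is unbounded near `0`; let `ε → 0`
    have hε : ∀ ε : ℝ, 0 < ε → ε ≤ H → ‖g (x + H * v) - g (x + ε * v)‖ ≤ K * c * cutMod α μ H := by
      intro ε hε hεH
      have hB : ∀ s : ℝ, ε ≤ s → HasDerivAt (fun s : ℝ => A * (s ^ (α / 2) / (α / 2)))
          (A * s ^ (α / 2 - 1)) s := fun s hs => by
        refine (((Real.hasDerivAt_rpow_const (p := α / 2)
          (Or.inl (hε.trans_le hs).ne')).div_const (α / 2)).const_mul A).congr_deriv ?_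
        field_simp
      have key := image_norm_le_of_norm_deriv_right_le_deriv_boundary'
        (f := fun s : ℝ => g (x + s * v) - g (x + ε * v)) (f' := fun s => g' (x + s * v) * v)
        (a := ε) (b := H)
        (B := fun s => A * (s ^ (α / 2) / (α / 2))) (B' := fun s => A * s ^ (α / 2 - 1))
        (fun s hs => (((hds s (hε.trans_le hs.1) hs.2).sub_const _).continuousAt).continuousWithinAt)
        (fun s hs => ((hds s (hε.trans_le hs.1) hs.2.le).sub_const _).hasDerivWithinAt)
        (by simp only [sub_self, norm_zero]; positivity)
        (fun s hs => (hB s hs.1).continuousAt.continuousWithinAt)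
        (fun s hs => (hB s hs.1).hasDerivWithinAt)
        (fun s hs => hbd s (hε.trans_le hs.1) hs.2.le) (right_mem_Icc.2 hεH)
      refine key.trans (le_of_eq ?_)
      have : H ^ (α / 2) ≠ 0 := by positivity
      rw [hA, hc]
      field_simp
    have hlim : Tendsto (fun ε : ℝ => ‖g (x + H * v) - g (x + ε * v)‖) (𝓝[>] 0)
        (𝓝 ‖g (x + H * v) - g x‖) := by
      have e1 : ContinuousAt g x := (hg x hx).continuousAt
      have e2 : Tendsto (fun ε : ℝ => x + ε * v) (𝓝[>] 0) (𝓝 x) := by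
        have : Continuous fun ε : ℝ => x + ε * v := by fun_prop
        exact (this.tendsto' 0 x (by simp)).mono_left nhdsWithin_le_nhds
      exact (tendsto_const_nhds.sub (e1.tendsto.comp e2)).norm
    refine le_of_tendsto hlim ?_
    filter_upwards [Ioc_mem_nhdsGT hH0] with ε hε'
    exact hε ε hε'.1 hε'.2
  have hz' := hvert z hz (by simpa using hr)
  have hw' := hvert w hw (by
    rw [norm_sub_rev, ← hh]
    have := min_le_left r (1 / 2)
    linarith)
  have hmid : ‖g (z + H * v) - g (w + H * v)‖ ≤ K * (2 * C₁ * (cutMod α μ h / h)) * h := by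
    have hb : Metric.ball (z + H * v) (2 * h) ⊆ D := by
      have := hcv z hz (by simpa using hr) H hH0 hHr2
      rwa [hH, show 8 * h / 4 = 2 * h by ring, ← hH] at this
    have hcl : ∀ x ∈ Metric.closedBall (z + H * v) h, Metric.ball x h ⊆ D := fun x hx =>
      (Metric.ball_subset_ball' (by rw [Metric.mem_closedBall] at hx; linarith)).trans hb
    have e1 := (convex_closedBall (z + H * v) h).norm_image_sub_le_of_norm_hasDerivWithin_le
      (f := g) (f' := g') (C := K * (2 * C₁ * (cutMod α μ h / h)))
      (fun x hx => (hg x (hcl x hx (Metric.mem_ball_self h0))).hasDerivWithinAt)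
      (fun x hx => hball x h h0 (hcl x hx))
      (x := w + H * v) (y := z + H * v) ?_ (Metric.mem_closedBall_self hh0)
    · rwa [add_sub_add_right_eq_sub] at e1
    · rw [Metric.mem_closedBall, dist_eq_norm, add_sub_add_right_eq_sub, norm_sub_rev]
  have hH2 : cutMod α μ H ≤ C₄ * cutMod α μ h := h₄ h hh0
  have e : g z - g w = -(g (z + H * v) - g z) + (g (z + H * v) - g (w + H * v)) +
      (g (w + H * v) - g w) := by ring
  rw [e]
  refine norm_add₃_le.trans ?_
  rw [norm_neg]
  have hc0 : 0 < c := by positivity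
  have f1 : K * c * cutMod α μ H ≤ K * c * (C₄ * cutMod α μ h) := by gcongr
  have f2 : K * (2 * C₁ * (cutMod α μ h / h)) * h = 2 * C₁ * K * cutMod α μ h := by field_simp
  have f3 : 0 ≤ 2 * C₂ / cutMod α μ (r' / 8) * K * cutMod α μ h := by positivity
  rw [f2] at hmid
  have f4 : (2 * C₂ / cutMod α μ (r' / 8) + 2 * (c * C₄) + 2 * C₁) * K * cutMod α μ h =
    2 * C₂ / cutMod α μ (r' / 8) * K * cutMod α μ h + (K * c * (C₄ * cutMod α μ h)) +
      2 * C₁ * K * cutMod α μ h + (K * c * (C₄ * cutMod α μ h)) := by ring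
  rw [f4]
  linarith

end HardyLittlewood

/-! ### Estimates of the Cauchy integrals of boundary operators -/

section Estimates

variable {𝕜 : Type*} [RCLike 𝕜] {D : Set ℂ} {m : ℕ} {α : ℝ} {Γ : BoundaryParametrization D m α}

namespace BoundaryOp

variable {p k : ℕ} {ν : ℝ} {Λ : Set 𝕜} {s : BoundaryOp Γ.n}

variable (Γ) in
lemma exists_half_period_le : ∃ R > 0, ∀ j, Γ.period j / 2 ≤ R :=
  exists_pos_forall_ge fun j => Γ.period j / 2

lemma exists_norm_cauchyOp_le {r : ℕ} (ν : ℝ) (Λ : Set 𝕜) (hα₀ : 0 < α) (hα₁ : α ≤ 1) (hm : 1 ≤ m)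
    (hD : IsOpen D) (hc : IsPreconnected D) (hf : (frontier D).Nonempty) (hs : Regular Γ p r s)
    (hr : r ≤ k) :
    ∃ C > 0, ∀ (E : (Fin 4 → ℕ) → ℂ → 𝕜 → ℂ) (N : ℝ), IsBoundaryJet Γ k α ν Λ E N →
      ∀ w ∈ D ×ˢ Λ, ‖cauchyOp Γ E s w‖ ≤ C * N := by
  obtain ⟨R, hR0, hR⟩ := exists_half_period_le Γ
  obtain ⟨C₁, hC₁, h₁⟩ := Γ.exists_kern_one_bound hm hD hc hf hR0.le hR (half_pos hα₀)
  obtain ⟨C₂, hC₂, h₂⟩ := exists_norm_eval_le ν Λ hs hr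
  obtain ⟨C₀, hC₀, h₀⟩ := cutMod_le_rpow hα₀ ν
  obtain ⟨C₃, hC₃, h₃⟩ := exists_modulus_eval (R := R) (ν := ν) (ω := fun x => x ^ (α / 2)) hα₀ hm Λ
    hs hr (fun x hx => by positivity) ⟨C₀, hC₀, fun x hx _ => h₀ x hx⟩ fun q hq j => by
      obtain ⟨M, hM, h⟩ := ((hs q hq).1 j).holder (Γ.period_pos j) hα₀ hα₁
      refine ⟨M * R ^ (α / 2), fun t u htu => (h t u).trans ?_⟩
      have e1 : |t - u| ^ α = |t - u| ^ (α / 2) * |t - u| ^ (α / 2) := by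
        rw [← Real.rpow_add_of_nonneg (abs_nonneg _) (by positivity) (by positivity), add_halves]
      have e2 : |t - u| ^ (α / 2) ≤ R ^ (α / 2) :=
        Real.rpow_le_rpow (abs_nonneg _) htu (by positivity)
      rw [e1, ← mul_assoc]
      gcongr
  refine ⟨C₁ * (C₂ + C₃), by positivity, fun E N hE w hw => ?_⟩
  have hN := hE.nonneg
  rw [mul_assoc]
  refine h₁ w.1 hw.1 _ _ (by positivity) (fun j => continuous_eval hE hs hr j hw.2)
    (fun j => eval_periodic s hs j w.2) (fun j t => ?_) fun j t u htu => ?_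
  · refine (h₂ E N hE w.2 hw.2 j t).trans ?_
    gcongr
    linarith
  · refine (h₃ E N hE w.2 hw.2 j t u htu).trans ?_
    gcongr
    linarith

/-- The derivative in `z` of the Cauchy integral of an operator of the top order `k`. If
`-1 ≤ ν < 0`, the coefficients are only Hölder continuous, which suffices because `0 ≤ ν + 1`; if
`ν < -1` they have to be more regular. -/
lemma exists_kern_two_eval_le (Λ : Set 𝕜) (hα₀ : 0 < α) (hα₁ : α ≤ 1) (hν : α = 1 → 0 ≤ ν)
    (hm : 1 ≤ m) (hD : IsOpen D) (hb : Bornology.IsBounded D) (hf : (frontier D).Nonempty)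
    (hs : Regular Γ p k s) (hp : ν < -1 → 1 ≤ p) :
    ∃ C > 0, ∀ (E : (Fin 4 → ℕ) → ℂ → 𝕜 → ℂ) (N : ℝ), IsBoundaryJet Γ k α ν Λ E N →
      ∀ w ∈ D ×ˢ Λ, ‖Γ.kern 2 (fun j t => eval Γ E s j t w.2) w.1‖ ≤
        C * N * (cutMod α (ν + 1) (Metric.infDist w.1 (frontier D)) /
          Metric.infDist w.1 (frontier D)) := by
  obtain ⟨R, hR0, hR⟩ := exists_half_period_le Γ
  obtain ⟨C₂, hC₂, h₂⟩ := exists_norm_eval_le ν Λ hs le_rfl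
  by_cases hcase : ν < -1 ∨ 0 ≤ ν
  · obtain ⟨C₁, hC₁, h₁⟩ := Γ.exists_kern_two_bound hm hD hb hf hR0.le hR hα₀ hα₁ hν
    obtain ⟨C₃, hC₃, h₃⟩ := exists_modulus_eval (R := R) (ν := ν) (ω := cutMod α ν) hα₀ hm Λ
      hs le_rfl (fun x hx => cutMod_nonneg hα₀ hx)
      ⟨1, one_pos, fun x hx _ => (one_mul (cutMod α ν x)).ge⟩ fun q hq j => by
        rcases hcase with h | h
        · obtain ⟨C, hC, hlin⟩ := linear_le_cutMod hα₀ hα₁ hν hR0.le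
          obtain ⟨p', rfl⟩ := Nat.exists_eq_add_of_le' (hp h)
          obtain ⟨M, hM, h⟩ := ((hs q hq).1 j).lipschitz (Γ.period_pos j)
          refine ⟨M * C, fun t u htu => (h t u).trans ?_⟩
          rw [mul_assoc]
          gcongr
          exact hlin _ (abs_nonneg _) htu
        · obtain ⟨C, hC, hpow⟩ := rpow_le_cutMod hα₀ h hR0.le
          obtain ⟨M, hM, h⟩ := ((hs q hq).1 j).holder (Γ.period_pos j) hα₀ hα₁
          refine ⟨M * C, fun t u htu => (h t u).trans ?_⟩
          rw [mul_assoc]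
          gcongr
          exact hpow _ (abs_nonneg _) htu
    refine ⟨C₁ * (C₂ + C₃), by positivity, fun E N hE w hw => ?_⟩
    have hN := hE.nonneg
    rw [mul_assoc C₁]
    refine h₁ w.1 hw.1 _ _ (by positivity) (fun j => continuous_eval hE hs le_rfl j hw.2)
      (fun j => eval_periodic s hs j w.2) (fun j t => ?_) fun j t u htu => ?_
    · refine (h₂ E N hE w.2 hw.2 j t).trans ?_
      gcongr
      linarith
    · refine (h₃ E N hE w.2 hw.2 j t u htu).trans ?_
      have := cutMod_nonneg (μ := ν) hα₀ (abs_nonneg (t - u))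
      gcongr
      linarith
  · push Not at hcase
    have hα : α < 1 := hα₁.lt_of_ne fun h => by linarith [hν h]
    obtain ⟨C₁, hC₁, h₁⟩ := Γ.exists_kern_two_bound_of_holder hm hD hb hf hR0.le hR hα₀ hα
      (μ := ν + 1) (by linarith)
    obtain ⟨C₀, hC₀, h₀⟩ := cutMod_le_cutMod hα₀ hcase.2.le
    obtain ⟨C₃, hC₃, h₃⟩ := exists_modulus_eval (R := R) (ν := ν) (ω := fun x => x ^ α) hα₀ hm Λ
      hs le_rfl (fun x hx => by positivity)
      ⟨C₀, hC₀, fun x hx _ => (h₀ x hx).trans (by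
        have : min x (1 / 2) ^ α ≤ x ^ α :=
          Real.rpow_le_rpow (by positivity) (min_le_left _ _) hα₀.le
        rw [cutMod, logMod, Real.rpow_zero, mul_one]
        gcongr)⟩ fun q hq j => by
        obtain ⟨M, hM, h⟩ := ((hs q hq).1 j).holder (Γ.period_pos j) hα₀ hα₁
        exact ⟨M, fun t u _ => h t u⟩
    refine ⟨C₁ * (C₂ + C₃), by positivity, fun E N hE w hw => ?_⟩
    have hN := hE.nonneg
    rw [mul_assoc C₁]
    refine h₁ w.1 hw.1 _ _ (by positivity) (fun j => continuous_eval hE hs le_rfl j hw.2)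
      (fun j => eval_periodic s hs j w.2) (fun j t => ?_) fun j t u htu => ?_
    · refine (h₂ E N hE w.2 hw.2 j t).trans ?_
      gcongr
      linarith
    · refine (h₃ E N hE w.2 hw.2 j t u htu).trans ?_
      gcongr
      linarith

lemma exists_cauchyOp_modulus_l (ν : ℝ) (Λ : Set 𝕜) (hα₀ : 0 < α) (hα₁ : α ≤ 1) (hm : 1 ≤ m)
    (hD : IsOpen D) (hc : IsPreconnected D) (hf : (frontier D).Nonempty) (hs : Regular Γ p k s)
    (hlow : ∀ q ∈ s, (∑ i, q.2 i = 0 → k = 0) ∨ ∀ j, q.1 j = fun _ => 0) :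
    ∃ C > 0, ∀ (E : (Fin 4 → ℕ) → ℂ → 𝕜 → ℂ) (N : ℝ), IsBoundaryJet Γ k α ν Λ E N →
      ∀ z ∈ D, ∀ l ∈ Λ, ∀ l' ∈ Λ, l ≠ l' → ‖l - l'‖ ≤ 1 / 2 →
        ‖cauchyOp Γ E s (z, l) - cauchyOp Γ E s (z, l')‖ ≤
          C * N * cutMod α (ν + 1) ‖l - l'‖ := by
  obtain ⟨R, hR0, hR⟩ := exists_half_period_le Γ
  obtain ⟨C₁, hC₁, h₁⟩ := Γ.exists_kern_one_bound_of_small hm hD hc hf hR0.le hR hα₀ ν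
  obtain ⟨C₂, hC₂, h₂⟩ := exists_modulus_eval_sub (ν := ν) hα₀ hα₁ hm Λ hs le_rfl hlow
  refine ⟨C₁ * C₂, by positivity, fun E N hE z hz l hl l' hl' hne hle => ?_⟩
  have hN := hE.nonneg
  have hcont := fun j => continuous_eval hE hs le_rfl j hl
  have hcont' := fun j => continuous_eval hE hs le_rfl j hl'
  unfold cauchyOp
  rw [← Γ.kern_sub hm hD 1 hcont hcont' hz, mul_assoc C₁]
  exact h₁ z hz _ _ ‖l - l'‖ (by positivity) (norm_pos_iff.2 (sub_ne_zero.2 hne)) hle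
    (fun j => (hcont j).sub (hcont' j))
    (fun j => (eval_periodic s hs j l).sub (eval_periodic s hs j l'))
    (fun j t => (h₂ E N hE l hl l' hl' j).1 t) fun j t u => (h₂ E N hE l hl l' hl' j).2 t u

lemma exists_holder_cauchyOp (Λ : Set 𝕜) (hα₀ : 0 < α) (hα₁ : α ≤ 1) (hν : α = 1 → 0 ≤ ν)
    (hm : 1 ≤ m) (hD : IsOpen D) (hc : IsPreconnected D) (hb : Bornology.IsBounded D)
    (hf : (frontier D).Nonempty) (hs : Regular Γ p k s) (hp : ν < -1 → 1 ≤ p)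
    (hlow : ∀ q ∈ s, (∑ i, q.2 i = 0 → k = 0) ∨ ∀ j, q.1 j = fun _ => 0) :
    ∃ C > 0, ∀ (E : (Fin 4 → ℕ) → ℂ → 𝕜 → ℂ) (N : ℝ), IsBoundaryJet Γ k α ν Λ E N →
      ∀ w ∈ D ×ˢ Λ, ∀ w' ∈ D ×ˢ Λ, 0 < euclidDist w w' → euclidDist w w' ≤ 1 / 2 →
        ‖cauchyOp Γ E s w' - cauchyOp Γ E s w‖ ≤
          C * N * logMod α (ν + 1) (euclidDist w w') := by
  obtain ⟨r, hr, hcone⟩ := Γ.exists_uniformCone hm hD hf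
  obtain ⟨C₀, hC₀, h₀⟩ := exists_norm_cauchyOp_le ν Λ hα₀ hα₁ hm hD hc hf hs le_rfl
  obtain ⟨C₁, hC₁, h₁⟩ := exists_kern_two_eval_le Λ hα₀ hα₁ hν hm hD hb hf hs hp
  obtain ⟨C₂, hC₂, h₂⟩ := exists_holder_of_norm_deriv_le hD hf hr hcone hα₀ hα₁ (μ := ν + 1)
    fun h => by linarith [hν h]
  obtain ⟨C₃, hC₃, h₃⟩ := exists_cauchyOp_modulus_l ν Λ hα₀ hα₁ hm hD hc hf hs hlow
  obtain ⟨C₄, hC₄, h₄⟩ := cutMod_mono hα₀ (ν + 1)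
  refine ⟨(C₂ * (C₀ + C₁) + C₃) * C₄, by positivity, fun E N hE w hw w' hw' hd0 hd1 => ?_⟩
  have hN := hE.nonneg
  rw [← cutMod_eq hd1]
  set d := euclidDist w w'
  have hp0 := cutMod_pos (α := α) (μ := ν + 1) hd0
  have f1 : ‖cauchyOp Γ E s (w'.1, w'.2) - cauchyOp Γ E s (w.1, w'.2)‖ ≤
      C₂ * ((C₀ + C₁) * N) * (C₄ * cutMod α (ν + 1) d) := by
    refine (h₂ (Γ.kern 1 fun j t => eval Γ E s j t w'.2) (Γ.kern 2 fun j t => eval Γ E s j t w'.2)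
      ((C₀ + C₁) * N) (by positivity) (fun z hz => Γ.hasDerivAt_kern_one hm hD
        (fun j => continuous_eval hE hs le_rfl j hw'.2) hz) (fun z hz => ?_) (fun z hz => ?_)
        w'.1 hw'.1 w.1 hw.1).trans ?_
    · refine (h₀ E N hE (z, w'.2) ⟨hz, hw'.2⟩).trans ?_
      gcongr
      linarith
    · refine (h₁ E N hE (z, w'.2) ⟨hz, hw'.2⟩).trans ?_
      have := cutMod_pos (α := α) (μ := ν + 1) (infDist_frontier_pos hD hf hz)
      have := infDist_frontier_pos hD hf hz
      gcongr
      linarith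
    · gcongr
      exact h₄ _ _ (norm_nonneg _) (norm_fst_le_euclidDist w w')
  have f2 : ‖cauchyOp Γ E s (w.1, w'.2) - cauchyOp Γ E s (w.1, w.2)‖ ≤
      C₃ * N * (C₄ * cutMod α (ν + 1) d) := by
    rcases eq_or_ne w'.2 w.2 with h | h
    · rw [h, sub_self, norm_zero]
      positivity
    · have hle := norm_snd_le_euclidDist w w'
      refine (h₃ E N hE w.1 hw.1 w'.2 hw'.2 w.2 hw.2 h (hle.trans hd1)).trans ?_
      gcongr
      exact h₄ _ _ (norm_nonneg _) hle
  have e : cauchyOp Γ E s w' - cauchyOp Γ E s w =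
      (cauchyOp Γ E s (w'.1, w'.2) - cauchyOp Γ E s (w.1, w'.2)) +
      (cauchyOp Γ E s (w.1, w'.2) - cauchyOp Γ E s (w.1, w.2)) := by
    rw [sub_add_sub_cancel]
  rw [e]
  refine (norm_add_le _ _).trans ((add_le_add f1 f2).trans (le_of_eq ?_))
  ring

end BoundaryOp

end Estimates

/-! ### The Cauchy singular integral -/

section Main

variable {𝕜 : Type*} [RCLike 𝕜] {D : Set ℂ} {m : ℕ} {α : ℝ}

lemma one_le_boundaryOrder (k : ℕ) (ν : ℝ) : 1 ≤ boundaryOrder k ν := by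
  unfold boundaryOrder
  split_ifs <;> omega

lemma le_boundaryOrder (k : ℕ) (ν : ℝ) : k ≤ boundaryOrder k ν := by
  unfold boundaryOrder
  split_ifs <;> omega

lemma boundaryOrder_of_lt (k : ℕ) {ν : ℝ} (h : ν < -1) : boundaryOrder k ν = k + 1 := by
  unfold boundaryOrder
  rw [if_pos h]

lemma continuousOn_cauchyIntegrand {Λ : Set 𝕜} {f : ℂ × 𝕜 → ℂ} (hD : IsOpen D)
    (hf : ContinuousOn (fun q : ℂ × 𝕜 => boundaryValue D f q.1 q.2) (frontier D ×ˢ Λ)) {z : ℂ}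
    (hz : z ∈ D) {l : 𝕜} (hl : l ∈ Λ) :
    ContinuousOn (cauchyIntegrand D f z l) (frontier D) := by
  refine ContinuousOn.div ?_ (by fun_prop) fun ζ hζ h => ?_
  · exact hf.comp (f := fun ζ : ℂ => (ζ, l)) (by fun_prop) fun ζ hζ => ⟨hζ, hl⟩
  · rw [hD.frontier_eq, sub_eq_zero.1 h] at hζ
    exact hζ.2 hz

lemma cauchyS_eq_cauchyOp {𝕜 : Type*} (Γ : BoundaryParametrization D m α)
    {E : (Fin 4 → ℕ) → ℂ → 𝕜 → ℂ} {f : ℂ × 𝕜 → ℂ} (hE : E 0 = boundaryValue D f) (w : ℂ × 𝕜) :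
    cauchyS Γ f w = (2 * Real.pi * Complex.I)⁻¹ *
      BoundaryOp.cauchyOp Γ E (BoundaryOp.one Γ) w := by
  unfold cauchyS BoundaryOp.cauchyOp BoundaryParametrization.contourIntegral
    BoundaryParametrization.kern
  congr 1
  refine Finset.sum_congr rfl fun j _ => ?_
  congr 1
  ext t
  simp only [BoundaryOp.eval, BoundaryOp.one, cauchyIntegrand, hE, List.map_cons, List.map_nil,
    List.sum_cons, List.sum_nil, one_mul, add_zero, pow_one]
  ring

lemma norm_inv_two_pi_I_le : ‖(2 * Real.pi * Complex.I : ℂ)⁻¹‖ ≤ 1 := by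
  have h := Real.pi_gt_three
  rw [norm_inv]
  refine inv_le_one_of_one_le₀ ?_
  rw [norm_mul, norm_mul, Complex.norm_I, Complex.norm_real, Real.norm_eq_abs,
    abs_of_pos Real.pi_pos, mul_one, Complex.norm_ofNat]
  linarith

/-- The estimates of all partial derivatives of a Cauchy integral, with a common constant. -/
lemma exists_partialDeriv_bound (Γ : BoundaryParametrization D m α) (k : ℕ) {ν : ℝ} {Λ : Set 𝕜}
    (hΛ : IsOpen Λ) (hα₀ : 0 < α) (hα₁ : α ≤ 1) (hν : α = 1 → 0 ≤ ν) (hm : 1 ≤ m) (hk : k ≤ m)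
    (hkν : ν < -1 → k + 1 ≤ m) (hD : IsOpen D) (hc : IsPreconnected D)
    (hb : Bornology.IsBounded D) (hf : (frontier D).Nonempty) :
    ∃ C > 0, ∀ (E : (Fin 4 → ℕ) → ℂ → 𝕜 → ℂ) (N : ℝ), IsBoundaryJet Γ k α ν Λ E N →
      ∀ g : ℂ × 𝕜 → ℂ, (∃ c : ℂ, ‖c‖ ≤ 1 ∧
        EqOn g (fun w => c * BoundaryOp.cauchyOp Γ E (BoundaryOp.one Γ) w) (D ×ˢ Λ)) →
      ∀ γ : Fin 4 → ℕ, (∑ i, γ i ≤ k → ∀ w ∈ D ×ˢ Λ, ‖partialDeriv γ g w‖ ≤ C * N) ∧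
        (∑ i, γ i = k → ∀ w ∈ D ×ˢ Λ, ∀ w' ∈ D ×ˢ Λ, 0 < euclidDist w w' →
          euclidDist w w' ≤ 1 / 2 → ‖partialDeriv γ g w' - partialDeriv γ g w‖ ≤
            C * N * logMod α (ν + 1) (euclidDist w w')) := by
  have h0 : ∀ γ : Fin 4 → ℕ, ∃ C : ℝ, ∑ i, γ i ≤ k → ∀ (E : (Fin 4 → ℕ) → ℂ → 𝕜 → ℂ) (N : ℝ),
      IsBoundaryJet Γ k α ν Λ E N → ∀ w ∈ D ×ˢ Λ,
        ‖BoundaryOp.cauchyOp Γ E (BoundaryOp.iterDiff Γ γ (BoundaryOp.one Γ)) w‖ ≤ C * N := by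
    intro γ
    by_cases hγ : ∑ i, γ i ≤ k
    · have hs := (BoundaryOp.admissible_iterDiff (Γ := Γ) hα₀ hα₁ (p := 0)
        (by omega : 0 + ∑ i, γ i ≤ m)).1
      obtain ⟨C, -, h⟩ := BoundaryOp.exists_norm_cauchyOp_le ν Λ hα₀ hα₁ hm hD hc hf hs hγ
      exact ⟨C, fun _ => h⟩
    · exact ⟨0, fun h => absurd h hγ⟩
  have h1 : ∀ γ : Fin 4 → ℕ, ∃ C : ℝ, ∑ i, γ i = k → ∀ (E : (Fin 4 → ℕ) → ℂ → 𝕜 → ℂ) (N : ℝ),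
      IsBoundaryJet Γ k α ν Λ E N → ∀ w ∈ D ×ˢ Λ, ∀ w' ∈ D ×ˢ Λ, 0 < euclidDist w w' →
        euclidDist w w' ≤ 1 / 2 →
        ‖BoundaryOp.cauchyOp Γ E (BoundaryOp.iterDiff Γ γ (BoundaryOp.one Γ)) w' -
          BoundaryOp.cauchyOp Γ E (BoundaryOp.iterDiff Γ γ (BoundaryOp.one Γ)) w‖ ≤
          C * N * logMod α (ν + 1) (euclidDist w w') := by
    intro γ
    by_cases hγ : ∑ i, γ i = k
    · subst hγ
      have hs := BoundaryOp.admissible_iterDiff (Γ := Γ) hα₀ hα₁ (γ := γ) (p := m - ∑ i, γ i)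
        (by omega)
      obtain ⟨C, -, h⟩ := BoundaryOp.exists_holder_cauchyOp Λ hα₀ hα₁ hν hm hD hc hb hf hs.1
        (fun h => by have := hkν h; omega) fun q hq => by
          by_cases h : ∑ i, γ i = 0
          · exact Or.inl fun _ => h
          · by_cases h' : ∑ i, q.2 i = 0
            · exact Or.inr (hs.2.2 h q hq h')
            · exact Or.inl fun h'' => absurd h'' h'
      exact ⟨C, fun _ => h⟩
    · exact ⟨0, fun h => absurd h hγ⟩
  choose C₀ hC₀ using h0
  choose C₁ hC₁ using h1
  -- there are only finitely many multi-indices of order at most `k`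
  have hfin : Finite (Icc (0 : Fin 4 → ℕ) fun _ => k) := (finite_Icc _ _).to_subtype
  obtain ⟨C, hC, h⟩ := exists_pos_forall_ge
    fun γ : Icc (0 : Fin 4 → ℕ) fun _ => k => max (C₀ γ) (C₁ γ)
  have hmem : ∀ γ : Fin 4 → ℕ, ∑ i, γ i ≤ k → C₀ γ ≤ C ∧ C₁ γ ≤ C := fun γ hγ => by
    have := h ⟨γ, fun _ => Nat.zero_le _, fun i =>
      (Finset.single_le_sum (fun _ _ => Nat.zero_le _) (Finset.mem_univ i)).trans hγ⟩
    exact ⟨(le_max_left _ _).trans this, (le_max_right _ _).trans this⟩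
  refine ⟨C, hC, fun E N hE g hg γ => ⟨fun hγ w hw => ?_, fun hγ w hw w' hw' hd0 hd1 => ?_⟩⟩
  · have hN := hE.nonneg
    obtain ⟨c, hc1, hcg⟩ := BoundaryOp.partialDeriv_eq_cauchyOp hE hα₀ hα₁ hm hD hΛ hγ hk hg
    rw [hcg hw, norm_mul]
    refine (mul_le_of_le_one_left (norm_nonneg _) hc1).trans ((hC₀ γ hγ E N hE w hw).trans ?_)
    gcongr
    exact (hmem γ hγ).1
  · have hN := hE.nonneg
    obtain ⟨c, hc1, hcg⟩ := BoundaryOp.partialDeriv_eq_cauchyOp hE hα₀ hα₁ hm hD hΛ hγ.le hk hg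
    rw [hcg hw, hcg hw']
    simp only
    rw [← mul_sub, norm_mul]
    refine (mul_le_of_le_one_left (norm_nonneg _) hc1).trans
      ((hC₁ γ hγ E N hE w hw w' hw' hd0 hd1).trans ?_)
    have := logMod_pos (α := α) (μ := ν + 1) hd0 hd1
    gcongr
    exact (hmem γ hγ.le).2

end Main

theorem theorem1p2 {𝕜 : Type*} [RCLike 𝕜] (k : ℕ) (α ν : ℝ) (hα₀ : 0 < α) (hα₁ : α ≤ 1)
    (hν : α = 1 → 0 ≤ ν)
    (D : Set ℂ) (hD_open : IsOpen D) (hD_conn : IsConnected D) (hD_bdd : Bornology.IsBounded D)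
    (Λ : Set 𝕜) (hΛ : IsOpen Λ) (hΛ_qc : 2 ≤ k → LocallyQuasiconvex Λ) :
    ∃ C : ℝ≥0, ∀ (Γ : BoundaryParametrization D (boundaryOrder k ν) α) (f : ℂ × 𝕜 → ℂ),
      MemLogHolder k α ν (D ×ˢ Λ) f →
        (∀ l ∈ Λ, ∀ ζ ∈ frontier D,
          Tendsto (fun z => f (z, l)) (𝓝[D] ζ) (𝓝 (boundaryValue D f ζ l))) ∧
        (∀ z ∈ D, ∀ l ∈ Λ, Γ.ContourIntegrable (cauchyIntegrand D f z l)) ∧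
        MemLogHolder k α (ν + 1) (D ×ˢ Λ) (cauchyS Γ f) ∧
        logHolderNorm k α (ν + 1) (D ×ˢ Λ) (cauchyS Γ f) ≤
          C * logHolderNorm k α ν (D ×ˢ Λ) f := by
  rcases isEmpty_or_nonempty (BoundaryParametrization D (boundaryOrder k ν) α) with hΓ | ⟨⟨Γ₀⟩⟩
  · exact ⟨0, fun Γ => hΓ.elim Γ⟩
  have hm := one_le_boundaryOrder k ν
  have hk := le_boundaryOrder k ν
  have hf := frontier_nonempty_of_bounded hD_conn.nonempty hD_bdd
  obtain ⟨C₁, hC₁, h₁⟩ := exists_isBoundaryJet Γ₀ hm hD_open hf hα₀ hα₁ hν k hΛ hΛ_qc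
  obtain ⟨C₂, hC₂, h₂⟩ := exists_partialDeriv_bound Γ₀ k hΛ hα₀ hα₁ hν hm hk
    (fun h => (boundaryOrder_of_lt k h).ge) hD_open hD_conn.isPreconnected hD_bdd hf
  refine ⟨termCount k * (C₂ * C₁).toNNReal, fun Γ f hfm => ?_⟩
  obtain ⟨hlim, hE⟩ := h₁ _ _ (hfm.isJet hD_open hΛ)
  set N := (logHolderNorm k α ν (D ×ˢ Λ) f).toReal
  set E : (Fin 4 → ℕ) → ℂ → 𝕜 → ℂ := fun β => boundaryValue D (partialDeriv β f) with hEdef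
  have hcont : ∀ z ∈ D, ∀ l ∈ Λ, ContinuousOn (cauchyIntegrand D f z l) (frontier D) :=
    fun z hz l hl => continuousOn_cauchyIntegrand hD_open (hE.continuousOn 0 (by simp)) hz hl
  -- the constants belong to `Γ₀`, but the Cauchy integral does not depend on the parametrization
  have heq : EqOn (cauchyS Γ f) (fun w => (2 * Real.pi * Complex.I)⁻¹ *
      BoundaryOp.cauchyOp Γ₀ E (BoundaryOp.one Γ₀) w) (D ×ˢ Λ) := fun w hw => by
    simp only
    rw [← cauchyS_eq_cauchyOp Γ₀ (f := f) rfl w]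
    unfold cauchyS
    rw [Γ.contourIntegral_eq hm Γ₀ hm (hcont w.1 hw.1 w.2 hw.2)]
  have hbd := h₂ E _ hE (cauchyS Γ f) ⟨_, norm_inv_two_pi_I_le, heq⟩
  have hnorm : logHolderNorm k α (ν + 1) (D ×ˢ Λ) (cauchyS Γ f) ≤
      (termCount k * (C₂ * C₁).toNNReal : ℝ≥0) * logHolderNorm k α ν (D ×ˢ Λ) f := by
    refine (logHolderNorm_le (fun β => (hbd β).1) fun β => (hbd β).2).trans (le_of_eq ?_)
    rw [← mul_assoc, ENNReal.ofReal_mul (by positivity), ENNReal.ofReal_toReal hfm.2.ne]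
    push_cast
    rw [mul_assoc]
    rfl
  refine ⟨fun l hl ζ hζ => hlim 0 (by simp) l hl ζ (frontier_subset_closure hζ),
    fun z hz l hl j => ?_, ⟨?_, ?_⟩, hnorm⟩
  · exact (Γ.continuous_contour_integrand hm (hcont z hz l hl) j).intervalIntegrable _ _
  · refine ContDiffOn.congr (contDiffOn_const.mul ?_) heq
    exact BoundaryOp.contDiffOn_cauchyOp hE hα₀ hα₁ hm hD_open hΛ hk
      (BoundaryOp.admissible_one k).1 (by omega)
  · exact hnorm.trans_lt (ENNReal.mul_lt_top ENNReal.coe_lt_top hfm.2)
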